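/- Let $\mathbb{F}$ be a field of characteristic $0$ and let $K$ be a finite group. Let $\mathbb{F}B_K$ be the Green biset functor over $\mathbb{F}$ obtained by shifting the Burnside functor $\mathbb{F}B$ by $K$: $\mathbb{F}B_K(G)=\mathbb{F}\otimes_{\mathbb{Z}} B(G\times K)$ for a finite group $G$, a finite $(H,G)$-biset $U$ acts as $\mathbb{F}B(U\times K)$, and the product $\mathbb{F}B_K(G)\times\mathbb{F}B_K(H)\to\mathbb{F}B_K(G\times H)$ sends a $(G\times K)$-set $X$ and an $(H\times K)$-set $Y$ to $X\times Y$, restricted to $G\times H\times K$ along $(g,h,k)\mapsto (g,k,h,k)$. An ideal of $\mathbb{F}B_K$ is an $\mathbb{F}B_K$-submodule of $\mathbb{F}B_K$. For a finite group $G$ and $X\leq G\times K$, let $$e_X^{G\times K}=\frac{1}{|N_{G\times K}(X)|}\sum_{Y\leq X}|Y|\,\mu(Y,X)\,[(G\times K)/Y]\in\mathbb{F}B_K(G),$$ where $\mu$ is the Möbius function of the poset of subgroups. For a finite group $L$ and $N\trianglelefteq L$, let $m_{L,N}=\frac{1}{|L|}\sum_{X\leq L,\,XN=L}|X|\,\mu(X,L)$.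 A group over $K$ is a pair $(L,\varphi)$ of a finite group $L$ and a homomorphism $\varphi:L\to K$. A morphism $(L,\varphi)\to(L',\varphi')$ is a homomorphism $f:L\to L'$ such that $i\circ\varphi=\varphi'\circ f$ for some inner automorphism $i$ of $K$. Write $(L,\varphi)\twoheadrightarrow(L',\varphi')$ if there is such a morphism with $f$ surjective, and $\cong$ for isomorphism in this category. The pair $(L,\varphi)$ is a $B_K$-group if $m_{L,N}=0$ for every non-trivial normal subgroup $N$ of $L$ contained in $\operatorname{Ker}\varphi$. For any $(L,\varphi)$, let $\beta_K(L,\varphi)=(L/Q,\varphi/Q)$, where $Q$ is a normal subgroup of $L$ contained in $\operatorname{Ker}\varphi$ and maximal such that $m_{L,Q}\neq 0$, and $\varphi/Q$ is induced by $\varphi$ (this is well defined up to isomorphism). Let $\mathsf{e}_{L,\varphi}$ be the ideal of $\mathbb{F}B_K$ generated by $e_{L_\varphi}^{L\times K}\in\mathbb{F}B_K(L)$, where $L_\varphi=\{(l,\varphi(l))\mid l\in L\}$. For $X\leq G\times K$, let $p_2:X\to K$ denote the restriction of the second projection. Theorem. 1. Let $(L,\varphi)$ be a $B_K$-group. Then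 $\mathsf{e}_{L,\varphi}$ has a unique maximal proper subideal $\mathsf{e}^0_{L,\varphi}$, namely $$\mathsf{e}_{L,\varphi}^0=\sum_{(M,\psi)}\mathsf{e}_{M,\psi},$$ where $(M,\psi)$ runs over the $B_K$-groups (up to isomorphism) such that $(M,\psi)\twoheadrightarrow(L,\varphi)$ and $(M,\psi)\ncong(L,\varphi)$. 2. The quotient $S_{L,\varphi}=\mathsf{e}_{L,\varphi}/\mathsf{e}_{L,\varphi}^0$ is a simple $\mathbb{F}B_K$-module. 3. For any finite group $G$, let $A_G$ be a set of representatives of conjugacy classes of subgroups $X$ of $G\times K$ such that $\beta_K(X,p_2)\cong(L,\varphi)$. Then the elements $e_X^{G\times K}$, for $X\in A_G$, lie in $\mathsf{e}_{L,\varphi}(G)$, and their images under the projection $\mathsf{e}_{L,\varphi}(G)\to S_{L,\varphi}(G)$ form an $\mathbb{F}$-basis of $S_{L,\varphi}(G)$ indexed by $A_G$. 4. If $I'\subset I$ are ideals of $\mathbb{F}B_K$ such that $I/I'$ is a simple $\mathbb{F}B_K$-module, then there exists a $B_K$-group $(L,\varphi)$ such that $I/I'\cong S_{L,\varphi}$ as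 $\mathbb{F}B_K$-modules. -/

import Mathlib

universe u v w

namespace ShiftedBurnside

/-! ## Finite sets with a group action, and the Burnside functor over a field -/

/-- A finite (left) `G`-set. -/
structure GSet (G : Type u) [Group G] : Type (u + 1) where
  carrier : Type u
  [finite : Finite carrier]
  [action : MulAction G carrier]

attribute [instance] GSet.finite GSet.action

instance (G : Type u) [Group G] : CoeSort (GSet G) (Type u) := ⟨GSet.carrier⟩

namespace GSet

variable {G : Type u} [Group G]

/-- Isomorphism of `G`-sets: an equivariant bijection. -/
def IsIso (X Y : GSet G) : Prop :=
  ∃ e : X ≃ Y, ∀ (g : G) (x : X), e (g • x) = g • e x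

/-- Disjoint union of `G`-sets. -/
def sum (X Y : GSet G) : GSet G where
  carrier := X ⊕ Y

/-- The transitive `G`-set `G / X`. -/
def transitive [Finite G] (X : Subgroup G) : GSet G where
  carrier := G ⧸ X

theorem IsIso.of_bijective {X Y : GSet G} (f : X → Y) (hf : Function.Bijective f)
    (h : ∀ (g : G) (x : X), f (g • x) = g • f x) : X.IsIso Y :=
  ⟨Equiv.ofBijective f hf, h⟩

end GSet

/-- The relations `[X] = [Y]` if `X ≅ Y` and `[X ⊔ Y] = [X] + [Y]`. -/
noncomputable def burnsideRelations (F : Type v) [Field F] (G : Type u) [Group G] :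
    Submodule F (GSet G →₀ F) :=
  Submodule.span F
    ({r | ∃ X Y : GSet G, X.IsIso Y ∧ r = Finsupp.single X 1 - Finsupp.single Y 1} ∪
     {r | ∃ X Y : GSet G,
        r = Finsupp.single (X.sum Y) 1 - (Finsupp.single X 1 + Finsupp.single Y 1)})

/-- `F ⊗ B(G)`, where `B(G)` is the Burnside group, i.e. the Grothendieck group of finite
`G`-sets for disjoint union: the `F`-vector space with a generator `[X]` for each finite `G`-set
`X`, subject to the relations above. -/
abbrev FB (F : Type v) [Field F] (G : Type u) [Group G] : Type (max (u + 1) v) :=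
  (GSet G →₀ F) ⧸ burnsideRelations F G

namespace FB

variable {F : Type v} [Field F] {G : Type u} [Group G]

variable (F) in
/-- The class `[X]` of a finite `G`-set `X`. -/
noncomputable def cls (X : GSet G) : FB F G :=
  (burnsideRelations F G).mkQ (Finsupp.single X 1)

theorem cls_iso {X Y : GSet G} (h : X.IsIso Y) : cls F X = cls F Y := by
  rw [← sub_eq_zero, cls, cls, ← map_sub]
  exact (Submodule.Quotient.mk_eq_zero _).2
    (Submodule.subset_span (Or.inl ⟨X, Y, h, rfl⟩))

theorem cls_sum (X Y : GSet G) : cls F (X.sum Y) = cls F X + cls F Y := by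
  rw [← sub_eq_zero, cls, cls, cls, ← map_add, ← map_sub]
  exact (Submodule.Quotient.mk_eq_zero _).2 (Submodule.subset_span (Or.inr ⟨X, Y, rfl⟩))

/-- Universal property: an isomorphism-invariant additive function on finite `G`-sets extends
linearly to `FB F G`. -/
noncomputable def lift {M : Type*} [AddCommGroup M] [Module F M] (f : GSet G → M)
    (h_iso : ∀ X Y : GSet G, X.IsIso Y → f X = f Y)
    (h_sum : ∀ X Y : GSet G, f (X.sum Y) = f X + f Y) : FB F G →ₗ[F] M :=
  (burnsideRelations F G).liftQ (Finsupp.linearCombination F f) (by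
    rw [burnsideRelations, Submodule.span_le]
    rintro r (⟨X, Y, h, rfl⟩ | ⟨X, Y, rfl⟩)
    · simp [h_iso X Y h]
    · simp [h_sum X Y])

@[simp] theorem lift_cls {M : Type*} [AddCommGroup M] [Module F M] (f : GSet G → M)
    (h_iso : ∀ X Y : GSet G, X.IsIso Y → f X = f Y)
    (h_sum : ∀ X Y : GSet G, f (X.sum Y) = f X + f Y) (X : GSet G) :
    lift (F := F) f h_iso h_sum (cls F X) = f X := by
  simp [lift, cls]

theorem hom_ext {M : Type*} [AddCommGroup M] [Module F M] {f g : FB F G →ₗ[F] M}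
    (h : ∀ X : GSet G, f (cls F X) = g (cls F X)) : f = g := by
  refine Submodule.linearMap_qext _ (Finsupp.lhom_ext' fun X => ?_)
  ext
  exact h X

end FB

/-! ## Bisets -/

/-- A finite `(H, G)`-biset: a finite set with commuting left `H`-action and right `G`-action. -/
structure Biset (H G : Type u) [Group H] [Group G] : Type (u + 1) where
  carrier : Type u
  [finite : Finite carrier]
  [left : MulAction H carrier]
  [right : MulAction Gᵐᵒᵖ carrier]
  [comm : SMulCommClass H Gᵐᵒᵖ carrier]

attribute [instance] Biset.finite Biset.left Biset.right Biset.comm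

instance (H G : Type u) [Group H] [Group G] : CoeSort (Biset H G) (Type u) := ⟨Biset.carrier⟩

section Tensor

variable (H : Type u) [Group H] (V U : Type u) [MulAction Hᵐᵒᵖ V] [MulAction H U]

/-- The orbit relation on `V × U` of the action `(v, u) · h = (v h, h⁻¹ u)`. -/
def tensorSetoid : Setoid (V × U) where
  r p q := ∃ h : H, q = (MulOpposite.op h • p.1, h⁻¹ • p.2)
  iseqv :=
    { refl := fun p => ⟨1, by simp⟩
      symm := by
        rintro p q ⟨h, rfl⟩
        exact ⟨h⁻¹, by simp [smul_smul]⟩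
      trans := by
        rintro p q r ⟨h, rfl⟩ ⟨h', rfl⟩
        exact ⟨h * h', by simp [smul_smul]⟩ }

/-- `V ×_H U = (V × U) / H`. -/
def TensorOver : Type u := Quotient (tensorSetoid H V U)

instance [Finite V] [Finite U] : Finite (TensorOver H V U) :=
  Quotient.finite _

variable {H V U}

/-- The class of `(v, u)` in `V ×_H U`. -/
def TensorOver.mk (v : V) (u : U) : TensorOver H V U := Quotient.mk _ (v, u)

theorem TensorOver.mk_eq_iff {v v' : V} {u u' : U} :
    (TensorOver.mk v u : TensorOver H V U) = TensorOver.mk v' u' ↔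
      ∃ h : H, v' = MulOpposite.op h • v ∧ u' = h⁻¹ • u := by
  refine Quotient.eq.trans ?_
  exact exists_congr fun h => Prod.mk_inj

theorem TensorOver.mk_smul (v : V) (h : H) (u : U) :
    (TensorOver.mk (MulOpposite.op h • v) u : TensorOver H V U) = TensorOver.mk v (h • u) :=
  (TensorOver.mk_eq_iff.2 ⟨h, rfl, by simp⟩).symm

theorem TensorOver.ind {p : TensorOver H V U → Prop} (h : ∀ v u, p (TensorOver.mk v u)) :
    ∀ t, p t := fun t => Quotient.inductionOn t fun a => h a.1 a.2

/-- Functions out of `V ×_H U`. -/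
def TensorOver.lift {T : Type*} (f : V → U → T)
    (hf : ∀ v (h : H) u, f (MulOpposite.op h • v) (h⁻¹ • u) = f v u) : TensorOver H V U → T :=
  Quotient.lift (fun p => f p.1 p.2) (by
    rintro p q ⟨h, rfl⟩
    exact (hf p.1 h p.2).symm)

variable (H V U)

/-- Left action on `V ×_H U` coming from a left action on `V`. -/
abbrev tensorLeft (K : Type u) [Group K] [MulAction K V] [SMulCommClass K Hᵐᵒᵖ V] :
    MulAction K (TensorOver H V U) where
  smul k := TensorOver.lift (fun v u => TensorOver.mk (k • v) u) (by
    intro v h u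
    rw [smul_comm, TensorOver.mk_smul, smul_inv_smul])
  one_smul := TensorOver.ind fun v u => congrArg (TensorOver.mk · u) (one_smul K v)
  mul_smul k k' := TensorOver.ind fun v u => congrArg (TensorOver.mk · u) (mul_smul k k' v)

/-- Right action on `V ×_H U` coming from a right action on `U`. -/
abbrev tensorRight (G : Type u) [Group G] [MulAction Gᵐᵒᵖ U] [SMulCommClass H Gᵐᵒᵖ U] :
    MulAction Gᵐᵒᵖ (TensorOver H V U) where
  smul g := TensorOver.lift (fun v u => TensorOver.mk v (g • u)) (by
    intro v h u
    rw [TensorOver.mk_smul, smul_comm, smul_inv_smul])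
  one_smul := TensorOver.ind fun v u => congrArg (TensorOver.mk v) (one_smul Gᵐᵒᵖ u)
  mul_smul k k' := TensorOver.ind fun v u => congrArg (TensorOver.mk v) (mul_smul k k' u)

end Tensor

namespace Biset

variable {G H J G' H' : Type u} [Group G] [Group H] [Group J] [Group G'] [Group H']

/-- Isomorphism of bisets. -/
def IsIso (U V : Biset H G) : Prop :=
  ∃ e : U ≃ V, (∀ (h : H) (u : U), e (h • u) = h • e u) ∧
    ∀ (g : G) (u : U), e (MulOpposite.op g • u) = MulOpposite.op g • e u

/-- Disjoint union of bisets. -/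
def sum (U V : Biset H G) : Biset H G where
  carrier := U ⊕ V
  comm := ⟨by rintro h g (u | v) <;> simp [smul_comm]⟩

variable (G) in
/-- The identity biset: `G`, acting on itself by left and right multiplication. -/
def id [Finite G] : Biset G G where
  carrier := G

/-- The right `G`-action `u · g = u f(g)` on `H`. -/
abbrev ofIsoRight (f : G ≃* H) : MulAction Gᵐᵒᵖ H where
  smul := fun g u => u * f g.unop
  one_smul := fun u => show u * f 1 = u by simp
  mul_smul := fun g g' u => show u * f (g'.unop * g.unop) = u * f g'.unop * f g.unop by
    simp [mul_assoc]

/-- `Iso(f)`: the set `H`, with action `h · u · g = h u f(g)`. -/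
def ofIso [Finite H] (f : G ≃* H) : Biset H G where
  carrier := H
  right := ofIsoRight f
  comm := by
    let _ := ofIsoRight f
    exact ⟨fun h g u => (mul_assoc h u (f g.unop)).symm⟩

/-- Composition of bisets: `V ×_H U`. -/
def comp (V : Biset J H) (U : Biset H G) : Biset J G where
  carrier := TensorOver H V U
  left := tensorLeft H V U J
  right := tensorRight H V U G
  comm := by
    let _ := tensorLeft H V U J
    let _ := tensorRight H V U G
    exact ⟨fun k g => TensorOver.ind fun v u => rfl⟩

/-- The `H`-set `U ×_G X`, for an `(H, G)`-biset `U` and a `G`-set `X`. -/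
def tensor (U : Biset H G) (X : GSet G) : GSet H where
  carrier := TensorOver G U X
  action := tensorLeft G U X H

/-- The action `(h, h') · (u, v) = (h u, h' v)` on `U × V`. -/
abbrev prodLeft (U : Biset H G) (V : Biset H' G') : MulAction (H × H') (U × V) where
  smul := fun h p => (h.1 • p.1, h.2 • p.2)
  one_smul := fun p => Prod.ext (one_smul H p.1) (one_smul H' p.2)
  mul_smul := fun h k p => Prod.ext (mul_smul h.1 k.1 p.1) (mul_smul h.2 k.2 p.2)

/-- The action `(u, v) · (g, g') = (u g, v g')` on `U × V`. -/
abbrev prodRight (U : Biset H G) (V : Biset H' G') : MulAction (G × G')ᵐᵒᵖ (U × V) where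
  smul := fun g p => (MulOpposite.op g.unop.1 • p.1, MulOpposite.op g.unop.2 • p.2)
  one_smul := fun p => Prod.ext (one_smul Gᵐᵒᵖ p.1) (one_smul G'ᵐᵒᵖ p.2)
  mul_smul := fun g k p => Prod.ext
    (mul_smul (MulOpposite.op g.unop.1) (MulOpposite.op k.unop.1) p.1)
    (mul_smul (MulOpposite.op g.unop.2) (MulOpposite.op k.unop.2) p.2)

/-- The external product: `U × V` as an `(H × H', G × G')`-biset. -/
def prod (U : Biset H G) (V : Biset H' G') : Biset (H × H') (G × G') where
  carrier := U × V
  left := prodLeft U V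
  right := prodRight U V
  comm := by
    let _ := prodLeft U V
    let _ := prodRight U V
    exact ⟨fun h g p => Prod.ext (smul_comm h.1 (MulOpposite.op g.unop.1) p.1)
      (smul_comm h.2 (MulOpposite.op g.unop.2) p.2)⟩

/-! ### Compatibilities of these constructions -/

theorem tensor_iso (U : Biset H G) {X Y : GSet G} (h : X.IsIso Y) :
    (U.tensor X).IsIso (U.tensor Y) := by
  obtain ⟨e, he⟩ := h
  refine GSet.IsIso.of_bijective
    (TensorOver.lift (fun u x => (TensorOver.mk u (e x) : TensorOver G U Y)) ?_) ⟨?_, ?_⟩ ?_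
  · intro u g x
    rw [he, TensorOver.mk_smul, smul_inv_smul]
  · refine TensorOver.ind fun u x => TensorOver.ind fun u' x' h => ?_
    obtain ⟨g, h1, h2⟩ := TensorOver.mk_eq_iff.1 h
    exact TensorOver.mk_eq_iff.2 ⟨g, h1, e.injective (by rw [h2, he])⟩
  · refine TensorOver.ind fun u y => ⟨TensorOver.mk u (e.symm y), ?_⟩
    exact congrArg (TensorOver.mk u) (e.apply_symm_apply y)
  · exact fun h => TensorOver.ind fun u x => rfl

theorem iso_tensor {U V : Biset H G} (h : U.IsIso V) (X : GSet G) :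
    (U.tensor X).IsIso (V.tensor X) := by
  obtain ⟨e, hl, hr⟩ := h
  refine GSet.IsIso.of_bijective
    (TensorOver.lift (fun u x => (TensorOver.mk (e u) x : TensorOver G V X)) ?_) ⟨?_, ?_⟩ ?_
  · intro u g x
    rw [hr, TensorOver.mk_smul, smul_inv_smul]
  · refine TensorOver.ind fun u x => TensorOver.ind fun u' x' h => ?_
    obtain ⟨g, h1, h2⟩ := TensorOver.mk_eq_iff.1 h
    exact TensorOver.mk_eq_iff.2 ⟨g, e.injective (by rw [h1, hr]), h2⟩
  · refine TensorOver.ind fun v x => ⟨TensorOver.mk (e.symm v) x, ?_⟩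
    exact congrArg (TensorOver.mk · x) (e.apply_symm_apply v)
  · exact fun h => TensorOver.ind fun u x => congrArg (TensorOver.mk · x) (hl h u)

theorem tensor_sum (U : Biset H G) (X Y : GSet G) :
    (U.tensor (X.sum Y)).IsIso ((U.tensor X).sum (U.tensor Y)) := by
  refine GSet.IsIso.of_bijective
    (TensorOver.lift (fun u (p : X ⊕ Y) => (p.map (TensorOver.mk u) (TensorOver.mk u) :
      TensorOver G U X ⊕ TensorOver G U Y)) ?_) ⟨?_, ?_⟩ ?_
  · rintro u g (x | y)
    · exact congrArg Sum.inl (by rw [TensorOver.mk_smul, smul_inv_smul])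
    · exact congrArg Sum.inr (by rw [TensorOver.mk_smul, smul_inv_smul])
  · refine TensorOver.ind fun u p => TensorOver.ind fun u' p' h => ?_
    rcases p with x | y <;> rcases p' with x' | y'
    · obtain ⟨g, h1, h2⟩ := TensorOver.mk_eq_iff.1 (Sum.inl_injective h)
      exact TensorOver.mk_eq_iff.2 ⟨g, h1, congrArg Sum.inl h2⟩
    · exact (Sum.inl_ne_inr h).elim
    · exact (Sum.inr_ne_inl h).elim
    · obtain ⟨g, h1, h2⟩ := TensorOver.mk_eq_iff.1 (Sum.inr_injective h)
      exact TensorOver.mk_eq_iff.2 ⟨g, h1, congrArg Sum.inr h2⟩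
  · rintro (t | t)
    · revert t
      exact TensorOver.ind fun u x =>
        ⟨(TensorOver.mk u (Sum.inl x) : TensorOver G U (X ⊕ Y)), rfl⟩
    · revert t
      exact TensorOver.ind fun u y =>
        ⟨(TensorOver.mk u (Sum.inr y) : TensorOver G U (X ⊕ Y)), rfl⟩
  · refine fun h => TensorOver.ind fun u p => ?_
    rcases p with x | y <;> rfl

theorem sum_tensor (U V : Biset H G) (X : GSet G) :
    ((U.sum V).tensor X).IsIso ((U.tensor X).sum (V.tensor X)) := by
  refine GSet.IsIso.of_bijective
    (TensorOver.lift (fun (p : U ⊕ V) (x : X) => (p.map (TensorOver.mk · x) (TensorOver.mk · x) :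
      TensorOver G U X ⊕ TensorOver G V X)) ?_) ⟨?_, ?_⟩ ?_
  · rintro (u | v) g x
    · exact congrArg Sum.inl ((TensorOver.mk_smul u g _).trans (by rw [smul_inv_smul]))
    · exact congrArg Sum.inr ((TensorOver.mk_smul v g _).trans (by rw [smul_inv_smul]))
  · refine TensorOver.ind fun p x => TensorOver.ind fun p' x' h => ?_
    rcases p with u | v <;> rcases p' with u' | v'
    · obtain ⟨g, h1, h2⟩ := TensorOver.mk_eq_iff.1 (Sum.inl_injective h)
      exact TensorOver.mk_eq_iff.2 ⟨g, congrArg Sum.inl h1, h2⟩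
    · exact (Sum.inl_ne_inr h).elim
    · exact (Sum.inr_ne_inl h).elim
    · obtain ⟨g, h1, h2⟩ := TensorOver.mk_eq_iff.1 (Sum.inr_injective h)
      exact TensorOver.mk_eq_iff.2 ⟨g, congrArg Sum.inr h1, h2⟩
  · rintro (t | t)
    · revert t
      exact TensorOver.ind fun u x =>
        ⟨(TensorOver.mk (Sum.inl u) x : TensorOver G (U ⊕ V) X), rfl⟩
    · revert t
      exact TensorOver.ind fun u x =>
        ⟨(TensorOver.mk (Sum.inr u) x : TensorOver G (U ⊕ V) X), rfl⟩
  · refine fun h => TensorOver.ind fun p x => ?_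
    rcases p with u | v <;> rfl

theorem id_tensor [Finite G] (X : GSet G) : ((Biset.id G).tensor X).IsIso X := by
  refine GSet.IsIso.of_bijective
    (TensorOver.lift (fun (g : G) (x : X) => g • x) ?_) ⟨?_, ?_⟩ ?_
  · intro (g : G) h x
    exact (smul_smul (g * h) h⁻¹ x).trans (by rw [mul_inv_cancel_right])
  · refine TensorOver.ind fun (g : G) x => TensorOver.ind fun (g' : G) x' h => ?_
    refine TensorOver.mk_eq_iff.2 ⟨g⁻¹ * g', (by exact (mul_inv_cancel_left g g').symm), ?_⟩
    replace h : g • x = g' • x' := h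
    rw [mul_inv_rev, inv_inv, mul_smul, h, inv_smul_smul]
  · exact fun x => ⟨(TensorOver.mk (1 : G) x : TensorOver G (Biset.id G) X), one_smul G x⟩
  · exact fun h => TensorOver.ind fun (g : G) x => mul_smul h g x

theorem comp_tensor (V : Biset J H) (U : Biset H G) (X : GSet G) :
    ((V.comp U).tensor X).IsIso (V.tensor (U.tensor X)) := by
  let _ := tensorLeft H V U J
  let _ := tensorRight H V U G
  let _ := tensorLeft G U X H
  refine GSet.IsIso.of_bijective
    (TensorOver.lift (fun (t : TensorOver H V U) (x : X) => TensorOver.lift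
      (fun (v : V) (u : U) => (TensorOver.mk v (TensorOver.mk u x : TensorOver G U X) :
        TensorOver H V (TensorOver G U X))) ?_ t) ?_) ⟨?_, ?_⟩ ?_
  · intro v h u
    refine (TensorOver.mk_smul v h _).trans (congrArg (TensorOver.mk v) ?_)
    exact smul_inv_smul h (TensorOver.mk u x : TensorOver G U X)
  · refine TensorOver.ind fun v u => fun g x => congrArg (TensorOver.mk v) ?_
    exact (TensorOver.mk_smul u g _).trans (congrArg (TensorOver.mk u) (smul_inv_smul g x))
  · refine TensorOver.ind fun t x => TensorOver.ind fun t' x' => ?_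
    revert t t'
    refine TensorOver.ind fun v u => TensorOver.ind fun v' u' => fun h => ?_
    obtain ⟨a, h1, h2⟩ := TensorOver.mk_eq_iff.1 h
    replace h2 : (TensorOver.mk u' x' : TensorOver G U X) = TensorOver.mk (a⁻¹ • u) x := h2
    obtain ⟨g, h3, h4⟩ := TensorOver.mk_eq_iff.1 h2.symm
    refine TensorOver.mk_eq_iff.2 ⟨g, ?_, h4⟩
    refine (TensorOver.mk_eq_iff.2 ⟨a, h1, ?_⟩ : TensorOver.mk v (MulOpposite.op g • u) = _).symm
    exact h3.trans (smul_comm a⁻¹ (MulOpposite.op g) u).symm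
  · refine TensorOver.ind fun v t => ?_
    revert t
    exact TensorOver.ind fun u x => ⟨(TensorOver.mk (TensorOver.mk v u : TensorOver H V U) x :
      TensorOver G (TensorOver H V U) X), rfl⟩
  · refine fun j => TensorOver.ind fun t x => ?_
    revert t
    exact TensorOver.ind fun v u => rfl

theorem prod_iso {U V : Biset H G} (h : U.IsIso V) (W : Biset H' G') :
    (U.prod W).IsIso (V.prod W) := by
  obtain ⟨e, hl, hr⟩ := h
  exact ⟨e.prodCongr (Equiv.refl _), fun h p => Prod.ext (hl h.1 p.1) rfl,
    fun g p => Prod.ext (hr g.1 p.1) rfl⟩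

theorem sum_prod (U V : Biset H G) (W : Biset H' G') :
    ((U.sum V).prod W).IsIso ((U.prod W).sum (V.prod W)) := by
  refine ⟨Equiv.sumProdDistrib U V W, ?_, ?_⟩
  · rintro h ⟨u | v, w⟩ <;> rfl
  · rintro g ⟨u | v, w⟩ <;> rfl

theorem id_prod_id [Finite G] [Finite G'] :
    ((Biset.id G).prod (Biset.id G')).IsIso (Biset.id (G × G')) :=
  ⟨Equiv.refl (G × G'), fun _ _ => rfl, fun _ _ => rfl⟩

theorem comp_prod_id [Finite G'] (V : Biset J H) (U : Biset H G) :
    ((V.comp U).prod (Biset.id G')).IsIso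
      ((V.prod (Biset.id G')).comp (U.prod (Biset.id G'))) := by
  let _ : MulAction (H × G')ᵐᵒᵖ (V × G') := (V.prod (Biset.id G')).right
  let _ : MulAction (H × G') (U × G') := (U.prod (Biset.id G')).left
  let T := TensorOver (H × G') (V × G') (U × G')
  let f : TensorOver H V U × G' → T := fun p => TensorOver.lift
    (fun v u => (TensorOver.mk (v, p.2) (u, (1 : G')) : T)) (by
      intro v h u
      refine (TensorOver.mk_eq_iff.2 ⟨(h, (1 : G')), ?_, ?_⟩).symm
      · exact Prod.ext rfl (mul_one p.2).symm
      · exact Prod.ext rfl (by simp : (1 : G') = (1 : G')⁻¹ * 1)) p.1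
  have f_mk : ∀ v u (k : G'), f (TensorOver.mk v u, k) = TensorOver.mk (v, k) (u, (1 : G')) :=
    fun _ _ _ => rfl
  have key : ∀ (v : V) (u : U) (k l : G'),
      (TensorOver.mk (v, k) (u, l) : T) = TensorOver.mk (v, k * l) (u, (1 : G')) := by
    intro v u k l
    refine TensorOver.mk_eq_iff.2 ⟨((1 : H), l), ?_, ?_⟩
    · exact Prod.ext (one_smul Hᵐᵒᵖ v).symm rfl
    · exact Prod.ext (by simp : u = (1 : H)⁻¹ • u) (inv_mul_cancel l).symm
  refine ⟨Equiv.ofBijective f ⟨?_, ?_⟩, ?_, ?_⟩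
  · rintro ⟨t, (k : G')⟩ ⟨t', (k' : G')⟩
    revert t t'
    refine TensorOver.ind fun v u => TensorOver.ind fun v' u' => fun h => ?_
    replace h := (f_mk v u k).symm.trans (h.trans (f_mk v' u' k'))
    obtain ⟨⟨a, b⟩, h1, h2⟩ := TensorOver.mk_eq_iff.1 h
    have hb : (1 : G') = b⁻¹ * 1 := congrArg Prod.snd h2
    have hb' : b = 1 := by simpa using hb
    subst hb'
    have hk : k' = k * 1 := congrArg Prod.snd h1
    refine Prod.ext ?_ (by exact (hk.trans (mul_one k)).symm)
    exact TensorOver.mk_eq_iff.2 ⟨a, congrArg Prod.fst h1, congrArg Prod.fst h2⟩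
  · refine TensorOver.ind ?_
    rintro ⟨v, (k : G')⟩ ⟨u, (l : G')⟩
    exact ⟨(TensorOver.mk v u, k * l), (key v u k l).symm⟩
  · rintro ⟨a, b⟩ ⟨t, (k : G')⟩
    revert t
    exact TensorOver.ind fun v u => rfl
  · rintro ⟨a, b⟩ ⟨t, (k : G')⟩
    revert t
    refine TensorOver.ind fun v u => ?_
    refine Eq.trans ?_ (key v (MulOpposite.op a • u) k (1 * b)).symm
    rw [one_mul]
    rfl

theorem ofIso_prod_id_tensor [Finite H] [Finite J] (f : G ≃* H) {X : GSet (G × J)}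
    {Y : GSet (H × J)} (e : X ≃ Y)
    (he : ∀ (g : G) (j : J) (x : X), e ((g, j) • x) = (f g, j) • e x) :
    (((Biset.ofIso f).prod (Biset.id J)).tensor X).IsIso Y := by
  let _ : MulAction (G × J)ᵐᵒᵖ (H × J) := ((Biset.ofIso f).prod (Biset.id J)).right
  let W := TensorOver (G × J) (H × J) X
  refine GSet.IsIso.of_bijective
    (TensorOver.lift (fun (p : H × J) (x : X) => p • e x) ?_) ⟨?_, ?_⟩ ?_
  · rintro ⟨(h : H), (j : J)⟩ ⟨g, k⟩ x
    have : e ((g, k)⁻¹ • x) = (f g, k)⁻¹ • e x := by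
      rw [Prod.inv_mk, he]
      simp
    rw [this]
    change ((h * f g, j * k) : H × J) • (f g, k)⁻¹ • e x = _
    rw [smul_smul]
    simp only [Prod.inv_mk, Prod.mk_mul_mk, mul_inv_cancel_right]
    rfl
  · refine TensorOver.ind fun (p : H × J) x => TensorOver.ind fun (q : H × J) x' h => ?_
    replace h : p • e x = q • e x' := h
    refine TensorOver.mk_eq_iff.2 ⟨(f.symm (p.1⁻¹ * q.1), p.2⁻¹ * q.2), ?_, ?_⟩
    · refine Prod.ext ?_ ?_
      · change q.1 = p.1 * f (f.symm (p.1⁻¹ * q.1))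
        simp
      · change q.2 = p.2 * (p.2⁻¹ * q.2)
        simp
    · apply e.injective
      rw [Prod.inv_mk, he, map_inv, MulEquiv.apply_symm_apply]
      change _ = (p⁻¹ * q)⁻¹ • e x
      rw [mul_inv_rev, inv_inv, mul_smul, h, inv_smul_smul]
  · intro y
    exact ⟨(TensorOver.mk (1 : H × J) (e.symm y) : W), by
      change (1 : H × J) • e (e.symm y) = y
      simp⟩
  · exact fun h => TensorOver.ind fun (p : H × J) x => mul_smul h p (e x)

end Biset

/-- The linear map `FB(U) : FB(G) → FB(H)`, `[X] ↦ [U ×_G X]`, for an `(H, G)`-biset `U`. -/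
noncomputable def FB.map (F : Type v) [Field F] {G H : Type u} [Group G] [Group H]
    (U : Biset H G) : FB F G →ₗ[F] FB F H :=
  FB.lift (fun X => FB.cls F (U.tensor X))
    (fun _ _ h => FB.cls_iso (U.tensor_iso h))
    (fun X Y => (FB.cls_iso (U.tensor_sum X Y)).trans (FB.cls_sum _ _))

@[simp] theorem FB.map_cls (F : Type v) [Field F] {G H : Type u} [Group G] [Group H]
    (U : Biset H G) (X : GSet G) : FB.map F U (FB.cls F X) = FB.cls F (U.tensor X) :=
  FB.lift_cls _ _ _ X

namespace FB

variable (F : Type v) [Field F] {G H J : Type u} [Group G] [Group H] [Group J]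

theorem map_iso {U V : Biset H G} (h : U.IsIso V) : FB.map F U = FB.map F V :=
  FB.hom_ext fun X => by simpa using FB.cls_iso (Biset.iso_tensor h X)

theorem map_sum (U V : Biset H G) : FB.map F (U.sum V) = FB.map F U + FB.map F V :=
  FB.hom_ext fun X => by
    simpa using (FB.cls_iso (Biset.sum_tensor U V X)).trans (FB.cls_sum _ _)

theorem map_id [Finite G] : FB.map F (Biset.id G) = LinearMap.id :=
  FB.hom_ext fun X => by simpa using FB.cls_iso (Biset.id_tensor X)

theorem map_comp (V : Biset J H) (U : Biset H G) :
    FB.map F (V.comp U) = FB.map F V ∘ₗ FB.map F U :=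
  FB.hom_ext fun X => by simpa using FB.cls_iso (Biset.comp_tensor V U X)

end FB

/-! ## Biset functors, Green biset functors and their modules -/

/-- A biset functor over `F`: an `F`-linear functor from the biset category `F𝒞` to `F`-vector
spaces. As `Hom(G, H)` in `F𝒞` is the `F`-vector space generated by the finite `(H, G)`-bisets
subject to `[U] = [V]` for `U ≅ V` and `[U ⊔ V] = [U] + [V]`, such a functor is given by its
values on finite groups and on finite bisets. -/
structure BisetFunctor (F : Type v) [Field F] where
  obj : ∀ (G : Type u) [Group G] [Finite G], Type w
  [addCommGroup : ∀ (G : Type u) [Group G] [Finite G], AddCommGroup (obj G)]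
  [module : ∀ (G : Type u) [Group G] [Finite G], Module F (obj G)]
  map : ∀ {G H : Type u} [Group G] [Finite G] [Group H] [Finite H],
    Biset H G → (obj G →ₗ[F] obj H)
  map_iso : ∀ {G H : Type u} [Group G] [Finite G] [Group H] [Finite H] {U V : Biset H G},
    U.IsIso V → map U = map V
  map_sum : ∀ {G H : Type u} [Group G] [Finite G] [Group H] [Finite H] (U V : Biset H G),
    map (U.sum V) = map U + map V
  map_id : ∀ (G : Type u) [Group G] [Finite G], map (Biset.id G) = LinearMap.id
  map_comp : ∀ {G H J : Type u} [Group G] [Finite G] [Group H] [Finite H] [Group J] [Finite J]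
    (V : Biset J H) (U : Biset H G), map (V.comp U) = map V ∘ₗ map U

attribute [instance] BisetFunctor.addCommGroup BisetFunctor.module

/-- A Green biset functor over `F`: a biset functor `A` with bilinear products
`A(G) × A(H) → A(G × H)`, bifunctorial, associative and unital (the latter two up to the canonical
isomorphisms `(G × H) × J ≅ G × (H × J)`, `1 × G ≅ G` and `G × 1 ≅ G`). -/
structure GreenBisetFunctor (F : Type v) [Field F] extends BisetFunctor.{u, v, w} F where
  mul : ∀ {G H : Type u} [Group G] [Finite G] [Group H] [Finite H],
    obj G →ₗ[F] obj H →ₗ[F] obj (G × H)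
  one : obj PUnit.{u + 1}
  mul_map : ∀ {G G' H H' : Type u} [Group G] [Finite G] [Group G'] [Finite G']
    [Group H] [Finite H] [Group H'] [Finite H'] (U : Biset G' G) (V : Biset H' H)
    (a : obj G) (b : obj H), mul (map U a) (map V b) = map (U.prod V) (mul a b)
  mul_assoc : ∀ {G H J : Type u} [Group G] [Finite G] [Group H] [Finite H] [Group J] [Finite J]
    (a : obj G) (b : obj H) (c : obj J),
    map (Biset.ofIso (MulEquiv.prodAssoc (M := G) (N := H) (P := J))) (mul (mul a b) c) =
      mul a (mul b c)
  one_mul : ∀ {G : Type u} [Group G] [Finite G] (a : obj G),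
    map (Biset.ofIso (MulEquiv.uniqueProd (M := G) (N := PUnit.{u + 1}))) (mul one a) = a
  mul_one : ∀ {G : Type u} [Group G] [Finite G] (a : obj G),
    map (Biset.ofIso (MulEquiv.prodUnique (M := G) (N := PUnit.{u + 1}))) (mul a one) = a

/-- A (left) module `M` over a Green biset functor `A`: a biset functor with bilinear products
`A(G) × M(H) → M(G × H)`, bifunctorial, associative and unital. -/
structure GreenModule {F : Type v} [Field F] (A : GreenBisetFunctor.{u, v, w} F) extends
    BisetFunctor.{u, v, w} F where
  act : ∀ {G H : Type u} [Group G] [Finite G] [Group H] [Finite H],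
    A.obj G →ₗ[F] obj H →ₗ[F] obj (G × H)
  act_map : ∀ {G G' H H' : Type u} [Group G] [Finite G] [Group G'] [Finite G']
    [Group H] [Finite H] [Group H'] [Finite H'] (U : Biset G' G) (V : Biset H' H)
    (a : A.obj G) (m : obj H), act (A.map U a) (map V m) = map (U.prod V) (act a m)
  mul_act : ∀ {G H J : Type u} [Group G] [Finite G] [Group H] [Finite H] [Group J] [Finite J]
    (a : A.obj G) (b : A.obj H) (m : obj J),
    map (Biset.ofIso (MulEquiv.prodAssoc (M := G) (N := H) (P := J))) (act (A.mul a b) m) =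
      act a (act b m)
  one_act : ∀ {G : Type u} [Group G] [Finite G] (m : obj G),
    map (Biset.ofIso (MulEquiv.uniqueProd (M := G) (N := PUnit.{u + 1}))) (act A.one m) = m

/-- `A`, as a left module over itself. -/
def GreenBisetFunctor.self {F : Type v} [Field F] (A : GreenBisetFunctor.{u, v, w} F) :
    GreenModule A where
  toBisetFunctor := A.toBisetFunctor
  act := A.mul
  act_map := A.mul_map
  mul_act := A.mul_assoc
  one_act := A.one_mul

namespace GreenModule

variable {F : Type v} [Field F] {A : GreenBisetFunctor.{u, v, w} F}

/-- A submodule of a module over a Green biset functor. -/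
@[ext] structure Sub (M : GreenModule A) where
  obj : ∀ (G : Type u) [Group G] [Finite G], Submodule F (M.obj G)
  map_mem : ∀ {G H : Type u} [Group G] [Finite G] [Group H] [Finite H] (U : Biset H G)
    {m : M.obj G}, m ∈ obj G → M.map U m ∈ obj H
  act_mem : ∀ {G H : Type u} [Group G] [Finite G] [Group H] [Finite H] (a : A.obj G)
    {m : M.obj H}, m ∈ obj H → M.act a m ∈ obj (G × H)

namespace Sub

variable {M : GreenModule A}

/-- Submodules are ordered by inclusion. -/
instance : PartialOrder (Sub M) where
  le N P := ∀ (G : Type u) [Group G] [Finite G], N.obj G ≤ P.obj G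
  le_refl _ _ _ _ := le_rfl
  le_trans _ _ _ h h' G _ _ := (h G).trans (h' G)
  le_antisymm N P h h' := by
    ext G _ _ : 4
    exact le_antisymm (h G) (h' G)

/-- The sum of a family of submodules. -/
def sum (S : Set (Sub M)) : Sub M where
  obj G _ _ := ⨆ N ∈ S, N.obj G
  map_mem {G H} _ _ _ _ U := by
    suffices h : (⨆ N ∈ S, N.obj G) ≤ (⨆ N ∈ S, N.obj H).comap (M.map U) from fun {_} hm => h hm
    refine iSup₂_le fun N hN m hm => ?_
    exact le_iSup₂ (f := fun N (_ : N ∈ S) => N.obj H) N hN (N.map_mem U hm)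
  act_mem {G H} _ _ _ _ a := by
    suffices h : (⨆ N ∈ S, N.obj H) ≤ (⨆ N ∈ S, N.obj (G × H)).comap (M.act a) from
      fun {_} hm => h hm
    refine iSup₂_le fun N hN m hm => ?_
    exact le_iSup₂ (f := fun N (_ : N ∈ S) => N.obj (G × H)) N hN (N.act_mem a hm)

/-- The submodule generated by an element `m ∈ M(G)`: the intersection of all submodules
containing it. -/
def generatedBy {G : Type u} [Group G] [Finite G] (m : M.obj G) : Sub M where
  obj H _ _ := ⨅ (N : Sub M) (_ : m ∈ N.obj G), N.obj H
  map_mem U _ hx := by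
    simp only [Submodule.mem_iInf] at hx ⊢
    exact fun N hN => N.map_mem U (hx N hN)
  act_mem a _ hx := by
    simp only [Submodule.mem_iInf] at hx ⊢
    exact fun N hN => N.act_mem a (hx N hN)

/-- The quotient module `I / I'` for submodules `I' ≤ I` of `M`. (Without the assumption
`I' ≤ I` this is `I / (I ∩ I')`.) -/
def quotient (I I' : Sub M) : GreenModule A where
  obj G _ _ := I.obj G ⧸ (I'.obj G).comap (I.obj G).subtype
  map {G H} _ _ _ _ U := Submodule.mapQ _ _
    ((M.map U).restrict fun _ hm => I.map_mem U hm) fun _ hm => I'.map_mem U hm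
  map_iso h := by
    refine Submodule.linearMap_qext _ (LinearMap.ext fun m => ?_)
    exact congrArg (Submodule.Quotient.mk) (Subtype.ext (by
      exact LinearMap.congr_fun (M.map_iso h) m.1))
  map_sum U V := by
    refine Submodule.linearMap_qext _ (LinearMap.ext fun m => ?_)
    exact congrArg (Submodule.Quotient.mk) (Subtype.ext (by
      exact LinearMap.congr_fun (M.map_sum U V) m.1))
  map_id G _ _ := by
    refine Submodule.linearMap_qext _ (LinearMap.ext fun m => ?_)
    exact congrArg (Submodule.Quotient.mk) (Subtype.ext (by
      exact LinearMap.congr_fun (M.map_id G) m.1))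
  map_comp V U := by
    refine Submodule.linearMap_qext _ (LinearMap.ext fun m => ?_)
    exact congrArg (Submodule.Quotient.mk) (Subtype.ext (by
      exact LinearMap.congr_fun (M.map_comp V U) m.1))
  act {G H} _ _ _ _ :=
    { toFun := fun a => Submodule.mapQ _ _
        ((M.act a).restrict fun _ hm => I.act_mem a hm) fun _ hm => I'.act_mem a hm
      map_add' := fun a b => by
        refine Submodule.linearMap_qext _ (LinearMap.ext fun m => ?_)
        exact congrArg (Submodule.Quotient.mk) (Subtype.ext (by
          exact LinearMap.congr_fun (M.act.map_add a b) m.1))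
      map_smul' := fun c a => by
        refine Submodule.linearMap_qext _ (LinearMap.ext fun m => ?_)
        exact congrArg (Submodule.Quotient.mk) (Subtype.ext (by
          exact LinearMap.congr_fun (M.act.map_smul c a) m.1)) }
  act_map U V a m := by
    induction m using Submodule.Quotient.induction_on with | H m => ?_
    exact congrArg (Submodule.Quotient.mk) (Subtype.ext (M.act_map U V a m.1))
  mul_act a b m := by
    induction m using Submodule.Quotient.induction_on with | H m => ?_
    exact congrArg (Submodule.Quotient.mk) (Subtype.ext (M.mul_act a b m.1))
  one_act m := by
    induction m using Submodule.Quotient.induction_on with | H m => ?_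
    exact congrArg (Submodule.Quotient.mk) (Subtype.ext (M.one_act m.1))

/-- The projection map `I(G) → (I / I')(G)`. -/
def proj (I I' : Sub M) (G : Type u) [Group G] [Finite G] :
    I.obj G →ₗ[F] (I.quotient I').obj G :=
  Submodule.mkQ _

end Sub

/-- A module is simple if it is nonzero and its only submodules are zero and itself. -/
def IsSimple (M : GreenModule A) : Prop :=
  (∃ (G : Type u) (_ : Group G) (_ : Finite G), Nontrivial (M.obj G)) ∧
  ∀ N : Sub M, (∀ (G : Type u) [Group G] [Finite G], N.obj G = ⊥) ∨
    (∀ (G : Type u) [Group G] [Finite G], N.obj G = ⊤)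

/-- An isomorphism of modules over a Green biset functor. -/
structure Iso (M N : GreenModule A) where
  equiv : ∀ (G : Type u) [Group G] [Finite G], M.obj G ≃ₗ[F] N.obj G
  equiv_map : ∀ {G H : Type u} [Group G] [Finite G] [Group H] [Finite H] (U : Biset H G)
    (m : M.obj G), equiv H (M.map U m) = N.map U (equiv G m)
  equiv_act : ∀ {G H : Type u} [Group G] [Finite G] [Group H] [Finite H] (a : A.obj G)
    (m : M.obj H), equiv (G × H) (M.act a m) = N.act a (equiv H m)

end GreenModule

/-! ## The shifted Burnside functor -/

section Shift

variable {G H G' H' J K : Type u} [Group G] [Group H] [Group G'] [Group H'] [Group J] [Group K]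

/-- For a `(G × K)`-set `X` and an `(H × K)`-set `Y`, the restriction of the
`(G × K × H × K)`-set `X × Y` along `(g, h, k) ↦ (g, k, h, k)`. -/
def GSet.shiftProd (X : GSet (G × K)) (Y : GSet (H × K)) : GSet ((G × H) × K) where
  carrier := X × Y
  action :=
    { smul := fun g p => ((g.1.1, g.2) • p.1, (g.1.2, g.2) • p.2)
      one_smul := fun p => Prod.ext (one_smul (G × K) p.1) (one_smul (H × K) p.2)
      mul_smul := fun g h p => Prod.ext (mul_smul (g.1.1, g.2) (h.1.1, h.2) p.1)
        (mul_smul (g.1.2, g.2) (h.1.2, h.2) p.2) }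

theorem GSet.shiftProd_iso {X X' : GSet (G × K)} {Y Y' : GSet (H × K)} (hX : X.IsIso X')
    (hY : Y.IsIso Y') : (X.shiftProd Y).IsIso (X'.shiftProd Y') := by
  obtain ⟨e, he⟩ := hX
  obtain ⟨f, hf⟩ := hY
  exact ⟨e.prodCongr f, fun g p => Prod.ext (he _ _) (hf _ _)⟩

theorem GSet.IsIso.refl (X : GSet G) : X.IsIso X := ⟨Equiv.refl _, fun _ _ => rfl⟩

theorem GSet.sum_shiftProd (X X' : GSet (G × K)) (Y : GSet (H × K)) :
    ((X.sum X').shiftProd Y).IsIso ((X.shiftProd Y).sum (X'.shiftProd Y)) := by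
  refine ⟨Equiv.sumProdDistrib X X' Y, ?_⟩
  rintro g ⟨x | x, y⟩ <;> rfl

theorem GSet.shiftProd_sum (X : GSet (G × K)) (Y Y' : GSet (H × K)) :
    (X.shiftProd (Y.sum Y')).IsIso ((X.shiftProd Y).sum (X.shiftProd Y')) := by
  refine ⟨Equiv.prodSumDistrib X Y Y', ?_⟩
  rintro g ⟨x, y | y⟩ <;> rfl

variable (K) in
/-- `U × K`, as an `(H × K, G × K)`-biset, for an `(H, G)`-biset `U`. -/
abbrev Biset.timesK [Finite K] (U : Biset H G) : Biset (H × K) (G × K) :=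
  U.prod (Biset.id K)

theorem GSet.tensor_shiftProd_tensor [Finite K] (U : Biset G' G) (V : Biset H' H)
    (X : GSet (G × K)) (Y : GSet (H × K)) :
    (((U.prod V).timesK K).tensor (X.shiftProd Y)).IsIso
      (((U.timesK K).tensor X).shiftProd ((V.timesK K).tensor Y)) := by
  let _ : MulAction (G × K)ᵐᵒᵖ (U × K) := (U.timesK K).right
  let _ : MulAction (H × K)ᵐᵒᵖ (V × K) := (V.timesK K).right
  let _ : MulAction ((G × H) × K)ᵐᵒᵖ ((U × V) × K) := ((U.prod V).timesK K).right
  let _ : MulAction ((G × H) × K) (X × Y) := (X.shiftProd Y).action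
  let W := TensorOver ((G × H) × K) ((U × V) × K) (X × Y)
  let f : W → TensorOver (G × K) (U × K) X × TensorOver (H × K) (V × K) Y :=
    TensorOver.lift (fun p q =>
      (TensorOver.mk (p.1.1, p.2) q.1, TensorOver.mk (p.1.2, p.2) q.2)) (by
      intro p g q
      refine Prod.ext ?_ ?_
      · exact (TensorOver.mk_smul (p.1.1, p.2) (g.1.1, g.2) _).trans
          (congrArg (TensorOver.mk (p.1.1, p.2)) (smul_inv_smul (g.1.1, g.2) q.1))
      · exact (TensorOver.mk_smul (p.1.2, p.2) (g.1.2, g.2) _).trans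
          (congrArg (TensorOver.mk (p.1.2, p.2)) (smul_inv_smul (g.1.2, g.2) q.2)))
  refine GSet.IsIso.of_bijective f ⟨?_, ?_⟩ ?_
  · refine TensorOver.ind ?_
    rintro ⟨⟨u, v⟩, (k : K)⟩ ⟨x, y⟩
    refine TensorOver.ind ?_
    rintro ⟨⟨u', v'⟩, (k' : K)⟩ ⟨x', y'⟩ h
    obtain ⟨⟨g, a⟩, h1, h2⟩ := TensorOver.mk_eq_iff.1 (congrArg Prod.fst h)
    obtain ⟨⟨g', a'⟩, h3, h4⟩ := TensorOver.mk_eq_iff.1 (congrArg Prod.snd h)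
    have ha : k' = k * a := congrArg Prod.snd h1
    have ha' : k' = k * a' := congrArg Prod.snd h3
    obtain rfl : a = a' := mul_left_cancel (ha.symm.trans ha')
    refine TensorOver.mk_eq_iff.2 ⟨((g, g'), a), ?_, ?_⟩
    · exact Prod.ext (Prod.ext (congrArg Prod.fst h1 :) (congrArg Prod.fst h3 :)) ha
    · exact Prod.ext h2 h4
  · rintro ⟨s, t⟩
    revert s t
    refine TensorOver.ind ?_
    rintro ⟨u, (k : K)⟩ x
    refine TensorOver.ind ?_
    rintro ⟨v, (l : K)⟩ y
    refine ⟨(TensorOver.mk ((u, v), (1 : K)) (((1 : G), k) • x, ((1 : H), l) • y) :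
      W), ?_⟩
    refine Prod.ext ?_ ?_
    · refine (TensorOver.mk_smul ((u, (1 : K)) : U × K) ((1 : G), k) x).symm.trans
        (congrArg (TensorOver.mk · x) ?_)
      exact Prod.ext (one_smul Gᵐᵒᵖ u) (one_mul k)
    · refine (TensorOver.mk_smul ((v, (1 : K)) : V × K) ((1 : H), l) y).symm.trans
        (congrArg (TensorOver.mk · y) ?_)
      exact Prod.ext (one_smul Hᵐᵒᵖ v) (one_mul l)
  · exact fun h => TensorOver.ind fun p q => rfl

variable (F : Type v) [Field F]

/-- The product `FB_K(G) × FB_K(H) → FB_K(G × H)`. -/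
noncomputable def FB.shiftMul : FB F (G × K) →ₗ[F] FB F (H × K) →ₗ[F] FB F ((G × H) × K) :=
  FB.lift
    (fun X => FB.lift (fun Y => FB.cls F (X.shiftProd Y))
      (fun _ _ h => FB.cls_iso (GSet.shiftProd_iso (.refl X) h))
      (fun Y Y' => (FB.cls_iso (GSet.shiftProd_sum X Y Y')).trans (FB.cls_sum _ _)))
    (fun _ _ h => FB.hom_ext fun Y => by
      simpa using FB.cls_iso (GSet.shiftProd_iso h (.refl Y)))
    (fun X X' => FB.hom_ext fun Y => by
      simpa using (FB.cls_iso (GSet.sum_shiftProd X X' Y)).trans (FB.cls_sum _ _))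

@[simp] theorem FB.shiftMul_cls (X : GSet (G × K)) (Y : GSet (H × K)) :
    FB.shiftMul F (FB.cls F X) (FB.cls F Y) = FB.cls F (X.shiftProd Y) := by
  simp [FB.shiftMul]

/-- The one-point `G`-set. -/
def GSet.point : GSet G where
  carrier := PUnit.{u + 1}
  action :=
    { smul := fun _ x => x
      one_smul := fun _ => rfl
      mul_smul := fun _ _ _ => rfl }

theorem FB.induction {p : FB F G → Prop} (hc : ∀ X, p (FB.cls F X))
    (hadd : ∀ a b, p a → p b → p (a + b)) (hsmul : ∀ (c : F) a, p a → p (c • a)) (a : FB F G) :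
    p a := by
  induction a using Submodule.Quotient.induction_on with | H a => ?_
  induction a using Finsupp.induction_linear with
  | zero => simpa using hsmul 0 _ (hc GSet.point)
  | add a b ha hb => exact hadd _ _ ha hb
  | single X c =>
    have := hsmul c _ (hc X)
    rwa [FB.cls, ← map_smul, Finsupp.smul_single_one] at this

end Shift

/-- The Green biset functor `FB_K`, obtained by shifting the Burnside functor by `K`:
`FB_K(G) = FB(G × K)` and `FB_K(U) = FB(U × K)`. -/
noncomputable def FBK (F : Type v) [Field F] (K : Type u) [Group K] [Finite K] :
    GreenBisetFunctor.{u, v, max (u + 1) v} F where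
  obj G _ _ := FB F (G × K)
  map U := FB.map F (U.timesK K)
  map_iso h := FB.map_iso F (Biset.prod_iso h _)
  map_sum U V := (FB.map_iso F (Biset.sum_prod U V _)).trans (FB.map_sum F _ _)
  map_id G _ _ := (FB.map_iso F Biset.id_prod_id).trans (FB.map_id F)
  map_comp V U := (FB.map_iso F (Biset.comp_prod_id V U)).trans (FB.map_comp F _ _)
  mul := FB.shiftMul F
  one := FB.cls F GSet.point
  mul_map U V a b := by
    induction a using FB.induction with
    | hadd a a' h h' => simp only [map_add, LinearMap.add_apply, h, h']
    | hsmul c a h => simp only [map_smul, LinearMap.smul_apply, h]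
    | hc X =>
    induction b using FB.induction with
    | hadd b b' h h' => simp only [map_add, h, h']
    | hsmul c b h => simp only [map_smul, h]
    | hc Y =>
    simpa using (FB.cls_iso (GSet.tensor_shiftProd_tensor U V X Y)).symm
  mul_assoc a b c := by
    induction a using FB.induction with
    | hadd a a' h h' => simp only [map_add, LinearMap.add_apply, h, h']
    | hsmul t a h => simp only [map_smul, LinearMap.smul_apply, h]
    | hc X =>
    induction b using FB.induction with
    | hadd b b' h h' => simp only [map_add, LinearMap.add_apply, h, h']
    | hsmul t b h => simp only [map_smul, LinearMap.smul_apply, h]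
    | hc Y =>
    induction c using FB.induction with
    | hadd c c' h h' => simp only [map_add, h, h']
    | hsmul t c h => simp only [map_smul, h]
    | hc Z =>
    simp only [FB.shiftMul_cls, FB.map_cls]
    exact FB.cls_iso (Biset.ofIso_prod_id_tensor _ (Equiv.prodAssoc X Y Z) fun _ _ _ => rfl)
  one_mul a := by
    induction a using FB.induction with
    | hadd a a' h h' => simp only [map_add, h, h']
    | hsmul t a h => simp only [map_smul, h]
    | hc X =>
    simp only [FB.shiftMul_cls, FB.map_cls]
    exact FB.cls_iso (Biset.ofIso_prod_id_tensor _ (Equiv.punitProd X) fun _ _ _ => rfl)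
  mul_one a := by
    induction a using FB.induction with
    | hadd a a' h h' => simp only [map_add, LinearMap.add_apply, h, h']
    | hsmul t a h => simp only [map_smul, LinearMap.smul_apply, h]
    | hc X =>
    simp only [FB.shiftMul_cls, FB.map_cls]
    exact FB.cls_iso (Biset.ofIso_prod_id_tensor _ (Equiv.prodPUnit X) fun _ _ _ => rfl)

/-- An ideal of `FB_K`: an `FB_K`-submodule of `FB_K`. -/
abbrev FBIdeal (F : Type v) [Field F] (K : Type u) [Group K] [Finite K] :=
  GreenModule.Sub (FBK F K).self

/-! ## Idempotents -/

section Moebius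

variable {G : Type u} [Group G] [Finite G]

open Classical in
/-- The Möbius function of the poset of subgroups of `G`. -/
noncomputable def moebius (X L : Subgroup G) : ℤ :=
  letI := Fintype.ofFinite (Subgroup G)
  letI : LocallyFiniteOrder (Subgroup G) := Fintype.toLocallyFiniteOrder
  IncidenceAlgebra.mu ℤ X L

/-- The idempotent `e_L^G = |N_G(L)|⁻¹ ∑_{X ≤ L} |X| μ(X, L) [G / X]` of `FB(G)`. -/
noncomputable def idem (F : Type v) [Field F] (L : Subgroup G) : FB F G :=
  (Nat.card (Subgroup.normalizer (L : Set G)) : F)⁻¹ •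
    ∑ᶠ X : {X : Subgroup G // X ≤ L},
      ((Nat.card X.1 : F) * (moebius X.1 L : F)) • FB.cls F (GSet.transitive X.1)

/-- `m_{G,N} = |G|⁻¹ ∑_{X ≤ G, X N = G} |X| μ(X, G)`, for a normal subgroup `N` of `G`. -/
noncomputable def mConst (N : Subgroup G) : ℚ :=
  (Nat.card G : ℚ)⁻¹ *
    ∑ᶠ X : {X : Subgroup G // X ⊔ N = ⊤}, (Nat.card X.1 : ℚ) * (moebius X.1 ⊤ : ℚ)

theorem mConst_bot : mConst (⊥ : Subgroup G) = 1 := by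
  have : Unique {X : Subgroup G // X ⊔ ⊥ = ⊤} :=
    { default := ⟨⊤, by simp⟩
      uniq := fun X => Subtype.ext (by simpa using X.2) }
  have h : moebius (⊤ : Subgroup G) ⊤ = 1 := by
    simp [moebius]
  have hd : (default : {X : Subgroup G // X ⊔ ⊥ = ⊤}).1 = ⊤ := by
    simpa using (default : {X : Subgroup G // X ⊔ ⊥ = ⊤}).2
  rw [mConst, finsum_unique, hd, h]
  simp

end Moebius

/-! ## Groups over `K` -/

/-- A finite group over `K`. -/
structure GroupOver (K : Type u) [Group K] : Type (u + 1) where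
  carrier : Type u
  [group : Group carrier]
  [finite : Finite carrier]
  hom : carrier →* K

attribute [instance] GroupOver.group GroupOver.finite

instance (K : Type u) [Group K] : CoeSort (GroupOver K) (Type u) := ⟨GroupOver.carrier⟩

namespace GroupOver

variable {K : Type u} [Group K]

/-- A morphism `(L, φ) → (L', φ')`: a group homomorphism `f : L → L'` such that
`i ∘ φ = φ' ∘ f` for some inner automorphism `i` of `K`. -/
@[ext] structure Hom (L L' : GroupOver K) where
  toHom : L →* L'
  comm : ∃ k : K, ∀ l : L, k * L.hom l * k⁻¹ = L'.hom (toHom l)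

instance : CategoryTheory.Category (GroupOver K) where
  Hom := Hom
  id L := ⟨MonoidHom.id L, 1, by simp⟩
  comp f g := ⟨g.toHom.comp f.toHom, by
    obtain ⟨k, hk⟩ := f.comm
    obtain ⟨k', hk'⟩ := g.comm
    exact ⟨k' * k, fun l => by simp [← hk', ← hk, mul_assoc]⟩⟩

/-- `(L, φ) ≅ (L', φ')` in the category of groups over `K`. -/
def IsIso (L L' : GroupOver K) : Prop := Nonempty (CategoryTheory.Iso L L')

/-- `(L', φ')` is a quotient of `(L, φ)`: there is a surjective morphism `(L, φ) → (L', φ')`. -/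
def HasQuotient (L L' : GroupOver K) : Prop :=
  ∃ f : Hom L L', Function.Surjective f.toHom

/-- `(L, φ)` is a `B_K`-group: `m_{L,N} = 0` for all nontrivial normal subgroups `N` of `L`
contained in `Ker φ`. -/
def IsBKGroup (L : GroupOver K) : Prop :=
  ∀ N : Subgroup L, N.Normal → N ≤ L.hom.ker → N ≠ ⊥ → mConst N = 0

/-- `(L / Q, φ / Q)`, for a normal subgroup `Q` of `L` contained in `Ker φ`. -/
def quotientBy (L : GroupOver K) (Q : Subgroup L) (hn : Q.Normal) (hQ : Q ≤ L.hom.ker) :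
    GroupOver K where
  carrier := L ⧸ Q
  hom := QuotientGroup.lift Q L.hom hQ

theorem exists_maximal (L : GroupOver K) :
    ∃ Q : Subgroup L, Maximal (fun Q => Q.Normal ∧ Q ≤ L.hom.ker ∧ mConst Q ≠ 0) Q := by
  refine (Set.toFinite {Q : Subgroup L | Q.Normal ∧ Q ≤ L.hom.ker ∧ mConst Q ≠ 0}).exists_maximal
    ⟨⊥, inferInstance, bot_le, ?_⟩
  rw [mConst_bot]
  exact one_ne_zero

/-- `β_K(L, φ)`: the quotient `(L / Q, φ / Q)`, where `Q` is a normal subgroup of `L` contained in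
`Ker φ`, chosen maximal such that `m_{L,Q} ≠ 0`. -/
noncomputable def beta (L : GroupOver K) : GroupOver K :=
  L.quotientBy L.exists_maximal.choose L.exists_maximal.choose_spec.prop.1
    L.exists_maximal.choose_spec.prop.2.1

/-- `(X, p₂)`, for a subgroup `X` of `G × K`. -/
def ofSubgroup {G : Type u} [Group G] [Finite G] [Finite K] (X : Subgroup (G × K)) :
    GroupOver K where
  carrier := X
  hom := (MonoidHom.snd G K).comp X.subtype

variable [Finite K]

/-- The ideal `e_{L,φ}` of `FB_K` generated by `e_{L_φ}^{L × K} ∈ FB_K(L)`, where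
`L_φ = {(l, φ(l)) | l ∈ L}`. -/
noncomputable def ideal (F : Type v) [Field F] (L : GroupOver K) : FBIdeal F K :=
  GreenModule.Sub.generatedBy (M := (FBK F K).self) (G := L) (idem F L.hom.graph)

/-- The sum `e⁰_{L,φ}` of the ideals `e_{M,ψ}`, for all `B_K`-groups `(M, ψ)` which have
`(L, φ)` as a quotient but are not isomorphic to it. -/
noncomputable def ideal₀ (F : Type v) [Field F] (L : GroupOver K) : FBIdeal F K :=
  GreenModule.Sub.sum
    {I | ∃ M : GroupOver K, M.IsBKGroup ∧ M.HasQuotient L ∧ ¬ M.IsIso L ∧ I = M.ideal F}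

/-- The `FB_K`-module `S_{L,φ} = e_{L,φ} / e⁰_{L,φ}`. -/
noncomputable def simpleModule (F : Type v) [Field F] (L : GroupOver K) :
    GreenModule (FBK F K) :=
  (L.ideal F).quotient (L.ideal₀ F)

end GroupOver

/-- `𝒜` is a set of representatives of the conjugacy classes of subgroups `X` of `G` having
the property `P`. -/
def IsSetOfRepresentatives {G : Type u} [Group G] (P : Subgroup G → Prop)
    (𝒜 : Set (Subgroup G)) : Prop :=
  (∀ X ∈ 𝒜, P X) ∧
  ∀ X, P X → ∃! Y, Y ∈ 𝒜 ∧ ∃ g : G, Y = X.map (MulAut.conj g).toMonoidHom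

end ShiftedBurnside

open ShiftedBurnside

/-! In characteristic 0 the marks (numbers of fixed points) determine an element of `FB F (G × K)`,
and the marks of e_X are 1 at the conjugates of X and 0 elsewhere. Multiplying externally by e_X and
restricting to the diagonal of G shows that an ideal I contains e_X as soon as some element of I(G)
has a nonzero mark at X. Hence I(G) is spanned by the e_X it contains. Moreover, whether e_X lies in
I(G) depends only on the group (X, p₂) over K. An ideal is therefore the same as the class of groups
over K that it supports (`FBIdeal.mem_iff`).

Such a class is closed in two ways (`GroupOver.IsClosed`). Restriction along a surjection passes
from (L, φ) to every group mapping onto it. Induction along L → L/Q passes from (L, φ) to (L/Q, φ/Q)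
when m_{L,Q} ≠ 0, since m_{L,Q} is, up to a nonzero factor, the mark of the image at the image
subgroup. Conversely, every closed class comes from an ideal (`GroupOver.map_mem_supported`): a
nonzero mark at Z of the image of an element under a biset produces a subgroup W at which the
element has a nonzero mark, with Z mapping onto a quotient W/(W ∩ N) such that m_{W,W∩N} ≠ 0. The
two closure properties also show that (M, ψ) and its β_K are supported by the same ideals.

The group-theoretic heart is `GroupOver.HasQuotient.quotientBy`: if M maps onto a B_K-group L and
m_{M,N} ≠ 0, then M/N still maps onto L. So the groups mapping onto L form a closed class, and this
is the class supported by e_{L,φ}. The proof rests on expressing m of the image of N as a sum over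
the subgroups W of M which map onto L (`sum_relConst`).

The theorem is then a statement about classes. A subideal of e_{L,φ} that does not support L
supports only groups M with β_K(M) mapping onto L and not isomorphic to L, so it lies in e⁰_{L,φ};
the groups separating the two ideals are those with β_K(M) ≅ L. A simple subquotient I/I' is matched
with S_{L,φ}, for L = β_K(M) with M supported by I and not by I', by the second isomorphism theorem.
-/

namespace ShiftedBurnside

/-! ## The Möbius function of the poset of subgroups -/

section MoebiusFunction

variable {G : Type u} [Group G] [Finite G]

/-- The finite type of subgroups of a finite group. -/
noncomputable abbrev fintypeSubgroup : Fintype (Subgroup G) := Fintype.ofFinite _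

attribute [local instance] fintypeSubgroup Classical.propDecidable

theorem moebius_of_not_le {X L : Subgroup G} (h : ¬ X ≤ L) : moebius X L = 0 := by
  simp [moebius, IncidenceAlgebra.apply_eq_zero_of_not_le h]

@[simp] theorem moebius_self (L : Subgroup G) : moebius L L = 1 := by
  simp [moebius]

theorem sum_moebius_left (A L : Subgroup G) :
    ∑ X, (if A ≤ X then moebius X L else 0) = if A = L then 1 else 0 := by
  let _ : LocallyFiniteOrder (Subgroup G) := Fintype.toLocallyFiniteOrder
  have h := IncidenceAlgebra.sum_Icc_mu_left (𝕜 := ℤ) A L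
  have h' : ∑ X ∈ Finset.Icc A L, moebius X L = if A = L then 1 else 0 := by
    convert h using 2
    unfold moebius
    rfl
  rw [← h', ← Finset.sum_filter]
  symm
  refine Finset.sum_subset (fun X hX => by simpa using (Finset.mem_Icc.1 hX).1) ?_
  intro X hX hX'
  refine moebius_of_not_le fun hle => hX' (Finset.mem_Icc.2 ⟨by simpa using hX, hle⟩)

theorem sum_moebius_right (A L : Subgroup G) :
    ∑ X, (if X ≤ L then moebius A X else 0) = if A = L then 1 else 0 := by
  let _ : LocallyFiniteOrder (Subgroup G) := Fintype.toLocallyFiniteOrder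
  have h := IncidenceAlgebra.sum_Icc_mu_right (𝕜 := ℤ) A L
  have h' : ∑ X ∈ Finset.Icc A L, moebius A X = if A = L then 1 else 0 := by
    convert h using 2
    unfold moebius
    rfl
  rw [← h', ← Finset.sum_filter]
  symm
  refine Finset.sum_subset (fun X hX => by simpa using (Finset.mem_Icc.1 hX).2) ?_
  intro X hX hX'
  refine moebius_of_not_le fun hle => hX' (Finset.mem_Icc.2 ⟨hle, by simpa using hX⟩)

/-- Uniqueness: the recursion `∑_{Y ≥ X} h(Y) = c δ_{X, ⊤}` on an upper interval determines `h`. -/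
theorem eq_mul_moebius {R : Type*} [Ring R] (A L : Subgroup G) (h : Subgroup G → R) (c : R)
    (hh : ∀ X, A ≤ X → ∑ Y, (if X ≤ Y then h Y else 0) = if X = L then c else 0)
    (X : Subgroup G) (hX : A ≤ X) : h X = c * (moebius X L : R) := by
  -- The induction runs downwards from large subgroups: the relation at `X` expresses `h X` through
  -- the values at the subgroups strictly containing `X`.
  induction X using (Finite.wellFounded_of_trans_of_irrefl
    (fun X Y : Subgroup G => Y < X)).induction with | _ X ih =>
  have h1 := hh X hX
  have h2 : ∑ Y, (if X ≤ Y then c * (moebius Y L : R) else 0) = if X = L then c else 0 := by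
    have := congrArg (fun z : ℤ => c * (z : R)) (sum_moebius_left X L)
    simpa [Finset.mul_sum, apply_ite, mul_ite] using this
  rw [← h2] at h1
  rw [← Finset.add_sum_erase _ _ (Finset.mem_univ X),
    ← Finset.add_sum_erase (a := X) _ (fun Y => if X ≤ Y then c * (moebius Y L : R) else 0)
      (Finset.mem_univ X)] at h1
  simp only [le_refl, if_true] at h1
  rw [Finset.sum_congr rfl (g := fun Y => if X ≤ Y then c * (moebius Y L : R) else 0)] at h1
  · exact add_right_cancel h1
  · intro Y hY
    split_ifs with hle
    · exact ih Y (lt_of_le_of_ne hle (Finset.ne_of_mem_erase hY).symm) (hX.trans hle)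
    · rfl

/-- Möbius functions are preserved by isomorphisms of intervals. -/
theorem moebius_map {H : Type u} [Group H] [Finite H] (f : Subgroup H → Subgroup G)
    (hf : ∀ X Y, f X ≤ f Y ↔ X ≤ Y) (L : Subgroup H)
    (hr : ∀ X Y, f X ≤ Y → Y ≤ f L → ∃ Z, f Z = Y) (X : Subgroup H) :
    moebius (f X) (f L) = moebius X L := by
  have hinj : Function.Injective f := fun X Y h =>
    le_antisymm ((hf _ _).1 h.le) ((hf _ _).1 h.ge)
  have := eq_mul_moebius (R := ℤ) ⊥ L (fun X => moebius (f X) (f L)) 1 ?_ X bot_le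
  · simpa using this
  intro X _
  have h := sum_moebius_left (f X) (f L)
  rw [hinj.eq_iff] at h
  rw [← h]
  refine Finset.sum_of_injOn f hinj.injOn (fun _ _ => Finset.mem_univ _) ?_ ?_
  · intro Y _ hY
    -- By `hr`, a subgroup above `f X` that is missed by `f` is not below `f L`, so its Möbius value
    -- vanishes.
    split_ifs with hle
    · refine moebius_of_not_le fun hle' => hY ?_
      obtain ⟨Z, rfl⟩ := hr X Y hle hle'
      exact ⟨Z, by simp, rfl⟩
    · rfl
  · intro Y _
    simp only [hf]

theorem moebius_map_subtype (W : Subgroup G) (X : Subgroup W) :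
    moebius (X.map W.subtype) W = moebius X ⊤ := by
  have := moebius_map (fun X : Subgroup W => X.map W.subtype)
    (fun X Y => Subgroup.map_le_map_iff_of_injective W.subtype_injective) ⊤
    (fun X Y _ h => ⟨Y.subgroupOf W, Subgroup.map_subgroupOf_eq_of_le (by
      rwa [← MonoidHom.range_eq_map, Subgroup.range_subtype] at h)⟩) X
  rwa [← MonoidHom.range_eq_map, Subgroup.range_subtype] at this

theorem moebius_comap {H : Type u} [Group H] [Finite H] (f : G →* H)
    (hf : Function.Surjective f) (X : Subgroup H) :
    moebius (X.comap f) ⊤ = moebius X ⊤ := by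
  have := moebius_map (fun X : Subgroup H => X.comap f)
    (fun X Y => Subgroup.comap_le_comap_of_surjective hf) ⊤
    (fun X Y h _ => ⟨Y.map f, Subgroup.comap_map_eq_self
      (le_trans (by rw [← MonoidHom.comap_bot]; exact Subgroup.comap_mono bot_le) h)⟩) X
  simpa using this

/-- Weisner's theorem. -/
theorem sum_moebius_of_inf_eq {Z : Subgroup G} (hZ : Z ≠ ⊤) (A : Subgroup G) :
    ∑ Y : Subgroup G, (if Y ⊓ Z = A then moebius Y ⊤ else 0) = 0 := by
  by_cases hA : A ≤ Z
  swap
  · exact Finset.sum_eq_zero fun Y _ => if_neg fun h : Y ⊓ Z = A => hA (h ▸ inf_le_right)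
  -- As a function of `A`, the sum satisfies the Möbius recursion with constant 0. Adding over all
  -- `A` containing `X` leaves the `Y` with `X ≤ Y ⊓ Z`: none unless `X ≤ Z`, and otherwise all `Y ≥
  -- X`, where `X ≠ ⊤` because `Z ≠ ⊤`.
  have key := eq_mul_moebius (R := ℤ) (G := G) ⊥ ⊤
    (fun A => ∑ Y : Subgroup G, (if Y ⊓ Z = A then moebius Y ⊤ else 0)) 0 ?_ A bot_le
  · simpa using key
  intro X _
  simp only [ite_self]
  have h1 : ∀ B : Subgroup G,
      (if X ≤ B then ∑ Y : Subgroup G, (if Y ⊓ Z = B then moebius Y ⊤ else 0) else 0) =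
        ∑ Y : Subgroup G, (if Y ⊓ Z = B then (if X ≤ B then moebius Y ⊤ else 0) else 0) := by
    intro B
    split_ifs <;> simp
  simp only [h1]
  rw [Finset.sum_comm]
  simp only [Finset.sum_ite_eq, Finset.mem_univ, if_true]
  by_cases hX : X ≤ Z
  · have := sum_moebius_left X ⊤
    rw [if_neg (fun h : X = ⊤ => hZ (top_le_iff.1 (h ▸ hX)))] at this
    simpa [hX] using this
  · exact Finset.sum_eq_zero fun Y _ => if_neg fun h => hX (h.trans inf_le_right)

/-! ## The constants `m_{G,N}` -/

theorem mConst_eq (N : Subgroup G) : (Nat.card G : ℚ) * mConst N =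
    ∑ X : Subgroup G, if X ⊔ N = ⊤ then (Nat.card X : ℚ) * (moebius X ⊤ : ℚ) else 0 := by
  rw [mConst, mul_inv_cancel_left₀ (by simp [Nat.card_pos.ne']),
    finsum_eq_sum_of_fintype, ← Finset.sum_filter]
  exact (Finset.sum_subtype (Finset.univ.filter fun X : Subgroup G => X ⊔ N = ⊤)
    (by simp) fun X : Subgroup G => (Nat.card X : ℚ) * (moebius X ⊤ : ℚ)).symm

omit [Finite G] in
theorem card_inf_mul_card_sup (X N : Subgroup G) [N.Normal] :
    Nat.card ↥(X ⊓ N) * Nat.card ↥(X ⊔ N) = Nat.card X * Nat.card N := by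
  have h1 := (X ⊓ N).card_mul_index
  have h2 := (X ⊔ N).card_mul_index
  have h3 : Nat.card ↥(X ⊓ N) * N.relIndex X = Nat.card X := by
    rw [← Subgroup.inf_relIndex_left]
    rw [Subgroup.relIndex, ← Nat.card_congr (Subgroup.subgroupOfEquivOfLe
      (inf_le_left : X ⊓ N ≤ X)).toEquiv]
    exact ((X ⊓ N).subgroupOf X).card_mul_index
  have h4 : Nat.card N * N.relIndex (X ⊔ N) = Nat.card ↥(X ⊔ N) := by
    rw [Subgroup.relIndex, ← Nat.card_congr (Subgroup.subgroupOfEquivOfLe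
      (le_sup_right : N ≤ X ⊔ N)).toEquiv]
    exact (N.subgroupOf (X ⊔ N)).card_mul_index
  rw [Subgroup.relIndex_sup_right] at h4
  rw [← h3, ← h4]
  ring

/-- The coefficient of the mark at `W` in the number of points of a `G`-set whose `N`-orbit is
fixed by `G`, weighted by the order of the stabilizer in `N`. -/
noncomputable def relConst (N W : Subgroup G) : ℤ :=
  ∑ Y : Subgroup G, if Y ⊔ N = ⊤ then (Nat.card ↥(Y ⊓ N) : ℤ) * moebius Y W else 0

/-- When YN = G, the product formula reads |Y ∩ N| |G| = |Y| |N|. This converts the weights |Y ∩ N|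
that arise from counting fixed points into the weights |Y| of m_{G,N}. -/
theorem card_mul_relConst (N W : Subgroup G) [N.Normal] : (Nat.card G : ℚ) * relConst N W =
    Nat.card N * ∑ Y : Subgroup G, if Y ⊔ N = ⊤ then (Nat.card Y : ℚ) * moebius Y W else 0 := by
  rw [relConst, Int.cast_sum, Finset.mul_sum, Finset.mul_sum]
  refine Finset.sum_congr rfl fun Y _ => ?_
  split_ifs with h
  · have := card_inf_mul_card_sup Y N
    rw [h, Subgroup.card_top] at this
    have h' : (Nat.card ↥(Y ⊓ N) : ℚ) * Nat.card G = Nat.card Y * Nat.card N := mod_cast this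
    push_cast
    linear_combination (moebius Y W : ℚ) * h'
  · simp

theorem relConst_top (N : Subgroup G) [N.Normal] :
    (relConst N ⊤ : ℚ) = Nat.card N * mConst N := by
  have h := card_mul_relConst N ⊤
  rw [← mConst_eq] at h
  have h0 : (Nat.card G : ℚ) ≠ 0 := by simp [Nat.card_pos.ne']
  refine mul_left_cancel₀ h0 (h.trans ?_)
  ring

omit [Finite G] in
-- Dedekind's law inside `W`: if WN = G and Y ≤ W, then Y(W ∩ N) = W exactly when YN = G.
theorem subgroupOf_sup_eq_top {Y W N : Subgroup G} [N.Normal] (hY : Y ≤ W) (hW : W ⊔ N = ⊤) :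
    Y.subgroupOf W ⊔ N.subgroupOf W = ⊤ ↔ Y ⊔ N = ⊤ := by
  rw [← Subgroup.inf_subgroupOf_right N, ← Subgroup.subgroupOf_sup hY inf_le_right,
    Subgroup.subgroupOf_eq_top]
  constructor
  · intro h
    rw [eq_top_iff, ← hW]
    exact sup_le (h.trans (sup_le_sup_left inf_le_left _)) le_sup_right
  · intro h w hw
    have : w ∈ Y ⊔ N := h ▸ Subgroup.mem_top w
    obtain ⟨y, hy, n, hn, rfl⟩ := (Subgroup.mem_sup_of_normal_right).1 this
    exact mul_mem (Subgroup.mem_sup_left hy)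
      (Subgroup.mem_sup_right ⟨hn, (mul_mem_cancel_left (hY hy)).1 hw⟩)

/-- If WN ≠ G, no Y ≤ W satisfies YN = G and every term vanishes. Otherwise the sum runs over the Y
≤ W with Y(W ∩ N) = W, and `relConst N W` equals |W ∩ N| m_{W,W∩N}. -/
theorem mConst_subgroupOf_ne_zero {N W : Subgroup G} [N.Normal] (h : relConst N W ≠ 0) :
    W ⊔ N = ⊤ ∧ mConst (N.subgroupOf W) ≠ 0 := by
  have hW : W ⊔ N = ⊤ := by
    by_contra hW
    refine h (Finset.sum_eq_zero fun Y _ => ?_)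
    split_ifs with hY
    · rw [moebius_of_not_le, mul_zero]
      exact fun hle => hW (top_le_iff.1 (hY ▸ sup_le_sup_right hle N))
    · rfl
  refine ⟨hW, fun h0 => h ?_⟩
  have h1 := mConst_eq (N.subgroupOf W)
  rw [h0, mul_zero] at h1
  have h2 := card_mul_relConst N W
  have h3 : ∑ Y : Subgroup G, (if Y ⊔ N = ⊤ then (Nat.card Y : ℚ) * moebius Y W else 0) = 0 := by
    refine Eq.trans (Eq.symm ?_) h1.symm
    refine Finset.sum_of_injOn (fun X : Subgroup W => X.map W.subtype)
      (Subgroup.map_injective W.subtype_injective).injOn (fun _ _ => Finset.mem_univ _) ?_ ?_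
    · intro Y _ hY
      split_ifs
      · rw [moebius_of_not_le, Int.cast_zero, mul_zero]
        exact fun hle => hY ⟨Y.subgroupOf W, by simp, Subgroup.map_subgroupOf_eq_of_le hle⟩
      · rfl
    · intro X _
      have hX : X.map W.subtype ≤ W := Subgroup.map_subtype_le X
      have := subgroupOf_sup_eq_top (N := N) hX hW
      rw [show (X.map W.subtype).subgroupOf W = X from
        Subgroup.comap_map_eq_self_of_injective W.subtype_injective X] at this
      simp only [this, moebius_map_subtype]
      rw [Nat.card_congr (X.equivMapOfInjective _ W.subtype_injective).toEquiv]
  rw [h3, mul_zero] at h2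
  have h4 : (Nat.card G : ℚ) ≠ 0 := by simp [Nat.card_pos.ne']
  exact_mod_cast (mul_eq_zero.1 h2).resolve_left h4

end MoebiusFunction

/-! ### The constants `m_{G,N}` under quotients and surjections -/

section Quotients

variable {G H : Type u} [Group G] [Finite G] [Group H] [Finite H]

attribute [local instance] fintypeSubgroup Classical.propDecidable

omit [Finite G] in
theorem card_comap (f : G →* H) (hf : Function.Surjective f) (T : Subgroup H) :
    Nat.card (T.comap f) = Nat.card f.ker * Nat.card T := by
  have h1 := (T.comap f).card_mul_index
  have h2 := T.card_mul_index
  have h3 := f.ker.card_mul_index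
  rw [Subgroup.index_comap_of_surjective T hf] at h1
  rw [Subgroup.index_ker, MonoidHom.range_eq_top.2 hf, Subgroup.card_top] at h3
  refine Nat.eq_of_mul_eq_mul_right (Nat.pos_of_ne_zero (Subgroup.index_ne_zero_of_finite
    (H := T))) ?_
  rw [h1, ← h3, mul_assoc, h2]

omit [Finite G] [Finite H] in
theorem comap_sup_eq_top (f : G →* H) (hf : Function.Surjective f) (T : Subgroup H)
    (N : Subgroup G) : T.comap f ⊔ N = ⊤ ↔ T ⊔ N.map f = ⊤ := by
  have h1 : (T ⊔ N.map f).comap f = T.comap f ⊔ N := by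
    have h2 : f.ker ≤ T.comap f := f.comap_bot ▸ Subgroup.comap_mono bot_le
    rw [← Subgroup.comap_sup_eq f _ _ hf, Subgroup.comap_map_eq, sup_comm N, ← sup_assoc,
      sup_eq_left.2 h2]
  rw [← h1, ← Subgroup.comap_top f]
  exact (Subgroup.comap_injective hf).eq_iff

theorem sum_comap {R : Type*} [AddCommMonoid R] (f : G →* H) (hf : Function.Surjective f)
    (g : Subgroup G → R) :
    ∑ T : Subgroup H, g (T.comap f) = ∑ X : Subgroup G, if f.ker ≤ X then g X else 0 := by
  refine Finset.sum_of_injOn (fun T : Subgroup H => T.comap f)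
    (Subgroup.comap_injective hf).injOn (fun _ _ => Finset.mem_univ _) ?_ ?_
  · intro X _ hX
    exact if_neg fun h => hX ⟨X.map f, by simp, Subgroup.comap_map_eq_self h⟩
  · intro T _
    exact (if_pos (f.comap_bot ▸ Subgroup.comap_mono bot_le)).symm

omit [Finite G] in
-- Dedekind's law. For Q ≤ X the condition X ≤ YQ depends only on Y ∩ X, which is the form needed
-- for Weisner's theorem.
theorem le_sup_iff_le_inf_sup {X Y Q : Subgroup G} [Q.Normal] (h : Q ≤ X) :
    X ≤ Y ⊔ Q ↔ X ≤ Y ⊓ X ⊔ Q := by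
  refine ⟨fun hX x hx => ?_, fun hX => hX.trans (sup_le_sup_right inf_le_left _)⟩
  obtain ⟨y, hy, q, hq, rfl⟩ := Subgroup.mem_sup_of_normal_right.1 (hX hx)
  exact mul_mem (Subgroup.mem_sup_left ⟨hy, (mul_mem_cancel_right (h hq)).1 hx⟩)
    (Subgroup.mem_sup_right hq)

/-- The left side satisfies the Möbius recursion on the interval from Q to G. Adding over all T ≥ X
gives the sum over Y with X ≤ YQ. For X = G this is `relConst Q ⊤`. For X < G both the condition and
the weight |Y ∩ Q| depend only on A = Y ∩ X, so the sum over each fibre is zero by Weisner's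
theorem. -/
theorem sum_card_inf_mul_moebius (Q T : Subgroup G) [Q.Normal] (hT : Q ≤ T) :
    ∑ Y : Subgroup G, (if Y ⊔ Q = T then (Nat.card ↥(Y ⊓ Q) : ℤ) * moebius Y ⊤ else 0) =
      relConst Q ⊤ * moebius T ⊤ := by
  have key := eq_mul_moebius (R := ℤ) Q ⊤ (fun T => ∑ Y : Subgroup G,
    (if Y ⊔ Q = T then (Nat.card ↥(Y ⊓ Q) : ℤ) * moebius Y ⊤ else 0)) (relConst Q ⊤) ?_ T hT
  · simpa using key
  intro X hX
  have h1 : ∀ B : Subgroup G, (if X ≤ B then ∑ Y : Subgroup G,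
      (if Y ⊔ Q = B then (Nat.card ↥(Y ⊓ Q) : ℤ) * moebius Y ⊤ else 0) else 0) =
      ∑ Y : Subgroup G, (if Y ⊔ Q = B then
        (if X ≤ B then (Nat.card ↥(Y ⊓ Q) : ℤ) * moebius Y ⊤ else 0) else 0) := by
    intro B
    split_ifs <;> simp
  simp only [h1]
  rw [Finset.sum_comm]
  simp only [Finset.sum_ite_eq, Finset.mem_univ, if_true]
  by_cases hX' : X = ⊤
  · subst hX'
    simp [relConst]
  rw [if_neg hX']
  have h2 : ∀ Y : Subgroup G,
      (if X ≤ Y ⊔ Q then (Nat.card ↥(Y ⊓ Q) : ℤ) * moebius Y ⊤ else 0) =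
      ∑ A : Subgroup G, if Y ⊓ X = A then
        ((if X ≤ A ⊔ Q then (Nat.card ↥(A ⊓ Q) : ℤ) else 0) * moebius Y ⊤) else 0 := by
    intro Y
    simp only [Finset.sum_ite_eq, Finset.mem_univ, if_true, ← le_sup_iff_le_inf_sup hX, inf_assoc,
      inf_eq_right.2 hX, ite_mul, zero_mul]
  simp only [h2]
  rw [Finset.sum_comm]
  refine Finset.sum_eq_zero fun A _ => ?_
  simp only [← mul_ite_zero]
  rw [← Finset.mul_sum, sum_moebius_of_inf_eq hX', mul_zero]

/-- Multiplicativity of the constants `m_{G,N}`. -/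
theorem mConst_eq_mul {Q N : Subgroup G} [Q.Normal] [N.Normal] (hQ : Q ≤ N) :
    mConst N = mConst Q * mConst (N.map (QuotientGroup.mk' Q)) := by
  have hs := QuotientGroup.mk'_surjective Q
  -- Group the subgroups Y with YN = G by T = YQ. As Q ≤ N, the condition becomes TN = G, and |Q|
  -- |Y| = |Y ∩ Q| |T|.
  have e1 : (Nat.card Q : ℚ) * (Nat.card G * mConst N) = ∑ T : Subgroup G,
      if T ⊔ N = ⊤ then (Nat.card T : ℚ) * ((∑ Y : Subgroup G,
        (if Y ⊔ Q = T then (Nat.card ↥(Y ⊓ Q) : ℤ) * moebius Y ⊤ else 0) : ℤ) : ℚ) else 0 := by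
    rw [mConst_eq, Finset.mul_sum]
    have h1 : ∀ T : Subgroup G, (if T ⊔ N = ⊤ then (Nat.card T : ℚ) * ((∑ Y : Subgroup G,
        (if Y ⊔ Q = T then (Nat.card ↥(Y ⊓ Q) : ℤ) * moebius Y ⊤ else 0) : ℤ) : ℚ) else 0) =
        ∑ Y : Subgroup G, if Y ⊔ Q = T then (if T ⊔ N = ⊤ then (Nat.card T : ℚ) *
          (Nat.card ↥(Y ⊓ Q) * moebius Y ⊤) else 0) else 0 := by
      intro T
      split_ifs with h
      · push_cast
        simp [Finset.mul_sum, mul_ite]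
      · simp
    simp only [h1]
    rw [Finset.sum_comm]
    simp only [Finset.sum_ite_eq, Finset.mem_univ, if_true, sup_assoc, sup_eq_right.2 hQ]
    refine Finset.sum_congr rfl fun Y _ => ?_
    split_ifs
    · have := card_inf_mul_card_sup Y Q
      have h' : (Nat.card ↥(Y ⊓ Q) : ℚ) * Nat.card ↥(Y ⊔ Q) = Nat.card Y * Nat.card Q :=
        mod_cast this
      linear_combination -(moebius Y ⊤ : ℚ) * h'
    · simp
  -- Only T containing Q can be of the form YQ; they correspond to the subgroups of G/Q.
  have e2 : ∀ T : Subgroup G, (if T ⊔ N = ⊤ then (Nat.card T : ℚ) * ((∑ Y : Subgroup G,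
      (if Y ⊔ Q = T then (Nat.card ↥(Y ⊓ Q) : ℤ) * moebius Y ⊤ else 0) : ℤ) : ℚ) else 0) =
      if (QuotientGroup.mk' Q).ker ≤ T then (if T ⊔ N = ⊤ then (Nat.card T : ℚ) *
        (relConst Q ⊤ * moebius T ⊤) else 0) else 0 := by
    intro T
    rw [QuotientGroup.ker_mk']
    by_cases hT : Q ≤ T
    · rw [if_pos hT, sum_card_inf_mul_moebius Q T hT]
      push_cast
      rfl
    · rw [if_neg hT, Finset.sum_eq_zero]
      · simp
      · exact fun Y _ => if_neg fun h : Y ⊔ Q = T => hT (h ▸ le_sup_right)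
  simp only [e2] at e1
  rw [← sum_comap _ hs] at e1
  simp only [comap_sup_eq_top _ hs, moebius_comap _ hs, card_comap _ hs, relConst_top] at e1
  have e3 := mConst_eq (N.map (QuotientGroup.mk' Q))
  have e4 : (Nat.card Q : ℚ) * (Nat.card G * mConst N) = Nat.card Q * Nat.card Q * mConst Q *
      (Nat.card (G ⧸ Q) * mConst (N.map (QuotientGroup.mk' Q))) := by
    rw [e1, e3, Finset.mul_sum]
    refine Finset.sum_congr rfl fun T _ => ?_
    rw [QuotientGroup.ker_mk']
    split_ifs
    · push_cast
      ring
    · simp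
  have e5 : (Nat.card G : ℚ) = Nat.card (G ⧸ Q) * Nat.card Q :=
    mod_cast Subgroup.card_eq_card_quotient_mul_card_subgroup Q
  have h0 : (Nat.card Q : ℚ) ≠ 0 := by simp [Nat.card_pos.ne']
  have h1 : (Nat.card (G ⧸ Q) : ℚ) ≠ 0 := by simp [Nat.card_pos.ne']
  rw [e5] at e4
  refine mul_left_cancel₀ (mul_ne_zero (mul_ne_zero h0 h0) h1) ?_
  linear_combination e4

/-- Write the indicator of f(W) = H as the sum of μ(T, H) over T ≥ f(W). The condition is W ≤
f⁻¹(T), so summing μ(Y, W) over W leaves only Y = f⁻¹(T). -/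
theorem sum_moebius_of_map_eq_top (f : G →* H) (Y : Subgroup G) :
    ∑ W : Subgroup G, (if W.map f = ⊤ then moebius Y W else 0) =
      ∑ T : Subgroup H, if Y = T.comap f then moebius T ⊤ else 0 := by
  have h1 : ∀ W : Subgroup G, (if W.map f = ⊤ then moebius Y W else 0) =
      ∑ T : Subgroup H, (if W ≤ T.comap f then moebius Y W else 0) * moebius T ⊤ := by
    intro W
    have := congrArg (fun z => moebius Y W * z) (sum_moebius_left (W.map f) ⊤)
    simp only [Finset.mul_sum, mul_ite, mul_one, mul_zero, Subgroup.map_le_iff_le_comap] at this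
    rw [← this]
    refine Finset.sum_congr rfl fun T _ => ?_
    split_ifs <;> simp
  simp only [h1]
  rw [Finset.sum_comm]
  refine Finset.sum_congr rfl fun T _ => ?_
  rw [← Finset.sum_mul, sum_moebius_right, ite_mul, one_mul, zero_mul]

/-- Exchanging sums, only the subgroups Y = f⁻¹(T) survive, with Tf(N) = H. For these the product
formula gives |f⁻¹(T) ∩ N| |G| = |ker f| |T| |N|, and what remains is the sum defining m_{H,f(N)}.
-/
theorem sum_relConst (f : G →* H) (hf : Function.Surjective f) (N : Subgroup G) [N.Normal] :
    ((∑ W : Subgroup G, (if W.map f = ⊤ then relConst N W else 0) : ℤ) : ℚ) =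
      Nat.card N * mConst (N.map f) := by
  have e1 : ∑ W : Subgroup G, (if W.map f = ⊤ then relConst N W else 0) =
      ∑ T : Subgroup H, if T ⊔ N.map f = ⊤ then
        (Nat.card ↥(T.comap f ⊓ N) : ℤ) * moebius T ⊤ else 0 := by
    have h1 : ∀ W : Subgroup G, (if W.map f = ⊤ then relConst N W else 0) =
        ∑ Y : Subgroup G, (if Y ⊔ N = ⊤ then (Nat.card ↥(Y ⊓ N) : ℤ) else 0) *
          (if W.map f = ⊤ then moebius Y W else 0) := by
      intro W
      rw [relConst]
      split_ifs <;> simp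
    simp only [h1]
    rw [Finset.sum_comm]
    simp only [← Finset.mul_sum, sum_moebius_of_map_eq_top]
    simp only [Finset.mul_sum]
    rw [Finset.sum_comm]
    refine Finset.sum_congr rfl fun T _ => ?_
    simp only [mul_ite, mul_zero, Finset.sum_ite_eq', Finset.mem_univ, if_true,
      comap_sup_eq_top f hf, ite_mul, zero_mul]
  have h0 : (Nat.card G : ℚ) ≠ 0 := by simp [Nat.card_pos.ne']
  have hG : (Nat.card G : ℚ) = Nat.card f.ker * Nat.card H := by
    have := card_comap f hf ⊤
    simp only [Subgroup.comap_top, Subgroup.card_top] at this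
    exact_mod_cast this
  refine mul_left_cancel₀ h0 ?_
  rw [e1, Int.cast_sum]
  have e2 := mConst_eq (N.map f)
  calc _ = (Nat.card N * Nat.card f.ker : ℚ) * ∑ T : Subgroup H,
        (if T ⊔ N.map f = ⊤ then (Nat.card T : ℚ) * (moebius T ⊤ : ℚ) else 0) := by
        rw [Finset.mul_sum, Finset.mul_sum]
        refine Finset.sum_congr rfl fun T _ => ?_
        split_ifs with hT
        · have := card_inf_mul_card_sup (T.comap f) N
          rw [(comap_sup_eq_top f hf T N).2 hT, Subgroup.card_top, card_comap f hf] at this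
          have h' : (Nat.card ↥(T.comap f ⊓ N) : ℚ) * Nat.card G =
            Nat.card f.ker * Nat.card T * Nat.card N := mod_cast this
          push_cast
          linear_combination (moebius T ⊤ : ℚ) * h'
        · simp
    _ = _ := by
        rw [← e2, hG]
        ring

/-- The total in `sum_relConst` is zero, while its term at W = G is |N| m_{G,N} ≠ 0. Some other term
is nonzero, and `mConst_subgroupOf_ne_zero` interprets it. -/
theorem exists_proper_of_mConst_map_eq_zero (f : G →* H) (hf : Function.Surjective f)
    (N : Subgroup G) [N.Normal] (hN : mConst N ≠ 0) (hN' : mConst (N.map f) = 0) :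
    ∃ W : Subgroup G, W ≠ ⊤ ∧ W.map f = ⊤ ∧ W ⊔ N = ⊤ ∧ mConst (N.subgroupOf W) ≠ 0 := by
  by_contra! hW
  have h1 := sum_relConst f hf N
  rw [hN', mul_zero, Int.cast_eq_zero, Finset.sum_eq_single ⊤, ← MonoidHom.range_eq_map,
    if_pos (MonoidHom.range_eq_top.2 hf)] at h1
  · have h2 := relConst_top N
    rw [h1, Int.cast_zero] at h2
    exact mul_ne_zero (by simp [Nat.card_pos.ne']) hN h2.symm
  · intro W _ hne
    split_ifs with h
    · by_contra hr
      obtain ⟨h2, h3⟩ := mConst_subgroupOf_ne_zero hr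
      exact h3 (hW W hne h h2)
    · rfl
  · simp

end Quotients

/-! ## Quotients of groups over `K` -/

namespace GroupOver

variable {K : Type u} [Group K]

theorem HasQuotient.refl (L : GroupOver K) : L.HasQuotient L :=
  ⟨CategoryTheory.CategoryStruct.id L, Function.surjective_id⟩

theorem HasQuotient.trans {L M N : GroupOver K} (h : L.HasQuotient M) (h' : M.HasQuotient N) :
    L.HasQuotient N := by
  obtain ⟨f, hf⟩ := h
  obtain ⟨g, hg⟩ := h'
  exact ⟨CategoryTheory.CategoryStruct.comp (obj := GroupOver K) f g, hg.comp hf⟩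

theorem IsIso.symm {L M : GroupOver K} (h : L.IsIso M) : M.IsIso L := ⟨h.some.symm⟩

theorem IsIso.hasQuotient {L M : GroupOver K} (h : L.IsIso M) : L.HasQuotient M := by
  obtain ⟨e⟩ := h
  refine ⟨e.hom, fun m => ⟨Hom.toHom e.inv m, ?_⟩⟩
  exact DFunLike.congr_fun (congrArg Hom.toHom e.inv_hom_id) m

/-- Surjections in both directions force equal orders, so each is bijective. If `k` witnesses
compatibility for a bijection, `k⁻¹` does for its inverse. -/
theorem HasQuotient.isIso {L M : GroupOver K} (h : L.HasQuotient M) (h' : M.HasQuotient L) :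
    L.IsIso M := by
  obtain ⟨f, hf⟩ := h
  obtain ⟨g, hg⟩ := h'
  have hb : Function.Bijective f.toHom :=
    hf.bijective_of_nat_card_le (Nat.card_le_card_of_surjective _ hg)
  let e := MulEquiv.ofBijective f.toHom hb
  have he : ∀ l, e l = f.toHom l := fun _ => rfl
  obtain ⟨k, hk⟩ := f.comm
  refine ⟨⟨f, ⟨e.symm.toMonoidHom, k⁻¹, fun m => ?_⟩, ?_, ?_⟩⟩
  · obtain ⟨l, rfl⟩ := e.surjective m
    rw [he, ← hk]
    simp [mul_assoc, ← he]
  · exact Hom.ext (MonoidHom.ext fun l => e.symm_apply_apply l)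
  · exact Hom.ext (MonoidHom.ext fun l => e.apply_symm_apply l)

/-- Serves where the quotient map is only available as a relation between `B` and `C`: `A` is a
common cover of both, and `h` factors through `g`. -/
theorem hasQuotient_of_ker_le {A : Type u} [Group A] {B C : GroupOver K} (g : A →* B)
    (hg : Function.Surjective g) (h : A →* C) (hh : Function.Surjective h)
    (hker : ∀ a, g a = 1 → h a = 1) (k : K) (hk : ∀ a, k * B.hom (g a) * k⁻¹ = C.hom (h a)) :
    B.HasQuotient C := by
  have hker' : g.ker ≤ h.ker := fun a ha => hker a ha
  let f : B →* C := g.liftOfSurjective hg ⟨h, hker'⟩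
  have hf : ∀ a, f (g a) = h a := fun a =>
    MonoidHom.liftOfRightInverse_comp_apply _ _ (Function.rightInverse_surjInv hg) ⟨h, hker'⟩ a
  refine ⟨⟨f, k, fun b => ?_⟩, fun c => ?_⟩
  · obtain ⟨a, rfl⟩ := hg b
    rw [hk, hf]
  · obtain ⟨a, rfl⟩ := hh c
    exact ⟨g a, hf a⟩

theorem hasQuotient_quotientBy (L : GroupOver K) (Q : Subgroup L) (hn : Q.Normal)
    (hQ : Q ≤ L.hom.ker) : L.HasQuotient (L.quotientBy Q hn hQ) :=
  ⟨⟨QuotientGroup.mk' Q, 1, fun l => by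
    rw [one_mul, inv_one, mul_one]
    rfl⟩, QuotientGroup.mk'_surjective Q⟩

/-- The restriction of a group over `K` to a subgroup. -/
def restrict (L : GroupOver K) (W : Subgroup L) : GroupOver K where
  carrier := W
  hom := L.hom.comp W.subtype

/-- Induction on |M|. If f : M → L kills N, it factors through M/N. Otherwise f(N) is a nontrivial
normal subgroup in the kernel over K, so m_{L,f(N)} = 0. There is then a proper W with f(W) = L, WN
= M and m_{W,W∩N} ≠ 0. As W/(W ∩ N) ≅ M/N, the claim for W gives the claim for M. -/
theorem HasQuotient.quotientBy {L : GroupOver K} (hL : L.IsBKGroup) {M : GroupOver K}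
    (h : M.HasQuotient L) (N : Subgroup M) (hn : N.Normal) (hN : N ≤ M.hom.ker)
    (hm : mConst N ≠ 0) : (M.quotientBy N hn hN).HasQuotient L := by
  induction hc : Nat.card M using Nat.strong_induction_on generalizing M with | _ c ih =>
  obtain ⟨f, hf⟩ := h
  obtain ⟨k, hk⟩ := f.comm
  by_cases hbot : N.map f.toHom = ⊥
  · refine hasQuotient_of_ker_le (QuotientGroup.mk' N) (QuotientGroup.mk'_surjective N)
      f.toHom hf (fun a ha => ?_) k hk
    exact (Subgroup.map_eq_bot_iff N).1 hbot ((QuotientGroup.eq_one_iff a).1 ha)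
  · have h0 := hL (N.map f.toHom) (hn.map _ hf) ?_ hbot
    · obtain ⟨W, hW, hWf, hWN, hWm⟩ := exists_proper_of_mConst_map_eq_zero f.toHom hf N hm h0
      have hN' : N.subgroupOf W ≤ (M.restrict W).hom.ker := fun w hw => hN hw
      have hn' : (N.subgroupOf W).Normal := hn.subgroupOf W
      have h1 : (M.restrict W).HasQuotient L := by
        refine ⟨⟨f.toHom.comp W.subtype, k, fun w => hk (W.subtype w)⟩, fun l => ?_⟩
        obtain ⟨w, hw, rfl⟩ : l ∈ W.map f.toHom := hWf ▸ Subgroup.mem_top l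
        exact ⟨⟨w, hw⟩, rfl⟩
      have h2 := ih (Nat.card W) (hc ▸ lt_of_le_of_ne (Subgroup.card_le_card_group W)
        fun h => hW (Subgroup.card_eq_iff_eq_top W |>.1 h)) h1 (N.subgroupOf W) hn' hN' hWm rfl
      -- The common cover of M/N and W/(W ∩ N) is W itself; it is onto M/N because WN = M.
      refine HasQuotient.trans (hasQuotient_of_ker_le (A := W)
        ((QuotientGroup.mk' N).comp W.subtype) ?_ (QuotientGroup.mk' (N.subgroupOf W))
        (QuotientGroup.mk'_surjective _) (fun w hw => ?_) 1 fun w => ?_) h2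
      · intro q
        obtain ⟨m, rfl⟩ := QuotientGroup.mk'_surjective N q
        obtain ⟨w, hw, n, hn1, rfl⟩ := Subgroup.mem_sup_of_normal_right.1
          (hWN ▸ Subgroup.mem_top m : m ∈ W ⊔ N)
        refine ⟨⟨w, hw⟩, ?_⟩
        rw [map_mul, (QuotientGroup.eq_one_iff n).2 hn1 |> fun h => (h : QuotientGroup.mk' N n = 1),
          mul_one]
        rfl
      · exact (QuotientGroup.eq_one_iff w).2 ((QuotientGroup.eq_one_iff (w : M)).1 hw)
      · rw [one_mul, inv_one, mul_one]
        rfl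
    · rintro _ ⟨n, hn1, rfl⟩
      rw [MonoidHom.mem_ker, ← hk, MonoidHom.mem_ker.1 (hN hn1)]
      simp

theorem HasQuotient.beta {L M : GroupOver K} (hL : L.IsBKGroup) (h : M.HasQuotient L) :
    M.beta.HasQuotient L :=
  h.quotientBy hL _ _ _ M.exists_maximal.choose_spec.prop.2.2

theorem hasQuotient_beta (M : GroupOver K) : M.HasQuotient M.beta :=
  M.hasQuotient_quotientBy _ _ _

/-- If a normal subgroup N/Q of L/Q in the kernel had m ≠ 0, then m_{L,N} = m_{L,Q} m_{L/Q,N/Q} ≠ 0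
by multiplicativity, so N = Q by maximality of Q. -/
theorem beta_isBKGroup (L : GroupOver K) : L.beta.IsBKGroup := by
  intro N' hn hN hbot
  have hQ := L.exists_maximal.choose_spec
  set Q := L.exists_maximal.choose
  have : Q.Normal := hQ.prop.1
  let π := QuotientGroup.mk' Q
  have hs : Function.Surjective π := QuotientGroup.mk'_surjective Q
  have hle : Q ≤ N'.comap π := by
    intro q hq
    have : π q = 1 := (QuotientGroup.eq_one_iff q).2 hq
    exact Subgroup.mem_comap.2 (this.symm ▸ N'.one_mem)
  have hnorm : (N'.comap π).Normal := hn.comap π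
  have h1 := mConst_eq_mul hle
  rw [show (N'.comap π).map (QuotientGroup.mk' Q) = N' from
    Subgroup.map_comap_eq_self_of_surjective hs N'] at h1
  by_contra h0
  have h2 : mConst (N'.comap π) ≠ 0 := h1 ▸ mul_ne_zero hQ.prop.2.2 h0
  have h3 : N'.comap π ≤ Q := hQ.le_of_ge ⟨hnorm, fun l hl => hN hl, h2⟩ hle
  refine hbot (eq_bot_iff.2 fun q hq => ?_)
  obtain ⟨l, rfl⟩ := hs q
  exact (QuotientGroup.eq_one_iff l).2 (h3 hq)

end GroupOver

/-! ## Marks -/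

section Marks

open MulAction

variable {G : Type u} [Group G]

/-- The part of a `G`-set cut out by an invariant property. -/
def GSet.restrict (X : GSet G) (p : X → Prop) (hp : ∀ (g : G) x, p x → p (g • x)) : GSet G where
  carrier := {x : X // p x}
  action :=
    { smul := fun g x => ⟨g • x.1, hp g x.1 x.2⟩
      one_smul := fun x => Subtype.ext (one_smul G x.1)
      mul_smul := fun g h x => Subtype.ext (mul_smul g h x.1) }

theorem GSet.isIso_sum_restrict (X : GSet G) (p : X → Prop)
    (hp : ∀ (g : G) x, p x → p (g • x)) (hp' : ∀ (g : G) x, ¬ p x → ¬ p (g • x)) :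
    ((X.restrict p hp).sum (X.restrict (fun x => ¬ p x) hp')).IsIso X := by
  classical
  refine ⟨Equiv.sumCompl p, ?_⟩
  rintro g (x | x) <;> rfl

theorem GSet.transitive_isIso_orbit [Finite G] (X : GSet G) (x : X)
    (hp : ∀ (g : G) y, y ∈ orbit G x → g • y ∈ orbit G x) :
    (GSet.transitive (stabilizer G x)).IsIso (X.restrict (· ∈ orbit G x) hp) := by
  refine GSet.IsIso.of_bijective (fun q : G ⧸ stabilizer G x =>
    (⟨ofQuotientStabilizer G x q, ofQuotientStabilizer_mem_orbit G x q⟩ :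
      {y : X // y ∈ orbit G x})) ⟨?_, ?_⟩ ?_
  · intro a b h
    exact injective_ofQuotientStabilizer G x (Subtype.ext_iff.1 h)
  · rintro ⟨_, g, rfl⟩
    exact ⟨(QuotientGroup.mk g : G ⧸ stabilizer G x), Subtype.ext (ofQuotientStabilizer_mk G x g)⟩
  · intro g q
    exact Subtype.ext (ofQuotientStabilizer_smul G x g q)

variable {F : Type v} [Field F]

/-- Orbits are split off one at a time, by induction on the number of points. -/
theorem FB.hom_ext_transitive [Finite G] {M : Type*} [AddCommGroup M] [Module F M]
    {f g : FB F G →ₗ[F] M}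
    (h : ∀ X : Subgroup G, f (FB.cls F (.transitive X)) = g (FB.cls F (.transitive X))) :
    f = g := by
  refine FB.hom_ext fun Z => ?_
  induction hc : Nat.card Z using Nat.strong_induction_on generalizing Z with | _ c ih =>
  rcases isEmpty_or_nonempty Z with hZ | ⟨⟨z⟩⟩
  · have h0 : FB.cls F Z = FB.cls F Z + FB.cls F Z := by
      have : IsEmpty (Z.sum Z) := ⟨fun x => x.elim hZ.elim hZ.elim⟩
      rw [← FB.cls_sum]
      exact FB.cls_iso ⟨Equiv.equivOfIsEmpty _ _, fun _ x => hZ.elim x⟩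
    rw [left_eq_add.1 h0, map_zero, map_zero]
  · have hp : ∀ (g : G) y, y ∈ orbit G z → g • y ∈ orbit G z :=
      fun g y hy => MulAction.mem_orbit_of_mem_orbit g hy
    have hp' : ∀ (g : G) y, ¬ y ∈ orbit G z → ¬ g • y ∈ orbit G z :=
      fun g y hy hgy => hy (by simpa using hp g⁻¹ _ hgy)
    rw [← FB.cls_iso (Z.isIso_sum_restrict (· ∈ orbit G z) hp hp'), FB.cls_sum, map_add, map_add,
      ← FB.cls_iso (Z.transitive_isIso_orbit z hp), h]
    congr 1
    refine ih _ ?_ _ rfl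
    rw [← hc]
    exact Finite.card_subtype_lt (x := z) (fun hn => hn (mem_orbit_self z))

variable (F) in
/-- The mark of `FB(G)` at a subgroup `H`: the number of fixed points under `H`. -/
noncomputable def mark (H : Subgroup G) : FB F G →ₗ[F] F :=
  FB.lift (fun X => (Nat.card {x : X // H ≤ stabilizer G x} : F))
    (fun X Y h => by
      obtain ⟨e, he⟩ := h
      refine congrArg Nat.cast (Nat.card_congr (e.subtypeEquiv fun x => ?_))
      refine forall₂_congr fun g _ => ?_
      rw [mem_stabilizer_iff, mem_stabilizer_iff, ← he, e.injective.eq_iff])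
    (fun X Y => by
      rw [← Nat.cast_add, ← Nat.card_sum]
      refine congrArg Nat.cast (Nat.card_congr ?_)
      refine (Equiv.subtypeSum (α := X) (β := Y)).trans (Equiv.sumCongr ?_ ?_)
      · refine Equiv.subtypeEquivRight fun x => forall₂_congr fun g _ => ?_
        exact Sum.inl_injective.eq_iff
      · refine Equiv.subtypeEquivRight fun x => forall₂_congr fun g _ => ?_
        exact Sum.inr_injective.eq_iff)

theorem mark_cls (H : Subgroup G) (X : GSet G) :
    mark F H (FB.cls F X) = (Nat.card {x : X // H ≤ stabilizer G x} : F) :=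
  FB.lift_cls _ _ _ X

theorem mark_map_conj (H : Subgroup G) (g : G) :
    mark F (H.map (MulAut.conj g).toMonoidHom) = mark F H := by
  refine FB.hom_ext fun X => ?_
  rw [mark_cls, mark_cls]
  refine congrArg Nat.cast (Nat.card_congr ((MulAction.toPerm g).subtypeEquiv fun x => ?_)).symm
  rw [MulAction.toPerm_apply, stabilizer_smul_eq_stabilizer_map_conj,
    Subgroup.map_le_map_iff_of_injective (MulAut.conj g).injective]

theorem stabilizer_mk (X : Subgroup G) (g : G) :
    stabilizer G (QuotientGroup.mk g : G ⧸ X) = X.map (MulAut.conj g).toMonoidHom := by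
  rw [show (QuotientGroup.mk g : G ⧸ X) = g • (QuotientGroup.mk 1 : G ⧸ X) from
      congrArg QuotientGroup.mk (mul_one g).symm,
    stabilizer_smul_eq_stabilizer_map_conj, stabilizer_quotient]

theorem natCard_eq_sum {R : Type*} [NonAssocSemiring R] {α : Type*} [Fintype α] (p : α → Prop)
    [DecidablePred p] : (Nat.card {x // p x} : R) = ∑ x, if p x then 1 else 0 := by
  rw [Nat.card_eq_fintype_card, Fintype.card_subtype, Finset.sum_boole]

variable [Finite G]

attribute [local instance] fintypeSubgroup Classical.propDecidable

/-- The coset gX has stabilizer gXg⁻¹, so the fixed cosets of H are those with H ≤ gXg⁻¹; each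
consists of |X| elements g. -/
theorem card_mul_mark_transitive (H X : Subgroup G) :
    (Nat.card X : F) * mark F H (FB.cls F (.transitive X)) =
      Nat.card {g : G // H ≤ X.map (MulAut.conj g).toMonoidHom} := by
  rw [mark_cls, ← Nat.cast_mul, ← Nat.card_prod]
  refine congrArg Nat.cast (Nat.card_congr ?_)
  refine (QuotientGroup.preimageMkEquivSubgroupProdSet X
    {q : G ⧸ X | H ≤ stabilizer G q}).symm.trans (Equiv.subtypeEquivRight fun g => ?_)
  change H ≤ stabilizer G (QuotientGroup.mk g : G ⧸ X) ↔ _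
  rw [stabilizer_mk]

theorem idem_eq_sum (L : Subgroup G) :
    idem F L = (Nat.card (Subgroup.normalizer (L : Set G)) : F)⁻¹ •
      ∑ X : Subgroup G, ((Nat.card X : F) * (moebius X L : F)) • FB.cls F (.transitive X) := by
  rw [idem, finsum_eq_sum_of_fintype]
  congr 1
  rw [← Finset.sum_subset (Finset.subset_univ (Finset.univ.filter fun X : Subgroup G => X ≤ L))]
  · exact (Finset.sum_subtype (Finset.univ.filter fun X : Subgroup G => X ≤ L) (by simp)
      fun X : Subgroup G => ((Nat.card X : F) * (moebius X L : F)) •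
        FB.cls F (.transitive X)).symm
  · intro X _ hX
    rw [moebius_of_not_le (by simpa using hX), Int.cast_zero, mul_zero, zero_smul]

variable [CharZero F]

omit [Finite G] in
theorem le_map_conj_iff (H X : Subgroup G) (g : G) :
    H ≤ X.map (MulAut.conj g).toMonoidHom ↔ H.map (MulAut.conj g⁻¹).toMonoidHom ≤ X := by
  rw [← Subgroup.map_le_map_iff_of_injective (f := (MulAut.conj g).toMonoidHom)
    (MulAut.conj g).injective (H := H.map _), Subgroup.map_map]
  have h : (MulAut.conj g).toMonoidHom.comp (MulAut.conj g⁻¹).toMonoidHom = MonoidHom.id G := by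
    ext x
    simp [mul_assoc]
  rw [h, Subgroup.map_id]

/-- The factor |X| in the definition of e_L cancels the one in `card_mul_mark_transitive`. For each
g what remains is the sum of μ(X, L) over X ≥ g⁻¹Hg, which is 1 if g⁻¹Hg = L and 0 otherwise. -/
theorem card_mul_mark_idem (H L : Subgroup G) :
    (Nat.card (Subgroup.normalizer (L : Set G)) : F) * mark F H (idem F L) =
      Nat.card {g : G // H.map (MulAut.conj g⁻¹).toMonoidHom = L} := by
  have := Fintype.ofFinite G
  rw [idem_eq_sum, map_smul, smul_eq_mul, mul_inv_cancel_left₀ (by simp),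
    map_sum, natCard_eq_sum]
  have h1 : ∀ X : Subgroup G, mark F H (((Nat.card X : F) * (moebius X L : F)) •
      FB.cls F (.transitive X)) = ∑ g : G, ((if H.map (MulAut.conj g⁻¹).toMonoidHom ≤ X then
        moebius X L else 0 : ℤ) : F) := by
    intro X
    rw [map_smul, smul_eq_mul, mul_right_comm, card_mul_mark_transitive, natCard_eq_sum,
      Finset.sum_mul]
    refine Finset.sum_congr rfl fun g _ => ?_
    simp only [le_map_conj_iff]
    split_ifs <;> simp
  simp only [h1]
  rw [Finset.sum_comm]
  refine Finset.sum_congr rfl fun g _ => ?_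
  rw [← Int.cast_sum, sum_moebius_left]
  split_ifs <;> simp

/-- The elements counted by `card_mul_mark_idem` are here the inverses of the elements of the
normalizer. -/
theorem mark_idem_self (L : Subgroup G) : mark F L (idem F L) = 1 := by
  have h0 : (Nat.card (Subgroup.normalizer (L : Set G)) : F) ≠ 0 := by simp [Nat.card_pos.ne']
  refine mul_left_cancel₀ h0 ((card_mul_mark_idem L L).trans ?_)
  rw [mul_one]
  refine congrArg Nat.cast (Nat.card_congr ((Equiv.inv G).subtypeEquiv fun g => ?_))
  rw [Equiv.inv_apply, Subgroup.mem_normalizer_iff_map_conj_eq]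
  rfl

theorem exists_conj_of_mark_idem_ne_zero {H L : Subgroup G} (h : mark F H (idem F L) ≠ 0) :
    ∃ g : G, H = L.map (MulAut.conj g).toMonoidHom := by
  by_contra! hg
  have h1 := card_mul_mark_idem (F := F) H L
  have h2 : Nat.card {g : G // H.map (MulAut.conj g⁻¹).toMonoidHom = L} = 0 := by
    refine Nat.card_eq_zero.2 (Or.inl ⟨fun g => hg g.1 ?_⟩)
    refine le_antisymm ((le_map_conj_iff _ _ _).2 g.2.le) ?_
    obtain ⟨g, rfl⟩ := g
    rintro _ ⟨_, ⟨x, hx, rfl⟩, rfl⟩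
    simpa [mul_assoc] using hx
  rw [h2, Nat.cast_zero] at h1
  exact h ((mul_eq_zero.1 h1).resolve_left (Nat.cast_ne_zero.2 Nat.card_pos.ne'))

theorem transitive_conj_isIso (X : Subgroup G) (g : G) :
    (GSet.transitive (X.map (MulAut.conj g).toMonoidHom)).IsIso (GSet.transitive X) := by
  rw [← stabilizer_mk]
  refine GSet.IsIso.of_bijective (fun q : G ⧸ stabilizer G (QuotientGroup.mk g : G ⧸ X) =>
    ofQuotientStabilizer G (QuotientGroup.mk g : G ⧸ X) q)
    ⟨injective_ofQuotientStabilizer G _, fun y => ?_⟩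
    (fun h q => ofQuotientStabilizer_smul G _ h q)
  obtain ⟨h, rfl⟩ := MulAction.exists_smul_eq G (QuotientGroup.mk g : G ⧸ X) y
  exact ⟨(QuotientGroup.mk h : G ⧸ _), ofQuotientStabilizer_mk G _ h⟩

/-- Expansion of an element of `FB(G)` in terms of its marks. -/
theorem eq_sum_mark_smul_idem (a : FB F G) :
    a = (Nat.card G : F)⁻¹ • ∑ L : Subgroup G,
      ((Nat.card (Subgroup.normalizer (L : Set G)) : F) * mark F L a) • idem F L := by
  -- The sum is over all subgroups rather than conjugacy classes: a class has |G| / |N_G(L)| members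
  -- with equal terms, which accounts for the coefficients.
  suffices h : LinearMap.id = (Nat.card G : F)⁻¹ • ∑ L : Subgroup G,
      ((Nat.card (Subgroup.normalizer (L : Set G)) : F) • (mark F L).smulRight (idem F L)) by
    have := LinearMap.congr_fun h a
    simpa [mul_smul] using this
  refine FB.hom_ext_transitive fun Z => ?_
  have := Fintype.ofFinite (G ⧸ Z)
  have h0 : (Nat.card G : F) ≠ 0 := by simp [Nat.card_pos.ne']
  -- Evaluate at G/Z, where the mark at L counts the points z with L ≤ Stab(z). Summing μ(Y, L) over
  -- such L leaves Y = Stab(z), so each z contributes |Stab(z)| [G/Stab(z)] = |Z| [G/Z]. The |G/Z|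
  -- points together give |G| [G/Z].
  have h1 : ∀ L : Subgroup G, ((Nat.card (Subgroup.normalizer (L : Set G)) : F) •
      (mark F L).smulRight (idem F L)) (FB.cls F (.transitive Z)) =
      ∑ Y : Subgroup G, ∑ z : G ⧸ Z, ((Nat.card Y : F) *
        ((if L ≤ stabilizer G z then moebius Y L else 0 : ℤ) : F)) • FB.cls F (.transitive Y) := by
    intro L
    have hN : (Nat.card (Subgroup.normalizer (L : Set G)) : F) ≠ 0 :=
      Nat.cast_ne_zero.2 Nat.card_pos.ne'
    rw [LinearMap.smul_apply, LinearMap.smulRight_apply, idem_eq_sum, smul_smul, smul_smul,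
      mul_right_comm, mul_inv_cancel₀ hN, one_mul, Finset.smul_sum, mark_cls]
    refine Finset.sum_congr rfl fun Y _ => ?_
    rw [smul_smul, ← Finset.sum_smul]
    congr 1
    refine (congrArg (· * _) (natCard_eq_sum (α := G ⧸ Z) _)).trans ?_
    rw [Finset.sum_mul]
    refine Finset.sum_congr rfl fun z _ => ?_
    split_ifs with h h' h'
    · simp
    · exact absurd h h'
    · exact absurd h' h
    · simp
  have h2 : ∀ z : G ⧸ Z, ∃ g : G, stabilizer G z = Z.map (MulAut.conj g).toMonoidHom := by
    rintro ⟨g⟩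
    exact ⟨g, stabilizer_mk Z g⟩
  have h3 : ∀ z : G ⧸ Z, (Nat.card (stabilizer G z) : F) • FB.cls F (.transitive (stabilizer G z)) =
      (Nat.card Z : F) • FB.cls F (.transitive Z) := by
    intro z
    obtain ⟨g, hg⟩ := h2 z
    rw [hg, FB.cls_iso (transitive_conj_isIso Z g), ← Nat.card_congr
      (Z.equivMapOfInjective _ (MulAut.conj g).injective).toEquiv]
  rw [LinearMap.smul_apply, LinearMap.sum_apply]
  simp only [h1]
  rw [Finset.sum_comm]
  have h4 : ∀ Y : Subgroup G, ∑ L : Subgroup G, ∑ z : G ⧸ Z, ((Nat.card Y : F) *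
        ((if L ≤ stabilizer G z then moebius Y L else 0 : ℤ) : F)) • FB.cls F (.transitive Y) =
      ∑ z : G ⧸ Z, if Y = stabilizer G z then
        (Nat.card Y : F) • FB.cls F (.transitive Y) else 0 := by
    intro Y
    rw [Finset.sum_comm]
    refine Finset.sum_congr rfl fun z _ => ?_
    rw [← Finset.sum_smul, ← Finset.mul_sum, ← Int.cast_sum, sum_moebius_right]
    split_ifs <;> simp
  simp only [h4]
  rw [Finset.sum_comm]
  simp only [Finset.sum_ite_eq', Finset.mem_univ, if_true, h3]
  rw [Finset.sum_const, Finset.card_univ, ← Nat.card_eq_fintype_card, ← Nat.cast_smul_eq_nsmul F,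
    smul_smul, smul_smul, mul_assoc, ← Nat.cast_mul,
    ← Subgroup.card_eq_card_quotient_mul_card_subgroup,
    inv_mul_cancel₀ h0, one_smul, LinearMap.id_apply]

/-- Burnside's theorem on marks, read off from the expansion above. -/
theorem mark_injective {a b : FB F G} (h : ∀ X : Subgroup G, mark F X a = mark F X b) :
    a = b := by
  rw [eq_sum_mark_smul_idem a, eq_sum_mark_smul_idem b]
  simp only [h]

theorem idem_map_conj (L : Subgroup G) (g : G) :
    idem F (L.map (MulAut.conj g).toMonoidHom) = idem F L := by
  refine mark_injective fun X => ?_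
  have h1 : mark F L (idem F (L.map (MulAut.conj g).toMonoidHom)) = 1 := by
    rw [← mark_map_conj L g, mark_idem_self]
  by_cases h : mark F X (idem F L) = 0
  · by_cases h' : mark F X (idem F (L.map (MulAut.conj g).toMonoidHom)) = 0
    · rw [h, h']
    · obtain ⟨k, rfl⟩ := exists_conj_of_mark_idem_ne_zero h'
      rw [mark_map_conj, mark_map_conj, h1, mark_idem_self]
  · obtain ⟨k, rfl⟩ := exists_conj_of_mark_idem_ne_zero h
    rw [mark_map_conj, h1, mark_idem_self]

end Marks

/-! ## Marks of tensor products with bisets -/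

section BisetMarks

open MulAction MulOpposite

attribute [local instance] fintypeSubgroup Classical.propDecidable

/-- Möbius inversion: for every subgroup S, the sum of `relConst N W` over W ≤ S is |S ∩ N| if SN =
T and 0 otherwise. Apply this to S = `s x` and add over x. -/
theorem sum_relConst_mul {T : Type u} [Group T] [Finite T] (N : Subgroup T) {X : Type*}
    [Fintype X] (s : X → Subgroup T) :
    ∑ x, (if s x ⊔ N = ⊤ then (Nat.card ↥(s x ⊓ N) : ℤ) else 0) =
      ∑ W : Subgroup T, relConst N W * (Nat.card {x // W ≤ s x} : ℤ) := by
  have h1 : ∀ W : Subgroup T, relConst N W * (Nat.card {x // W ≤ s x} : ℤ) =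
      ∑ x : X, ∑ Y : Subgroup T, (if Y ⊔ N = ⊤ then (Nat.card ↥(Y ⊓ N) : ℤ) else 0) *
        (if W ≤ s x then moebius Y W else 0) := by
    intro W
    rw [natCard_eq_sum, Finset.mul_sum]
    refine Finset.sum_congr rfl fun x _ => ?_
    rw [relConst, Finset.sum_mul]
    refine Finset.sum_congr rfl fun Y _ => ?_
    split_ifs <;> simp
  simp only [h1]
  rw [Finset.sum_comm]
  refine Finset.sum_congr rfl fun x _ => ?_
  rw [Finset.sum_comm]
  simp only [← Finset.mul_sum, sum_moebius_right]
  simp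

variable {G H : Type u} [Group G] [Group H]

/-- The subgroup of the elements `g` of `G` such that `v g = z v` for some `z ∈ Z`. -/
def Biset.transport (V : Biset H G) (Z : Subgroup H) (v : V) : Subgroup G where
  carrier := {g | ∃ z ∈ Z, z • v = op g • v}
  one_mem' := ⟨1, Z.one_mem, by simp⟩
  mul_mem' := by
    rintro g g' ⟨z, hz, h⟩ ⟨z', hz', h'⟩
    refine ⟨z * z', Z.mul_mem hz hz', ?_⟩
    rw [op_mul, mul_smul, mul_smul, h', ← h, smul_comm]
  inv_mem' := by
    rintro g ⟨z, hz, h⟩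
    refine ⟨z⁻¹, Z.inv_mem hz, ?_⟩
    rw [inv_smul_eq_iff, smul_comm, h, op_inv, inv_smul_smul]

/-- The subgroup of the elements `g` of `G` such that `v g = v`. -/
def Biset.rightStab (V : Biset H G) (v : V) : Subgroup G where
  carrier := {g | op g • v = v}
  one_mem' := by simp
  mul_mem' := by
    intro g g' (h : op g • v = v) (h' : op g' • v = v)
    change op (g * g') • v = v
    rw [op_mul, mul_smul, h, h']
  inv_mem' := by
    intro g (h : op g • v = v)
    change op g⁻¹ • v = v
    rw [op_inv, inv_smul_eq_iff, h]

theorem Biset.mem_rightStab {V : Biset H G} {v : V} {g : G} :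
    g ∈ V.rightStab v ↔ op g • v = v := Iff.rfl

theorem Biset.rightStab_le_transport (V : Biset H G) (Z : Subgroup H) (v : V) :
    V.rightStab v ≤ V.transport Z v :=
  fun g (hg : op g • v = v) => ⟨1, Z.one_mem, by rw [one_smul, hg]⟩

instance Biset.rightStab_subgroupOf_normal (V : Biset H G) (Z : Subgroup H) (v : V) :
    ((V.rightStab v).subgroupOf (V.transport Z v)).Normal where
  conj_mem := by
    rintro ⟨n, _⟩ hn ⟨g, z, hz, h⟩
    change op (g * n * g⁻¹) • v = v
    have hn' : op n • v = v := hn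
    rw [op_mul, op_mul, mul_smul, mul_smul, op_inv, inv_smul_eq_iff, ← h, ← smul_comm z, hn']

/-- Z fixes the class of (v, x) when each z ∈ Z admits g ∈ Stab(x) with zv = vg. For fixed z, the g
with zv = vg form a coset of the right stabilizer N of v. So, once every z admits some g, the
condition says that the transport group is the product of N and its intersection with Stab(x). -/
theorem Biset.le_stabilizer_tensor_iff (V : Biset H G) (X : GSet G) (Z : Subgroup H) (v : V)
    (x : X) : Z ≤ stabilizer H (α := V.tensor X) (TensorOver.mk v x : TensorOver G V X) ↔
      (∀ z ∈ Z, ∃ g : G, z • v = op g • v) ∧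
      (stabilizer G x).subgroupOf (V.transport Z v) ⊔
        (V.rightStab v).subgroupOf (V.transport Z v) = ⊤ := by
  have h1 : Z ≤ stabilizer H (α := V.tensor X) (TensorOver.mk v x : TensorOver G V X) ↔
      ∀ z ∈ Z, ∃ g : G, z • v = op g • v ∧ g ∈ stabilizer G x := by
    refine forall₂_congr fun z _ => ?_
    change (TensorOver.mk (z • v) x : TensorOver G V X) = TensorOver.mk v x ↔ _
    rw [eq_comm, TensorOver.mk_eq_iff]
    refine exists_congr fun g => and_congr_right fun _ => ?_
    rw [eq_inv_smul_iff, mem_stabilizer_iff]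
  rw [h1]
  constructor
  · refine fun h => ⟨fun z hz => ?_, eq_top_iff.2 ?_⟩
    · obtain ⟨g, hg, -⟩ := h z hz
      exact ⟨g, hg⟩
    rintro ⟨g, z, hz, hg⟩ -
    obtain ⟨g', h2, h3⟩ := h z hz
    have hg' : g' ∈ V.transport Z v := ⟨z, hz, h2⟩
    refine Subgroup.mem_sup_of_normal_right.2 ⟨⟨g', hg'⟩, h3,
      ⟨g'⁻¹ * g, mul_mem (inv_mem hg') ⟨z, hz, hg⟩⟩, ?_, Subtype.ext (by simp)⟩
    change op (g'⁻¹ * g) • v = v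
    have h4 : op g'⁻¹ • v = z⁻¹ • v := by
      rw [op_inv, inv_smul_eq_iff, ← smul_comm z⁻¹, eq_inv_smul_iff, h2]
    rw [op_mul, mul_smul, h4, ← smul_comm z⁻¹, ← hg, inv_smul_smul]
  · rintro ⟨h2, h3⟩ z hz
    obtain ⟨g, hg⟩ := h2 z hz
    obtain ⟨⟨s, z', hz', hs⟩, hs', ⟨n, hn⟩, hn', h4⟩ := Subgroup.mem_sup_of_normal_right.1
      (h3 ▸ Subgroup.mem_top (⟨g, z, hz, hg⟩ : V.transport Z v))
    have h5 : s * n = g := congrArg Subtype.val h4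
    have h6 : op n • v = v := hn'
    refine ⟨s, ?_, hs'⟩
    rw [hg, ← h5, op_mul, mul_smul, ← hs, ← smul_comm z', h6]

/-- The diagonal action of `G` on `V × X`, whose orbits are the elements of `V ×_G X`. -/
def Biset.pairs (V : Biset H G) (X : GSet G) : GSet G where
  carrier := V × X
  action :=
    { smul := fun g p => (op g⁻¹ • p.1, g • p.2)
      one_smul := fun p => Prod.ext (by change op (1 : G)⁻¹ • p.1 = p.1; simp) (one_smul G p.2)
      mul_smul := fun g h p => Prod.ext
        (by
          change op (g * h)⁻¹ • p.1 = op g⁻¹ • op h⁻¹ • p.1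
          rw [mul_inv_rev, op_mul, mul_smul]) (mul_smul g h p.2) }

theorem Biset.mk_smul_pairs (V : Biset H G) (X : GSet G) (g : G) (q : V.pairs X) :
    (TensorOver.mk (g • q).1 (g • q).2 : TensorOver G V X) = TensorOver.mk q.1 q.2 := by
  refine TensorOver.mk_eq_iff.2 ⟨g, ?_, ?_⟩
  · change q.1 = op g • op g⁻¹ • q.1
    rw [op_inv, smul_inv_smul]
  · change q.2 = g⁻¹ • g • q.2
    rw [inv_smul_smul]

/-- Orbit counting for the diagonal action of G on the pairs whose class satisfies `p`: both sides
count pairs (q, g) with g fixing q. -/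
theorem Biset.card_mul_card_tensor (V : Biset H G) (X : GSet G) (p : TensorOver G V X → Prop) :
    Nat.card {t // p t} * Nat.card G = Nat.card (Σ q : {q : V × X // p (TensorOver.mk q.1 q.2)},
      ↥(stabilizer G q.1.2 ⊓ V.rightStab q.1.1)) := by
  have hp : ∀ (g : G) (q : V.pairs X), p (TensorOver.mk q.1 q.2) →
      p (TensorOver.mk (g • q).1 (g • q).2) := fun g q hq =>
    (congrArg p (V.mk_smul_pairs X g q)).mpr hq
  let Y : GSet G := (V.pairs X).restrict (fun q : V × X => p (TensorOver.mk q.1 q.2)) hp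
  let f : orbitRel.Quotient G Y → {t // p t} :=
    Quotient.lift (fun y : Y => ⟨TensorOver.mk y.1.1 y.1.2, y.2⟩) (by
      rintro _ y ⟨g, rfl⟩
      exact Subtype.ext (V.mk_smul_pairs X g y.1))
  have hf : Function.Bijective f := by
    constructor
    · rintro ⟨y⟩ ⟨y'⟩ h
      obtain ⟨g, h1, h2⟩ := TensorOver.mk_eq_iff.1 (Subtype.ext_iff.1 h)
      refine Quotient.sound ⟨g, Subtype.ext (Prod.ext ?_ ?_)⟩
      · change op g⁻¹ • y'.1.1 = y.1.1
        rw [h1, op_inv, inv_smul_smul]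
      · change g • y'.1.2 = y.1.2
        rw [h2, smul_inv_smul]
    · rintro ⟨t, ht⟩
      revert t
      exact TensorOver.ind fun v x ht => ⟨Quotient.mk _ ⟨(v, x), ht⟩, rfl⟩
  rw [← Nat.card_congr (Equiv.ofBijective f hf), ← Nat.card_prod]
  have hfix : ∀ (g : G) (y : Y), g • y = y ↔ g ∈ stabilizer G y.1.2 ⊓ V.rightStab y.1.1 := by
    intro g y
    have h1 : g • y = y ↔ op g⁻¹ • y.1.1 = y.1.1 ∧ g • y.1.2 = y.1.2 :=
      Subtype.ext_iff.trans Prod.ext_iff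
    rw [h1, Subgroup.mem_inf, mem_stabilizer_iff, mem_rightStab, op_inv, inv_smul_eq_iff, and_comm,
      eq_comm (a := y.1.1)]
  refine Nat.card_congr ((sigmaFixedByEquivOrbitsProdGroup G Y).symm.trans
    ⟨fun s => ⟨s.2.1, s.1, (hfix _ _).1 s.2.2⟩, fun s => ⟨s.2.1, s.1, (hfix _ _).2 s.2.2⟩,
      fun _ => rfl, fun _ => rfl⟩)

variable [Finite G] (F : Type v) [Field F]

/-- The marks of the image of an element under a biset, in terms of the marks of the element. -/
theorem card_smul_mark_comp_map (V : Biset H G) [Fintype V] (Z : Subgroup H) :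
    (Nat.card G : F) • mark F Z ∘ₗ FB.map F V = ∑ v : V,
      if (∀ z ∈ Z, ∃ g : G, z • v = op g • v) then ∑ W : Subgroup (V.transport Z v),
        (relConst ((V.rightStab v).subgroupOf (V.transport Z v)) W : F) •
          mark F (W.map (V.transport Z v).subtype) else 0 := by
  refine FB.hom_ext fun X => ?_
  have := Fintype.ofFinite X
  rw [LinearMap.smul_apply, LinearMap.comp_apply, FB.map_cls, mark_cls, smul_eq_mul, mul_comm,
    ← Nat.cast_mul]
  refine (congrArg Nat.cast (V.card_mul_card_tensor X
    fun t => Z ≤ stabilizer H (α := V.tensor X) t)).trans ?_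
  rw [Nat.card_sigma, LinearMap.sum_apply]
  rw [← Finset.sum_subtype (Finset.univ.filter fun q : V × X =>
    Z ≤ stabilizer H (α := V.tensor X) (TensorOver.mk q.1 q.2 : TensorOver G V X)) (by simp)
    fun q : V × X => Nat.card ↥(stabilizer G q.2 ⊓ V.rightStab q.1), Finset.sum_filter,
    Fintype.sum_prod_type, Nat.cast_sum]
  refine Finset.sum_congr rfl fun v _ => ?_
  simp only [Biset.le_stabilizer_tensor_iff]
  split_ifs with hv
  · have h1 := sum_relConst_mul ((V.rightStab v).subgroupOf (V.transport Z v))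
      fun x : X => (stabilizer G x).subgroupOf (V.transport Z v)
    have h2 := congrArg (Int.cast : ℤ → F) h1
    rw [Int.cast_sum, Int.cast_sum] at h2
    rw [LinearMap.sum_apply, Nat.cast_sum]
    refine Eq.trans (Finset.sum_congr rfl fun x _ => ?_) (h2.trans
      (Finset.sum_congr rfl fun W _ => ?_))
    · by_cases h : (stabilizer G x).subgroupOf (V.transport Z v) ⊔
          (V.rightStab v).subgroupOf (V.transport Z v) = ⊤
      · rw [if_pos ⟨hv, h⟩, if_pos h, Int.cast_natCast]
        exact congrArg Nat.cast (Nat.card_congr (Subgroup.subgroupOfEquivOfLe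
          (inf_le_right.trans (V.rightStab_le_transport Z v))).toEquiv).symm
      · rw [if_neg fun h' => h h'.2, if_neg h, Nat.cast_zero, Int.cast_zero]
    · rw [LinearMap.smul_apply, mark_cls, Int.cast_mul, Int.cast_natCast, smul_eq_mul]
      simp only [Subgroup.map_le_iff_le_comap]
      rfl
  · simp [hv]

end BisetMarks

/-! ## Restriction and induction along homomorphisms -/

section ResInd

open MulAction MulOpposite

variable {G H K : Type u} [Group G] [Group H] [Group K]

/-- The restriction of an `H`-set along `f : G → H`. -/
def GSet.comap (f : G →* H) (X : GSet H) : GSet G where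
  carrier := X
  action := MulAction.compHom X f

/-- The `(G, H)`-biset `H`, with action `g · x · h = f(g) x h`. -/
def Biset.res [Finite H] (f : G →* H) : Biset G H where
  carrier := H
  left := MulAction.compHom H f
  comm := by
    let _ : MulAction G H := MulAction.compHom H f
    exact ⟨fun g h x => (mul_assoc (f g) x h.unop).symm⟩

/-- The right `G`-action `x · g = x f(g)` on `H`. -/
abbrev Biset.indRight (f : G →* H) : MulAction Gᵐᵒᵖ H where
  smul := fun g u => u * f g.unop
  one_smul := fun u => show u * f 1 = u by simp
  mul_smul := fun g g' u => show u * f (g'.unop * g.unop) = u * f g'.unop * f g.unop by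
    simp [mul_assoc]

/-- The `(H, G)`-biset `H`, with action `h · x · g = h x f(g)`. -/
def Biset.ind [Finite H] (f : G →* H) : Biset H G where
  carrier := H
  right := Biset.indRight f
  comm := by
    let _ := Biset.indRight f
    exact ⟨fun h g u => (mul_assoc h u (f g.unop)).symm⟩

theorem Biset.res_tensor_isIso [Finite H] (f : G →* H) (X : GSet H) :
    ((Biset.res f).tensor X).IsIso (X.comap f) := by
  refine GSet.IsIso.of_bijective
    (TensorOver.lift (fun (h : H) (x : X) => h • x) ?_) ⟨?_, ?_⟩ ?_
  · intro (g : H) h x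
    exact (smul_smul (g * h) h⁻¹ x).trans (by rw [mul_inv_cancel_right])
  · refine TensorOver.ind fun (g : H) x => TensorOver.ind fun (g' : H) x' h => ?_
    refine TensorOver.mk_eq_iff.2 ⟨g⁻¹ * g', (by exact (mul_inv_cancel_left g g').symm), ?_⟩
    replace h : g • x = g' • x' := h
    rw [mul_inv_rev, inv_inv, mul_smul, h, inv_smul_smul]
  · exact fun (x : X) =>
      ⟨(TensorOver.mk (1 : H) x : TensorOver H (Biset.res f) X), one_smul H (α := X) x⟩
  · exact fun g => TensorOver.ind fun (h : H) x => mul_smul (f g) h x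

theorem Biset.res_timesK_isIso [Finite H] [Finite K] (f : G →* H) :
    ((Biset.res f).timesK K).IsIso (Biset.res (f.prodMap (MonoidHom.id K))) :=
  ⟨Equiv.refl (H × K), fun _ _ => rfl, fun _ _ => rfl⟩

theorem Biset.ind_timesK_isIso [Finite H] [Finite K] (f : G →* H) :
    ((Biset.ind f).timesK K).IsIso (Biset.ind (f.prodMap (MonoidHom.id K))) :=
  ⟨Equiv.refl (H × K), fun _ _ => rfl, fun _ _ => rfl⟩

/-- The tensor product is a single orbit, and the class of (1, S) has stabilizer f(S). For
non-injective f the functor combines deflation to the image with induction. -/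
theorem Biset.transitive_isIso_ind_tensor [Finite G] [Finite H] (f : G →* H) (S : Subgroup G) :
    (GSet.transitive (S.map f)).IsIso ((Biset.ind f).tensor (GSet.transitive S)) := by
  let T := TensorOver G (Biset.ind f) (GSet.transitive S)
  let m : H → G ⧸ S → T := fun h x => TensorOver.mk (V := Biset.ind f) (U := GSet.transitive S) h x
  have hm : ∀ (h : H) (g : G) (x : G ⧸ S), m (h * f g) x = m h (g • x) := fun h g x =>
    TensorOver.mk_smul (V := Biset.ind f) (U := GSet.transitive S) h g x
  have h1 : ∀ g : G, g ∈ S ↔ g • (QuotientGroup.mk 1 : G ⧸ S) = QuotientGroup.mk 1 := fun g => by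
    rw [← mem_stabilizer_iff, stabilizer_quotient]
  refine GSet.IsIso.of_bijective (Quotient.lift (fun h : H => m h (QuotientGroup.mk 1)) ?_)
    ⟨?_, ?_⟩ ?_
  · intro h h' hh
    obtain ⟨s, hs, hs'⟩ := QuotientGroup.leftRel_apply.1 hh
    rw [show h' = h * f s by rw [hs', mul_inv_cancel_left], hm, (h1 s).1 hs]
  · rintro ⟨h⟩ ⟨h'⟩ hh
    obtain ⟨g, h2, h3⟩ := TensorOver.mk_eq_iff.1 (show m h (QuotientGroup.mk 1) = m h' _ from hh)
    replace h2 : h' = h * f g := h2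
    refine QuotientGroup.eq.2 ⟨g, (h1 g).2 ?_, ?_⟩
    · exact (eq_inv_smul_iff.1 h3)
    · rw [h2, inv_mul_cancel_left]
  · refine TensorOver.ind fun (h : H) x => ?_
    obtain ⟨g⟩ := x
    refine ⟨QuotientGroup.mk (h * f g), ?_⟩
    change m (h * f g) (QuotientGroup.mk 1) = m h (QuotientGroup.mk g)
    rw [hm]
    exact congrArg (m h) (congrArg QuotientGroup.mk (mul_one g))
  · rintro h ⟨h'⟩
    rfl

variable (F : Type v) [Field F]

theorem mark_map_res [Finite H] (f : G →* H) (Z : Subgroup G) (a : FB F H) :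
    mark F Z (FB.map F (Biset.res f) a) = mark F (Z.map f) a := by
  suffices h : mark F Z ∘ₗ FB.map F (Biset.res f) = mark F (Z.map f) from LinearMap.congr_fun h a
  refine FB.hom_ext fun X => ?_
  rw [LinearMap.comp_apply, FB.map_cls, FB.cls_iso (Biset.res_tensor_isIso f X), mark_cls, mark_cls]
  simp only [Subgroup.map_le_iff_le_comap]
  rfl

theorem map_ind_idem [Finite G] [Finite H] (f : G →* H) (S : Subgroup G) :
    letI := fintypeSubgroup (G := G)
    FB.map F (Biset.ind f) (idem F S) = (Nat.card (Subgroup.normalizer (S : Set G)) : F)⁻¹ •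
      ∑ X : Subgroup G, ((Nat.card X : F) * (moebius X S : F)) •
        FB.cls F (.transitive (X.map f)) := by
  simp only [idem_eq_sum, map_smul, map_sum, FB.map_cls,
    FB.cls_iso (Biset.transitive_isIso_ind_tensor f _)]

attribute [local instance] fintypeSubgroup Classical.propDecidable

/-- For X ≤ S, the condition f(X) = f(S) means X(S ∩ ker f) = S, so this is the sum defining
m_{S,S∩ker f}. -/
theorem sum_card_mul_moebius_of_map_eq [Finite G] (f : G →* H) (S : Subgroup G) :
    ∑ X : Subgroup G, (if X ≤ S ∧ X.map f = S.map f then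
      (Nat.card X : ℚ) * (moebius X S : ℚ) else 0) =
      Nat.card S * mConst (f.ker.subgroupOf S) := by
  rw [mConst_eq]
  symm
  refine Finset.sum_of_injOn (fun X : Subgroup S => X.map S.subtype)
    (Subgroup.map_injective S.subtype_injective).injOn (fun _ _ => Finset.mem_univ _) ?_ ?_
  · intro Y _ hY
    refine if_neg fun h => hY ⟨Y.subgroupOf S, by simp, Subgroup.map_subgroupOf_eq_of_le h.1⟩
  · intro X _
    have h1 : X ⊔ f.ker.subgroupOf S = ⊤ ↔
        X.map S.subtype ≤ S ∧ (X.map S.subtype).map f = S.map f := by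
      rw [and_iff_right (Subgroup.map_subtype_le X), Subgroup.map_map,
        show f.ker.subgroupOf S = (f.comp S.subtype).ker from rfl, ← Subgroup.comap_map_eq,
        eq_top_iff, ← Subgroup.map_le_iff_le_comap, ← MonoidHom.range_eq_map, MonoidHom.range_comp,
        Subgroup.range_subtype]
      refine ⟨fun h => le_antisymm ?_ h, fun h => h.ge⟩
      rw [← Subgroup.map_map]
      exact Subgroup.map_mono (Subgroup.map_subtype_le X)
    simp only [h1, moebius_map_subtype]
    rw [Nat.card_congr (X.equivMapOfInjective _ S.subtype_injective).toEquiv]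

/-- The image of e_S is a combination of the [H/f(X)] with X ≤ S. If f(X) is smaller than f(S), its
order forbids a conjugate containing f(S), so the mark vanishes. The terms with f(X) = f(S) add up
to |S| m_{S,S∩ker f} times a nonzero mark. -/
theorem mark_map_ind_idem_ne_zero [CharZero F] [Finite G] [Finite H] (f : G →* H) (S : Subgroup G)
    (hS : mConst (f.ker.subgroupOf S) ≠ 0) :
    mark F (S.map f) (FB.map F (Biset.ind f) (idem F S)) ≠ 0 := by
  have hN : (Nat.card (Subgroup.normalizer (S : Set G)) : F) ≠ 0 :=
    Nat.cast_ne_zero.2 Nat.card_pos.ne'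
  have hc : mark F (S.map f) (FB.cls F (.transitive (S.map f))) ≠ 0 := by
    rw [mark_cls]
    have : Nonempty {x : GSet.transitive (S.map f) // S.map f ≤ stabilizer H x} :=
      ⟨(QuotientGroup.mk 1 : H ⧸ S.map f), (stabilizer_quotient (S.map f)).ge⟩
    exact Nat.cast_ne_zero.2 Nat.card_pos.ne'
  have h0 : ∀ X : Subgroup G, X ≤ S → X.map f ≠ S.map f →
      mark F (S.map f) (FB.cls F (.transitive (X.map f))) = 0 := by
    intro X hX hne
    have h1 := card_mul_mark_transitive (F := F) (S.map f) (X.map f)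
    have h2 : Nat.card {g : H // S.map f ≤ (X.map f).map (MulAut.conj g).toMonoidHom} = 0 := by
      refine Nat.card_eq_zero.2 (Or.inl ⟨?_⟩)
      rintro ⟨g, hg⟩
      refine hne (Subgroup.eq_of_le_of_card_ge (Subgroup.map_mono hX) ?_)
      rw [Nat.card_congr ((X.map f).equivMapOfInjective (MulAut.conj g).toMonoidHom
        (MulAut.conj g).injective).toEquiv]
      exact Subgroup.card_le_of_le hg
    rw [h2, Nat.cast_zero] at h1
    exact (mul_eq_zero.1 h1).resolve_left (Nat.cast_ne_zero.2 Nat.card_pos.ne')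
  rw [map_ind_idem, map_smul, map_sum, smul_eq_mul]
  refine mul_ne_zero (inv_ne_zero hN) ?_
  have h2 : ∀ X : Subgroup G, mark F (S.map f) (((Nat.card X : F) * (moebius X S : F)) •
      FB.cls F (.transitive (X.map f))) = ((if X ≤ S ∧ X.map f = S.map f then
      (Nat.card X : ℚ) * (moebius X S : ℚ) else 0 : ℚ) : F) *
        mark F (S.map f) (FB.cls F (.transitive (S.map f))) := by
    intro X
    rw [map_smul, smul_eq_mul]
    by_cases hX : X ≤ S
    · by_cases hX' : X.map f = S.map f
      · rw [if_pos ⟨hX, hX'⟩, hX']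
        push_cast
        rfl
      · rw [if_neg fun h => hX' h.2, h0 X hX hX', mul_zero, Rat.cast_zero, zero_mul]
    · rw [if_neg fun h => hX h.1, moebius_of_not_le hX, Int.cast_zero, mul_zero, Rat.cast_zero,
        zero_mul, zero_mul]
  simp only [h2]
  rw [← Finset.sum_mul, ← Rat.cast_sum, sum_card_mul_moebius_of_map_eq]
  refine mul_ne_zero (Rat.cast_ne_zero.2 (mul_ne_zero ?_ hS)) hc
  exact Nat.cast_ne_zero.2 Nat.card_pos.ne'

theorem mark_shiftMul (Z : Subgroup ((G × H) × K)) (a : FB F (G × K)) (b : FB F (H × K)) :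
    mark F Z (FB.shiftMul F a b) =
      mark F (Z.map ((MonoidHom.fst G H).prodMap (MonoidHom.id K))) a *
      mark F (Z.map ((MonoidHom.snd G H).prodMap (MonoidHom.id K))) b := by
  induction a using FB.induction with
  | hadd a a' h h' => simp only [map_add, LinearMap.add_apply, h, h', add_mul]
  | hsmul c a h => simp only [map_smul, LinearMap.smul_apply, h, smul_eq_mul, mul_assoc]
  | hc X =>
  induction b using FB.induction with
  | hadd b b' h h' => simp only [map_add, h, h', mul_add]
  | hsmul c b h => simp only [map_smul, h, smul_eq_mul, mul_left_comm]
  | hc Y =>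
  rw [FB.shiftMul_cls, mark_cls, mark_cls, mark_cls, ← Nat.cast_mul, ← Nat.card_prod]
  refine congrArg Nat.cast (Nat.card_congr ((Equiv.subtypeEquivRight fun p => ?_).trans
    (Equiv.subtypeProdEquivProd (p := fun x : X => _ ≤ stabilizer (G × K) x)
      (q := fun y : Y => _ ≤ stabilizer (H × K) y))))
  rw [Subgroup.map_le_iff_le_comap, Subgroup.map_le_iff_le_comap, ← le_inf_iff]
  refine forall₂_congr fun z _ => ?_
  exact Prod.ext_iff

end ResInd

/-! ### Closed classes of groups over `K` and their ideals -/

namespace GroupOver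

variable {K : Type u} [Group K] [Finite K] {G H : Type u} [Group G] [Finite G] [Group H] [Finite H]

theorem ofSubgroup_hasQuotient_map (f : G →* H) (Z : Subgroup (G × K)) :
    (ofSubgroup Z).HasQuotient (ofSubgroup (Z.map (f.prodMap (MonoidHom.id K)))) := by
  refine ⟨⟨(f.prodMap (MonoidHom.id K)).subgroupMap Z, 1, fun z => ?_⟩,
    MonoidHom.subgroupMap_surjective _ Z⟩
  rw [one_mul, inv_one, mul_one]
  rfl

/-- Conjugation by `c` changes the second projection by the inner automorphism of `c.2`; hence
morphisms over K are taken up to inner automorphisms. -/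
theorem ofSubgroup_hasQuotient_conj (X : Subgroup (G × K)) (c : G × K) :
    (ofSubgroup X).HasQuotient (ofSubgroup (X.map (MulAut.conj c).toMonoidHom)) :=
  ⟨⟨(MulAut.conj c).toMonoidHom.subgroupMap X, c.2, fun _ => rfl⟩,
    MonoidHom.subgroupMap_surjective _ X⟩

theorem conj_hasQuotient_ofSubgroup (X : Subgroup (G × K)) (c : G × K) :
    (ofSubgroup (X.map (MulAut.conj c).toMonoidHom)).HasQuotient (ofSubgroup X) := by
  obtain ⟨f, hf⟩ := ofSubgroup_hasQuotient_conj X c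
  refine HasQuotient.trans (ofSubgroup_hasQuotient_conj _ c⁻¹) ?_
  rw [Subgroup.map_map, show (MulAut.conj c⁻¹).toMonoidHom.comp (MulAut.conj c).toMonoidHom =
    MonoidHom.id (G × K) from MonoidHom.ext fun x => by simp [mul_assoc], Subgroup.map_id]
  exact .refl _

theorem ofSubgroup_graph_hasQuotient (L : GroupOver K) :
    (ofSubgroup L.hom.graph).HasQuotient L := by
  refine ⟨⟨(MonoidHom.fst L K).comp L.hom.graph.subtype, 1, fun x => ?_⟩,
    fun l => ⟨⟨(l, L.hom l), rfl⟩, rfl⟩⟩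
  rw [one_mul, inv_one, mul_one]
  exact x.2.symm

theorem hasQuotient_ofSubgroup_graph (L : GroupOver K) :
    L.HasQuotient (ofSubgroup L.hom.graph) := by
  refine ⟨⟨((MonoidHom.id L).prod L.hom).codRestrict L.hom.graph fun _ => rfl, 1, fun x => ?_⟩,
    ?_⟩
  · rw [one_mul, inv_one, mul_one]
    rfl
  · rintro ⟨⟨l, k⟩, h⟩
    exact ⟨l, Subtype.ext (Prod.ext rfl h)⟩

/-- A class of groups over `K` which is stable under extensions and under quotients by normal
subgroups `Q ≤ Ker φ` with `m_{L,Q} ≠ 0`. -/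
structure IsClosed (𝒞 : GroupOver K → Prop) : Prop where
  of_hasQuotient : ∀ {M L : GroupOver K}, M.HasQuotient L → 𝒞 L → 𝒞 M
  quotientBy : ∀ {L : GroupOver K} {Q : Subgroup L} (hn : Q.Normal) (hQ : Q ≤ L.hom.ker),
    mConst Q ≠ 0 → 𝒞 L → 𝒞 (L.quotientBy Q hn hQ)

omit [Finite K] in
theorem IsClosed.beta {𝒞 : GroupOver K → Prop} (h : IsClosed 𝒞) {L : GroupOver K} :
    𝒞 L.beta ↔ 𝒞 L :=
  ⟨h.of_hasQuotient L.hasQuotient_beta, h.quotientBy _ _ L.exists_maximal.choose_spec.prop.2.2⟩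

omit [Finite K] in
theorem isClosed_hasQuotient {L : GroupOver K} (hL : L.IsBKGroup) :
    IsClosed fun M => M.HasQuotient L :=
  ⟨fun h h' => h.trans h', fun hn hQ hm h => h.quotientBy hL _ hn hQ hm⟩

/-- The elements of `FB_K(G)` all of whose nonzero marks are at groups over `K` in `𝒞`. -/
def supported (F : Type v) [Field F] (G : Type u) [Group G] [Finite G] (𝒞 : GroupOver K → Prop) :
    Submodule F (FB F (G × K)) where
  carrier := {a | ∀ X : Subgroup (G × K), mark F X a ≠ 0 → 𝒞 (ofSubgroup X)}
  zero_mem' := fun X h => (h (map_zero _)).elim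
  add_mem' := by
    intro a b ha hb X h
    by_cases h0 : mark F X a = 0
    · exact hb X fun h1 => h (by rw [map_add, h0, h1, add_zero])
    · exact ha X h0
  smul_mem' := fun c a ha X h => ha X fun h0 => h (by rw [map_smul, h0, smul_zero])

variable {F : Type v} [Field F]

/-- By the formula for marks under a biset, a nonzero mark at Z yields a point v and a subgroup W of
its transport group T such that a has a nonzero mark at W, WN = T and m_{W,W∩N} ≠ 0, with N the
right stabilizer of v. So W, and then W/(W ∩ N), belongs to the class. Sending z to those w with zv
= vw maps Z onto W/(W ∩ N). -/
theorem map_mem_supported [CharZero F] {𝒞 : GroupOver K → Prop} (h𝒞 : IsClosed 𝒞) (U : Biset H G)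
    {a : FB F (G × K)} (ha : a ∈ supported F G 𝒞) :
    FB.map F (U.timesK K) a ∈ supported F H 𝒞 := by
  intro Z hZ
  let V : Biset (H × K) (G × K) := U.timesK K
  have := Fintype.ofFinite V
  have h1 := LinearMap.congr_fun (card_smul_mark_comp_map F V Z) a
  have h2 : ((Nat.card (G × K) : F) • mark F Z ∘ₗ FB.map F V) a ≠ 0 :=
    mul_ne_zero (Nat.cast_ne_zero.2 Nat.card_pos.ne') hZ
  rw [h1, LinearMap.sum_apply] at h2
  obtain ⟨v, -, hv⟩ := Finset.exists_ne_zero_of_sum_ne_zero h2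
  split_ifs at hv with hS
  swap
  · exact (hv rfl).elim
  rw [LinearMap.sum_apply] at hv
  obtain ⟨W, -, hW⟩ := Finset.exists_ne_zero_of_sum_ne_zero hv
  rw [LinearMap.smul_apply] at hW
  obtain ⟨hc, hm⟩ := smul_ne_zero_iff.1 hW
  -- `c` is the K-coordinate of `v`. Since K acts on itself by translations, zv = vg forces z₂c =
  -- cg₂; in particular the right stabilizer of v projects trivially to K.
  obtain ⟨c, hcv⟩ : ∃ c : K, ∀ (z : H × K) (g : G × K), z • v = MulOpposite.op g • v →
      z.2 * c = c * g.2 := ⟨v.2, fun z g h => congrArg Prod.snd h⟩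
  let T := V.transport Z v
  obtain ⟨hsup, hm'⟩ := mConst_subgroupOf_ne_zero (Int.cast_ne_zero.1 hc)
  let N := (V.rightStab v).subgroupOf T
  let A : GroupOver K := ⟨W, (MonoidHom.snd G K).comp (T.subtype.comp W.subtype)⟩
  have hA : 𝒞 A := by
    refine h𝒞.of_hasQuotient ?_ (ha _ hm)
    refine ⟨⟨T.subtype.subgroupMap W, 1, fun z => ?_⟩, MonoidHom.subgroupMap_surjective _ W⟩
    rw [one_mul, inv_one, mul_one]
    rfl
  have hn : (N.subgroupOf W).Normal := inferInstance
  have hker : N.subgroupOf W ≤ A.hom.ker := by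
    intro w hw
    have h3 : MulOpposite.op (w.1.1 : G × K) • v = v := hw
    have h4 := hcv 1 w.1.1 (by rw [h3, one_smul])
    rw [Prod.snd_one, one_mul] at h4
    exact mul_eq_left.1 h4.symm
  refine h𝒞.of_hasQuotient ?_ (h𝒞.quotientBy hn hker hm' hA)
  -- The relation zv = vw, as a subgroup of Z × W covering both Z and W/(W ∩ N).
  let P : Subgroup (Z × W) :=
    { carrier := {p | (p.1 : H × K) • v = MulOpposite.op (p.2.1.1 : G × K) • v}
      one_mem' := by simp
      mul_mem' := by
        rintro ⟨z, w⟩ ⟨z', w'⟩ h h'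
        replace h : (z : H × K) • v = MulOpposite.op (w.1.1 : G × K) • v := h
        replace h' : (z' : H × K) • v = MulOpposite.op (w'.1.1 : G × K) • v := h'
        change ((z : H × K) * z') • v = MulOpposite.op ((w.1.1 : G × K) * w'.1.1) • v
        rw [MulOpposite.op_mul, mul_smul, mul_smul, h', ← h, smul_comm]
      inv_mem' := by
        rintro ⟨z, w⟩ h
        replace h : (z : H × K) • v = MulOpposite.op (w.1.1 : G × K) • v := h
        change (z : H × K)⁻¹ • v = MulOpposite.op (w.1.1 : G × K)⁻¹ • v
        rw [inv_smul_eq_iff, smul_comm, h, MulOpposite.op_inv, inv_smul_smul] }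
  have hP : ∀ p : P, (p.1.1 : H × K) • v = MulOpposite.op (p.1.2.1.1 : G × K) • v := fun p => p.2
  refine hasQuotient_of_ker_le (A := P) ((MonoidHom.fst Z W).comp P.subtype) ?_
    ((QuotientGroup.mk' (N.subgroupOf W)).comp ((MonoidHom.snd Z W).comp P.subtype)) ?_ ?_
    c⁻¹ ?_
  -- Given zv = vg, write g = wn with w ∈ W and n ∈ N; then vg = vw, so (z, w) lies in `P`.
  · intro z
    obtain ⟨g, hg⟩ := hS z.1 z.2
    obtain ⟨w, hw, n, hn', h4⟩ := Subgroup.mem_sup_of_normal_right.1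
      (hsup ▸ Subgroup.mem_top (⟨g, z.1, z.2, hg⟩ : T))
    have h5 : (w * n : G × K) = g := congrArg Subtype.val h4
    obtain ⟨z', hz', h7⟩ := w.2
    have h6 : MulOpposite.op (n : G × K) • v = v := hn'
    refine ⟨⟨(z, ⟨w, hw⟩), ?_⟩, rfl⟩
    change z.1 • v = MulOpposite.op (w : G × K) • v
    rw [hg, ← h5, MulOpposite.op_mul, mul_smul, ← h7, ← smul_comm z', h6]
  · intro q
    obtain ⟨w, rfl⟩ := QuotientGroup.mk'_surjective _ q
    obtain ⟨z', hz', h7⟩ := w.1.2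
    exact ⟨⟨(⟨z', hz'⟩, w), h7⟩, rfl⟩
  · rintro p hp
    refine (QuotientGroup.eq_one_iff p.1.2).2 ?_
    have h3 := hP p
    replace hp : p.1.1 = 1 := hp
    rw [hp, Subgroup.coe_one, one_smul] at h3
    exact h3.symm
  · intro p
    have h3 := hcv _ _ (hP p)
    change c⁻¹ * p.1.1.1.2 * c⁻¹⁻¹ = p.1.2.1.1.2
    rw [inv_inv, mul_assoc, h3, inv_mul_cancel_left]

theorem shiftMul_mem_supported {𝒞 : GroupOver K → Prop} (h𝒞 : IsClosed 𝒞) (a : FB F (G × K))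
    {b : FB F (H × K)} (hb : b ∈ supported F H 𝒞) :
    FB.shiftMul F a b ∈ supported F (G × H) 𝒞 := by
  intro Z hZ
  rw [mark_shiftMul] at hZ
  exact h𝒞.of_hasQuotient (ofSubgroup_hasQuotient_map _ Z) (hb _ (right_ne_zero_of_mul hZ))

variable (F) in
/-- The ideal of `FB_K` attached to a closed class of groups over `K`. -/
def supportedIdeal [CharZero F] {𝒞 : GroupOver K → Prop} (h𝒞 : IsClosed 𝒞) : FBIdeal F K where
  obj G _ _ := supported F G 𝒞
  map_mem U _ h := map_mem_supported h𝒞 U h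
  act_mem a _ h := shiftMul_mem_supported h𝒞 a h

end GroupOver

/-! ### Isomorphism invariance of `m_{G,N}` -/

section

attribute [local instance] fintypeSubgroup Classical.propDecidable

theorem mConst_comap_equiv {G H : Type u} [Group G] [Finite G] [Group H] [Finite H] (e : G ≃* H)
    (N : Subgroup H) : mConst (N.comap e.toMonoidHom) = mConst N := by
  have hs : Function.Surjective e.toMonoidHom := e.surjective
  have hk : e.toMonoidHom.ker = ⊥ := (MonoidHom.ker_eq_bot_iff _).2 e.injective
  have h1 := mConst_eq (N.comap e.toMonoidHom)
  have h2 := sum_comap e.toMonoidHom hs fun X : Subgroup G => if X ⊔ N.comap e.toMonoidHom = ⊤ then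
    (Nat.card X : ℚ) * (moebius X ⊤ : ℚ) else 0
  simp only [hk, bot_le, if_true] at h2
  rw [← h2] at h1
  simp only [comap_sup_eq_top _ hs, Subgroup.map_comap_eq_self_of_surjective hs,
    moebius_comap _ hs, card_comap _ hs, hk, Subgroup.card_bot, one_mul] at h1
  rw [← mConst_eq, Nat.card_congr e.toEquiv] at h1
  exact mul_left_cancel₀ (by simp [Nat.card_pos.ne']) h1

end

/-! ### Ideals and the groups over `K` which they support -/

namespace FBIdeal

open GroupOver

variable {F : Type v} [Field F] {K : Type u} [Group K] [Finite K]
  {G H : Type u} [Group G] [Finite G] [Group H] [Finite H] (I J : FBIdeal F K)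

theorem map_res_mem (f : G →* H) {a : FB F (H × K)} (ha : a ∈ I.obj H) :
    FB.map F (Biset.res (f.prodMap (MonoidHom.id K))) a ∈ I.obj G := by
  rw [← FB.map_iso F (Biset.res_timesK_isIso f)]
  exact I.map_mem _ ha

theorem map_ind_mem (f : G →* H) {a : FB F (G × K)} (ha : a ∈ I.obj G) :
    FB.map F (Biset.ind (f.prodMap (MonoidHom.id K))) a ∈ I.obj H := by
  rw [← FB.map_iso F (Biset.ind_timesK_isIso f)]
  exact I.map_mem _ ha

variable [CharZero F]

/-- The external product e_X × a, restricted along the diagonal of G, is the product in the Burnside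
algebra of G × K. Its marks are those of e_X multiplied by the mark of a at X, so I contains a
nonzero multiple of e_X. -/
theorem idem_mem_of_mark_ne_zero {a : FB F (G × K)} (ha : a ∈ I.obj G) {X : Subgroup (G × K)}
    (hX : mark F X a ≠ 0) : idem F X ∈ I.obj G := by
  have h1 := I.map_res_mem ((MonoidHom.id G).prod (MonoidHom.id G))
    (I.act_mem (idem F X : FB F (G × K)) ha)
  have h2 : FB.map F (Biset.res (((MonoidHom.id G).prod (MonoidHom.id G)).prodMap
      (MonoidHom.id K))) (FB.shiftMul F (idem F X) a) = mark F X a • idem F X := by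
    refine mark_injective fun W => ?_
    rw [mark_map_res, mark_shiftMul, Subgroup.map_map, Subgroup.map_map, map_smul, smul_eq_mul]
    have e1 : ((MonoidHom.fst G G).prodMap (MonoidHom.id K)).comp
      (((MonoidHom.id G).prod (MonoidHom.id G)).prodMap (MonoidHom.id K)) = MonoidHom.id _ := rfl
    have e2 : ((MonoidHom.snd G G).prodMap (MonoidHom.id K)).comp
      (((MonoidHom.id G).prod (MonoidHom.id G)).prodMap (MonoidHom.id K)) = MonoidHom.id _ := rfl
    rw [e1, e2, Subgroup.map_id, mul_comm]
    by_cases h : mark F W (idem F X) = 0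
    · rw [h, mul_zero, mul_zero]
    · obtain ⟨g, rfl⟩ := exists_conj_of_mark_idem_ne_zero h
      rw [mark_map_conj]
  have h3 : mark F X a • idem F X ∈ I.obj G := by
    rw [← h2]
    exact h1
  exact ((I.obj G).smul_mem_iff hX).1 h3

/-- Restriction along f sends the idempotent of the image of Z to an element whose mark at Z is 1.
-/
theorem idem_mem_of_map (f : G →* H) (Z : Subgroup (G × K))
    (h : idem F (Z.map (f.prodMap (MonoidHom.id K))) ∈ I.obj H) : idem F Z ∈ I.obj G := by
  refine I.idem_mem_of_mark_ne_zero (I.map_res_mem f h) ?_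
  rw [mark_map_res, mark_idem_self]
  exact one_ne_zero

theorem idem_map_mem (f : G →* H) (Z : Subgroup (G × K)) (h : idem F Z ∈ I.obj G)
    (hm : mConst ((f.prodMap (MonoidHom.id K)).ker.subgroupOf Z) ≠ 0) :
    idem F (Z.map (f.prodMap (MonoidHom.id K))) ∈ I.obj H :=
  I.idem_mem_of_mark_ne_zero (I.map_ind_mem f h) (mark_map_ind_idem_ne_zero F _ Z hm)

/-- The class of the groups `(L, φ)` over `K` such that `e_{L_φ}^{L × K} ∈ I(L)`. -/
def Supports (L : GroupOver K) : Prop := idem F L.hom.graph ∈ I.obj L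

theorem map_graph_ofSubgroup (X : Subgroup (G × K)) :
    (ofSubgroup X).hom.graph.map (((MonoidHom.fst G K).comp X.subtype).prodMap (MonoidHom.id K)) =
      X := by
  ext x
  constructor
  · rintro ⟨⟨y, k⟩, h, rfl⟩
    replace h : y.1.2 = k := h
    subst h
    exact y.2
  · intro hx
    exact ⟨(⟨x, hx⟩, x.2), rfl, rfl⟩

/-- The first projection X → G carries the graph of p₂ in X × K isomorphically onto X. Restriction
gives one direction. Induction gives the other: the kernel meets the graph trivially, so the
constant m involved is 1. -/
theorem supports_ofSubgroup (X : Subgroup (G × K)) :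
    I.Supports (ofSubgroup X) ↔ idem F X ∈ I.obj G := by
  have hX := map_graph_ofSubgroup X
  constructor
  · intro h
    have h1 := I.idem_map_mem ((MonoidHom.fst G K).comp X.subtype) (ofSubgroup X).hom.graph h ?_
    · rwa [hX] at h1
    · refine (congrArg mConst (eq_bot_iff.2 ?_ :
        _ = (⊥ : Subgroup (ofSubgroup X).hom.graph))).trans_ne
          (mConst_bot.trans_ne one_ne_zero)
      rintro ⟨⟨y, k⟩, hy⟩ h2
      replace hy : y.1.2 = k := hy
      have h3 : y.1.1 = 1 := congrArg Prod.fst (MonoidHom.mem_ker.1 h2)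
      have h4 : k = 1 := congrArg Prod.snd (MonoidHom.mem_ker.1 h2)
      have h5 : y = 1 := Subtype.ext (Prod.ext h3 (hy.trans h4))
      subst h4 h5
      exact Subgroup.mem_bot.2 rfl
  · intro h
    refine I.idem_mem_of_map ((MonoidHom.fst G K).comp X.subtype) (ofSubgroup X).hom.graph ?_
    rwa [hX]

theorem isClosed_supports : IsClosed I.Supports where
  of_hasQuotient := by
    rintro M L ⟨f, hf⟩ hL
    obtain ⟨k, hk⟩ := f.comm
    refine I.idem_mem_of_map f.toHom M.hom.graph ?_
    -- The image of the graph of M is the graph of L up to conjugation by (1, k⁻¹), where k is the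
    -- element that compares the two maps to K.
    have h1 : M.hom.graph.map (f.toHom.prodMap (MonoidHom.id K)) =
        L.hom.graph.map (MulAut.conj ((1 : L), k⁻¹)).toMonoidHom := by
      ext x
      constructor
      · rintro ⟨⟨m, c⟩, h, rfl⟩
        replace h : M.hom m = c := h
        refine ⟨(f.toHom m, L.hom (f.toHom m)), rfl, ?_⟩
        rw [← hk, ← h]
        simp [MulAut.conj_apply, mul_assoc]
      · rintro ⟨⟨l, c⟩, h, rfl⟩
        replace h : L.hom l = c := h
        obtain ⟨m, rfl⟩ := hf l
        refine ⟨(m, M.hom m), rfl, ?_⟩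
        rw [← h, ← hk]
        simp [MulAut.conj_apply, mul_assoc]
    rw [h1, idem_map_conj]
    exact hL
  quotientBy := by
    intro L Q hn hQ hm hL
    have h1 := I.idem_map_mem (QuotientGroup.mk' Q) L.hom.graph hL ?_
    · have h2 : L.hom.graph.map ((QuotientGroup.mk' Q).prodMap (MonoidHom.id K)) =
          (L.quotientBy Q hn hQ).hom.graph := by
        ext x
        constructor
        · rintro ⟨⟨l, c⟩, h, rfl⟩
          exact h
        · obtain ⟨q, c⟩ := x
          intro h
          obtain ⟨l, rfl⟩ := QuotientGroup.mk'_surjective Q q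
          exact ⟨(l, c), h, rfl⟩
      rw [h2] at h1
      exact h1
    -- Under the isomorphism of L with its graph, the kernel of the map to (L/Q) × K corresponds to
    -- Q.
    · let e : L ≃* L.hom.graph :=
        { toFun := fun l => ⟨(l, L.hom l), rfl⟩
          invFun := fun x => x.1.1
          left_inv := fun _ => rfl
          right_inv := fun x => Subtype.ext (Prod.ext rfl x.2)
          map_mul' := fun l l' => Subtype.ext (Prod.ext rfl (map_mul L.hom l l')) }
      rw [← mConst_comap_equiv e, show Subgroup.comap _ _ = Q from ?_]
      · exact hm
      · ext l
        constructor
        · intro h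
          exact (QuotientGroup.eq_one_iff l).1 (congrArg Prod.fst (MonoidHom.mem_ker.1 h))
        · intro h
          exact MonoidHom.mem_ker.2 (Prod.ext ((QuotientGroup.eq_one_iff l).2 h) (hQ h))

/-- An ideal is determined by the groups over `K` which support it. -/
theorem mem_iff (a : FB F (G × K)) : a ∈ I.obj G ↔
    ∀ X : Subgroup (G × K), mark F X a ≠ 0 → I.Supports (ofSubgroup X) := by
  constructor
  · exact fun ha X hX => (I.supports_ofSubgroup X).2 (I.idem_mem_of_mark_ne_zero ha hX)
  · intro h
    rw [eq_sum_mark_smul_idem a]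
    refine Submodule.smul_mem _ _ (Submodule.sum_mem _ fun X _ => ?_)
    by_cases h0 : mark F X a = 0
    · rw [h0, mul_zero, zero_smul]
      exact Submodule.zero_mem _
    · exact Submodule.smul_mem _ _ ((I.supports_ofSubgroup X).1 (h X h0))

theorem le_iff_supports : I ≤ J ↔ ∀ L : GroupOver K, I.Supports L → J.Supports L :=
  ⟨fun h L hL => h L hL, fun h _ _ _ a ha => (J.mem_iff a).2 fun X hX =>
    h _ ((I.mem_iff a).1 ha X hX)⟩

theorem supportedIdeal_supports {𝒞 : GroupOver K → Prop} (h𝒞 : IsClosed 𝒞) (L : GroupOver K) :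
    Supports (supportedIdeal F h𝒞) L ↔ 𝒞 L := by
  constructor
  · intro h
    refine h𝒞.of_hasQuotient L.hasQuotient_ofSubgroup_graph (h L.hom.graph ?_)
    rw [mark_idem_self]
    exact one_ne_zero
  · intro hL X hX
    obtain ⟨c, rfl⟩ := exists_conj_of_mark_idem_ne_zero hX
    exact h𝒞.of_hasQuotient ((conj_hasQuotient_ofSubgroup _ c).trans
      L.ofSubgroup_graph_hasQuotient) hL

omit [CharZero F] in
theorem ideal_le_iff (L : GroupOver K) : L.ideal F ≤ I ↔ I.Supports L := by
  constructor
  · intro h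
    refine h L ?_
    exact Submodule.mem_iInf _ |>.2 fun N => Submodule.mem_iInf _ |>.2 fun hN => hN
  · intro h G _ _ a ha
    exact (Submodule.mem_iInf _).1 ((Submodule.mem_iInf _).1 ha I) h

/-- The groups mapping onto L form a closed class, whose ideal contains the generator of e_{L,φ},
hence e_{L,φ} itself. The converse is the closure of supports under extensions. -/
theorem ideal_supports_iff {L : GroupOver K} (hL : L.IsBKGroup) (M : GroupOver K) :
    Supports (L.ideal F) M ↔ M.HasQuotient L := by
  constructor
  · intro h
    have h1 := (ideal_le_iff (supportedIdeal F (isClosed_hasQuotient hL)) L).2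
      ((supportedIdeal_supports _ L).2 (.refl L))
    exact (supportedIdeal_supports (F := F) (isClosed_hasQuotient hL) M).1 (h1 M h)
  · exact fun h => (isClosed_supports _).of_hasQuotient h ((ideal_le_iff _ L).1 le_rfl)

/-- A sum of ideals supports no new group: if no summand supports L, the mark at the graph of L
vanishes on each summand, hence on the sum, while the idempotent of the graph has mark 1 there. -/
theorem sum_supports_iff (S : Set (FBIdeal F K)) (L : GroupOver K) :
    Supports (GreenModule.Sub.sum S) L ↔ ∃ I ∈ S, Supports I L := by
  constructor
  · intro h
    by_contra! hI
    have h1 : (GreenModule.Sub.sum S).obj L ≤ LinearMap.ker (mark F L.hom.graph) := by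
      refine iSup₂_le fun I hIS a ha => ?_
      by_contra h0
      exact hI I hIS (idem_mem_of_mark_ne_zero I ha h0)
    have h2 : mark F L.hom.graph (idem F L.hom.graph) = 0 := h1 h
    rw [mark_idem_self] at h2
    exact one_ne_zero h2
  · rintro ⟨I, hI, h⟩
    exact le_iSup₂ (f := fun N (_ : N ∈ S) => N.obj L) I hI h

end FBIdeal

/-! ### The unique maximal subideal of `e_{L,φ}` -/

namespace FBIdeal

open GroupOver

variable {F : Type v} [Field F] [CharZero F] {K : Type u} [Group K] [Finite K]

theorem supports_beta (I : FBIdeal F K) (M : GroupOver K) : I.Supports M.beta ↔ I.Supports M :=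
  I.isClosed_supports.beta

theorem ideal₀_supports_iff (L M : GroupOver K) : Supports (L.ideal₀ F) M ↔
    ∃ N : GroupOver K, N.IsBKGroup ∧ N.HasQuotient L ∧ ¬ N.IsIso L ∧ M.HasQuotient N := by
  refine (sum_supports_iff _ M).trans ⟨?_, ?_⟩
  · rintro ⟨_, ⟨N, hN, h1, h2, rfl⟩, h⟩
    exact ⟨N, hN, h1, h2, (ideal_supports_iff hN M).1 h⟩
  · rintro ⟨N, hN, h1, h2, h⟩
    exact ⟨_, ⟨N, hN, h1, h2, rfl⟩, (ideal_supports_iff hN M).2 h⟩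

/-- Otherwise some N would map onto L and L onto N, which makes them isomorphic. -/
theorem not_ideal₀_supports_self (L : GroupOver K) : ¬ Supports (L.ideal₀ F) L := by
  rw [ideal₀_supports_iff]
  rintro ⟨N, -, h1, h2, h3⟩
  exact h2 (h1.isIso h3)

variable {L : GroupOver K} (hL : L.IsBKGroup)
include hL

theorem ideal₀_lt_ideal : L.ideal₀ F < L.ideal F := by
  refine lt_of_le_not_ge ((le_iff_supports _ _).2 fun M hM => ?_) fun h => ?_
  · obtain ⟨N, -, h1, -, h3⟩ := (ideal₀_supports_iff L M).1 hM
    exact (ideal_supports_iff hL M).2 (h3.trans h1)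
  · exact not_ideal₀_supports_self L ((ideal_le_iff _ L).1 h)

/-- If I supports M, it supports β_K(M), a B_K-group which still maps onto L and is not isomorphic
to L, since I does not support L. So β_K(M) is one of the groups defining e⁰_{L,φ}. -/
theorem le_ideal₀_of_not_supports {I : FBIdeal F K} (hI : ∀ M, I.Supports M → M.HasQuotient L)
    (h : ¬ I.Supports L) : I ≤ L.ideal₀ F := by
  refine (le_iff_supports _ _).2 fun M hM => (ideal₀_supports_iff L M).2
    ⟨M.beta, M.beta_isBKGroup, (hI M hM).beta hL, fun hiso => h ?_, M.hasQuotient_beta⟩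
  exact I.isClosed_supports.of_hasQuotient hiso.symm.hasQuotient ((I.supports_beta M).2 hM)

theorem le_ideal₀_of_lt {I : FBIdeal F K} (hI : I < L.ideal F) : I ≤ L.ideal₀ F :=
  le_ideal₀_of_not_supports hL
    (fun M hM => (ideal_supports_iff hL M).1 ((le_iff_supports _ _).1 hI.le M hM))
    fun h => hI.not_ge ((ideal_le_iff I L).2 h)

theorem maximal_ideal₀ : Maximal (fun I : FBIdeal F K => I < L.ideal F) (L.ideal₀ F) :=
  ⟨ideal₀_lt_ideal hL, fun _ hI _ => le_ideal₀_of_lt hL hI⟩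

theorem eq_ideal₀_of_maximal {J : FBIdeal F K}
    (hJ : Maximal (fun I : FBIdeal F K => I < L.ideal F) J) : J = L.ideal₀ F :=
  le_antisymm (le_ideal₀_of_lt hL hJ.prop)
    (hJ.le_of_ge (ideal₀_lt_ideal hL) (le_ideal₀_of_lt hL hJ.prop))

/-- The classes of e_{L,φ} and e⁰_{L,φ} contain M exactly when they contain β_K(M). If M maps onto
L, then so does the B_K-group β_K(M), and it belongs to e⁰_{L,φ} if it is not L; L itself is
excluded. -/
theorem beta_isIso_iff (M : GroupOver K) :
    M.beta.IsIso L ↔ Supports (L.ideal F) M ∧ ¬ Supports (L.ideal₀ F) M := by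
  constructor
  · intro h
    refine ⟨(ideal_supports_iff hL M).2 (M.hasQuotient_beta.trans h.hasQuotient), fun h0 => ?_⟩
    exact not_ideal₀_supports_self L ((isClosed_supports _).of_hasQuotient h.symm.hasQuotient
      ((supports_beta _ M).2 h0))
  · rintro ⟨h, h0⟩
    by_contra hiso
    exact h0 ((ideal₀_supports_iff L M).2 ⟨M.beta, M.beta_isBKGroup,
      ((ideal_supports_iff hL M).1 h).beta hL, hiso, M.hasQuotient_beta⟩)

end FBIdeal

/-! ### Submodules of `I / I'` and the second isomorphism theorem -/

namespace GreenModule.Sub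

variable {F : Type v} [Field F] {A : GreenBisetFunctor.{u, v, w} F} {M : GreenModule A}

theorem proj_eq_zero_iff {I I' : Sub M} {G : Type u} [Group G] [Finite G] {x : I.obj G} :
    proj I I' G x = 0 ↔ x.1 ∈ I'.obj G :=
  Submodule.Quotient.mk_eq_zero ((I'.obj G).comap (I.obj G).subtype)

theorem proj_eq_iff {I I' : Sub M} {G : Type u} [Group G] [Finite G] {x y : I.obj G} :
    proj I I' G x = proj I I' G y ↔ x.1 - y.1 ∈ I'.obj G :=
  Submodule.Quotient.eq ((I'.obj G).comap (I.obj G).subtype)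

theorem proj_surjective (I I' : Sub M) (G : Type u) [Group G] [Finite G] :
    Function.Surjective (proj I I' G) :=
  Submodule.mkQ_surjective ((I'.obj G).comap (I.obj G).subtype)

/-- The inverse image in `M` of a submodule of `I / I'`, intersected with `I`. -/
def ofQuotient {I I' : Sub M} (N : Sub (I.quotient I')) : Sub M where
  obj G _ _ := ((N.obj G).comap (proj I I' G)).map (I.obj G).subtype
  map_mem {G H} _ _ _ _ U m hm := by
    obtain ⟨x, hx, rfl⟩ := hm
    exact ⟨⟨M.map U x.1, I.map_mem U x.2⟩, N.map_mem U hx, rfl⟩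
  act_mem {G H} _ _ _ _ a m hm := by
    obtain ⟨x, hx, rfl⟩ := hm
    exact ⟨⟨M.act a x.1, I.act_mem a x.2⟩, N.act_mem a hx, rfl⟩

/-- The image in `I / I'` of a submodule of `M`. -/
def image (I I' J : Sub M) : Sub (I.quotient I') where
  obj G _ _ := ((J.obj G).comap (I.obj G).subtype).map (proj I I' G)
  map_mem {G H} _ _ _ _ U m hm := by
    obtain ⟨x, hx, rfl⟩ := hm
    exact ⟨⟨M.map U x.1, I.map_mem U x.2⟩, J.map_mem U hx, rfl⟩
  act_mem {G H} _ _ _ _ a m hm := by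
    obtain ⟨x, hx, rfl⟩ := hm
    exact ⟨⟨M.act a x.1, I.act_mem a x.2⟩, J.act_mem a hx, rfl⟩

theorem isSimple_quotient {I I' : Sub M} (hlt : I' < I)
    (h : ∀ J : Sub M, I' ≤ J → J ≤ I → J = I' ∨ J = I) : (I.quotient I').IsSimple := by
  constructor
  · by_contra! hs
    refine hlt.not_ge fun G _ _ m hm => ?_
    have h1 : proj I I' G ⟨m, hm⟩ = 0 := by
      have := hs G inferInstance inferInstance
      exact Subsingleton.elim _ _
    exact proj_eq_zero_iff.1 h1
  · intro N
    have h1 : I' ≤ ofQuotient N := fun G _ _ m hm => by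
      refine ⟨⟨m, hlt.le G hm⟩, ?_, rfl⟩
      have : proj I I' G ⟨m, hlt.le G hm⟩ = 0 := proj_eq_zero_iff.2 hm
      exact Submodule.mem_comap.2 (this ▸ Submodule.zero_mem _)
    have h2 : ofQuotient N ≤ I := fun G _ _ m hm => by
      obtain ⟨x, -, rfl⟩ := hm
      exact x.2
    refine (h (ofQuotient N) h1 h2).imp (fun h3 G _ _ => ?_) (fun h3 G _ _ => ?_)
    · refine eq_bot_iff.2 fun q hq => ?_
      obtain ⟨x, rfl⟩ := proj_surjective I I' G q
      have : x.1 ∈ (ofQuotient N).obj G := ⟨x, hq, rfl⟩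
      rw [h3] at this
      exact proj_eq_zero_iff.2 this
    · refine eq_top_iff.2 fun q _ => ?_
      obtain ⟨x, rfl⟩ := proj_surjective I I' G q
      have : x.1 ∈ (ofQuotient N).obj G := by
        rw [h3]
        exact x.2
      obtain ⟨y, hy, hxy⟩ := this
      rw [Subtype.ext hxy] at hy
      exact hy

theorem eq_or_eq_of_isSimple {I I' J : Sub M} (h : (I.quotient I').IsSimple) (h1 : I' ≤ J)
    (h2 : J ≤ I) : J = I' ∨ J = I := by
  refine (h.2 (image I I' J)).imp
    (fun h3 => le_antisymm (fun (G : Type u) [Group G] [Finite G] m hm => ?_) h1)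
    (fun h3 => le_antisymm h2 fun (G : Type u) [Group G] [Finite G] m hm => ?_)
  · have h4 : proj I I' G ⟨m, h2 G hm⟩ ∈ (image I I' J).obj G := ⟨_, hm, rfl⟩
    rw [h3] at h4
    exact proj_eq_zero_iff.1 ((Submodule.mem_bot F).1 h4)
  · have h4 : proj I I' G ⟨m, hm⟩ ∈ (image I I' J).obj G := by
      rw [h3]
      exact Submodule.mem_top
    obtain ⟨x, hx, hxm⟩ := h4
    have h5 : x.1 - m ∈ J.obj G := h1 G (proj_eq_iff.1 hxm)
    exact (Submodule.sub_mem_iff_right (J.obj G) hx).1 h5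

theorem le_sum {S : Set (Sub M)} {I : Sub M} (h : I ∈ S) : I ≤ sum S :=
  fun G _ _ => le_iSup₂ (f := fun N (_ : N ∈ S) => N.obj G) I h

theorem sum_le {S : Set (Sub M)} {J : Sub M} (h : ∀ I ∈ S, I ≤ J) : sum S ≤ J :=
  fun G _ _ => iSup₂_le fun I hI => h I hI G

/-- The isomorphism `I / I' ≅ J / J'` for submodules with `J ≤ I`, `J' = J ∩ I'` and
`I = J + I'`. -/
noncomputable def quotientIso {I I' J J' : Sub M} (hJ : J ≤ I) (hJ' : J' ≤ I')
    (hinf : ∀ (G : Type u) [Group G] [Finite G], J.obj G ⊓ I'.obj G ≤ J'.obj G)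
    (hsup : ∀ (G : Type u) [Group G] [Finite G], I.obj G ≤ J.obj G ⊔ I'.obj G) :
    GreenModule.Iso (I.quotient I') (J.quotient J') := by
  -- The inclusion of J in I induces J/J' → I/I'; the isomorphism sought is its inverse.
  let f : ∀ (G : Type u) [Group G] [Finite G],
      (J.quotient J').obj G →ₗ[F] (I.quotient I').obj G := fun G _ _ =>
    Submodule.mapQ _ _ (Submodule.inclusion (hJ G)) fun m hm => hJ' G hm
  have hf : ∀ (G : Type u) [Group G] [Finite G], Function.Bijective (f G) := by
    intro G _ _
    constructor
    · refine (injective_iff_map_eq_zero _).2 fun q hq => ?_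
      obtain ⟨x, rfl⟩ := proj_surjective J J' G q
      exact proj_eq_zero_iff.2 (hinf G ⟨x.2, (proj_eq_zero_iff (I := I) (I' := I')
        (x := Submodule.inclusion (hJ G) x)).1 hq⟩)
    · intro q
      obtain ⟨x, rfl⟩ := proj_surjective I I' G q
      obtain ⟨y, hy, z, hz, hyz⟩ := Submodule.mem_sup.1 (hsup G x.2)
      refine ⟨proj J J' G ⟨y, hy⟩, (proj_eq_iff (x := ⟨y, hJ G hy⟩)).2 ?_⟩
      change y - x.1 ∈ I'.obj G
      rw [← hyz, sub_add_cancel_left]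
      exact neg_mem hz
  let e : ∀ (G : Type u) [Group G] [Finite G],
      (J.quotient J').obj G ≃ₗ[F] (I.quotient I').obj G := fun G _ _ =>
    LinearEquiv.ofBijective (f G) (hf G)
  have he : ∀ (G : Type u) [Group G] [Finite G] q, e G q = f G q := fun _ _ _ _ => rfl
  refine ⟨fun G _ _ => (e G).symm, ?_, ?_⟩
  · intro G H _ _ _ _ U m
    obtain ⟨q, rfl⟩ := (e G).surjective m
    rw [LinearEquiv.symm_apply_eq, LinearEquiv.symm_apply_apply, he, he]
    obtain ⟨x, rfl⟩ := proj_surjective J J' _ q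
    rfl
  · intro G H _ _ _ _ a m
    obtain ⟨q, rfl⟩ := (e H).surjective m
    rw [LinearEquiv.symm_apply_eq, LinearEquiv.symm_apply_apply, he, he]
    obtain ⟨x, rfl⟩ := proj_surjective J J' _ q
    rfl

end GreenModule.Sub

/-! ### Bases of the simple modules and classification of the simple subquotients -/

namespace FBIdeal

open GroupOver GreenModule.Sub

variable {F : Type v} [Field F] [CharZero F] {K : Type u} [Group K] [Finite K]

theorem isSimple_simpleModule {L : GroupOver K} (hL : L.IsBKGroup) :
    (L.simpleModule F).IsSimple := by
  refine isSimple_quotient (ideal₀_lt_ideal hL) fun J h1 h2 => ?_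
  rcases h2.lt_or_eq with h | h
  · exact Or.inl (le_antisymm (le_ideal₀_of_lt hL h) h1)
  · exact Or.inr h

/-- Distinct representatives are not conjugate, so the mark at X of a combination of the e_Y is the
coefficient of e_X; were it nonzero for a combination in e⁰_{L,φ}, that ideal would support X. For
spanning, an element of e_{L,φ}(G) is a combination of the e_X in e_{L,φ}(G). Those in e⁰_{L,φ}
vanish in the quotient, and the others have β_K(X, p₂) ≅ L, so X is conjugate to a representative.
-/
theorem exists_basis {L : GroupOver K} (hL : L.IsBKGroup) (G : Type u) [Group G] [Finite G]
    (𝒜 : Set (Subgroup (G × K)))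
    (h𝒜 : IsSetOfRepresentatives (fun X : Subgroup (G × K) => (ofSubgroup X).beta.IsIso L) 𝒜) :
    ∃ b : Module.Basis 𝒜 F ((L.simpleModule F).obj G),
      ∀ X : 𝒜, ∃ h : idem F X.1 ∈ (L.ideal F).obj G,
        b X = proj (L.ideal F) (L.ideal₀ F) G ⟨idem F X.1, h⟩ := by
  have hmem : ∀ X : 𝒜, idem F X.1 ∈ (L.ideal F).obj G := fun X =>
    (supports_ofSubgroup _ _).1 ((beta_isIso_iff hL _).1 (h𝒜.1 X.1 X.2)).1
  let π : (L.ideal F).obj G →ₗ[F] (L.simpleModule F).obj G := proj (L.ideal F) (L.ideal₀ F) G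
  let s : 𝒜 → (L.simpleModule F).obj G := fun X => π ⟨idem F X.1, hmem X⟩
  have hli : LinearIndependent F s := by
    rw [linearIndependent_iff']
    intro t c hc X hX
    let y : (L.ideal F).obj G := ∑ Y ∈ t, c Y • ⟨idem F Y.1, hmem Y⟩
    have hy : π y = 0 := (map_sum π _ t).trans
      ((Finset.sum_congr rfl fun Y _ => map_smul π _ _).trans hc)
    have hy0 : y.1 ∈ (L.ideal₀ F).obj G := proj_eq_zero_iff.1 hy
    by_contra hcX
    refine ((beta_isIso_iff (F := F) hL _).1 (h𝒜.1 X.1 X.2)).2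
      ((mem_iff (L.ideal₀ F) y.1).1 hy0 X.1 ?_)
    have hy1 : (y.1 : FB F (G × K)) = ∑ Y ∈ t, c Y • idem F Y.1 :=
      (map_sum ((L.ideal F).obj G).subtype _ t).trans
        (Finset.sum_congr rfl fun Y _ => map_smul ((L.ideal F).obj G).subtype _ _)
    rw [hy1, map_sum, Finset.sum_eq_single X]
    · rw [map_smul, mark_idem_self, smul_eq_mul, mul_one]
      exact hcX
    · intro Y _ hne
      rw [map_smul, smul_eq_mul]
      by_contra h0
      obtain ⟨g, hg⟩ := exists_conj_of_mark_idem_ne_zero (right_ne_zero_of_mul h0)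
      obtain ⟨Z, -, hZ⟩ := h𝒜.2 Y.1 (h𝒜.1 Y.1 Y.2)
      have hY := hZ Y.1 ⟨Y.2, 1, by
        rw [map_one]
        exact (Subgroup.map_id Y.1).symm⟩
      have hX' := hZ X.1 ⟨X.2, g, hg⟩
      exact hne (Subtype.ext (hY.trans hX'.symm))
    · exact fun h => (h hX).elim
  have hsp : ⊤ ≤ Submodule.span F (Set.range s) := by
    intro q _
    obtain ⟨x, rfl⟩ := proj_surjective _ _ G q
    let P : Submodule F (FB F (G × K)) :=
      ((Submodule.span F (Set.range s)).comap π).map ((L.ideal F).obj G).subtype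
    suffices h : x.1 ∈ P by
      obtain ⟨y, hy, hyx⟩ := h
      rw [Subtype.ext hyx] at hy
      exact hy
    have hx : x.1 = _ := eq_sum_mark_smul_idem (x.1 : FB F (G × K))
    rw [hx]
    refine P.smul_mem _ (P.sum_mem fun X _ => ?_)
    by_cases h0 : mark F X x.1 = 0
    · rw [h0, mul_zero, zero_smul]
      exact P.zero_mem
    refine P.smul_mem _ ?_
    have hX := idem_mem_of_mark_ne_zero (L.ideal F) x.2 h0
    refine ⟨⟨idem F X, hX⟩, ?_, rfl⟩
    refine Submodule.mem_comap.2 ?_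
    by_cases h1 : idem F X ∈ (L.ideal₀ F).obj G
    · rw [show π ⟨idem F X, hX⟩ = 0 from proj_eq_zero_iff.2 h1]
      exact (Submodule.span F (Set.range s)).zero_mem
    · obtain ⟨Y, ⟨hY, g, hg⟩, -⟩ := h𝒜.2 X ((beta_isIso_iff (F := F) hL _).2
        ⟨(supports_ofSubgroup _ _).2 hX, fun h => h1 ((supports_ofSubgroup _ _).1 h)⟩)
      refine Submodule.subset_span ⟨⟨Y, hY⟩, congrArg π (Subtype.ext ?_)⟩
      change idem F Y = idem F X
      rw [hg, idem_map_conj]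
  exact ⟨Module.Basis.mk hli hsp, fun X => ⟨hmem X, Module.Basis.mk_apply hli hsp X⟩⟩

theorem exists_iso_simpleModule {I I' : FBIdeal F K} (hlt : I' < I)
    (hs : (I.quotient I').IsSimple) :
    ∃ L : GroupOver K, L.IsBKGroup ∧
      Nonempty (GreenModule.Iso (I.quotient I') (L.simpleModule F)) := by
  obtain ⟨M, hM, hM'⟩ : ∃ M, I.Supports M ∧ ¬ I'.Supports M := by
    by_contra! h
    exact hlt.not_ge ((le_iff_supports _ _).2 h)
  set L := M.beta
  have hL : L.IsBKGroup := M.beta_isBKGroup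
  have h1 : I.Supports L := (I.supports_beta M).2 hM
  have h2 : ¬ I'.Supports L := fun h => hM' ((I'.supports_beta M).1 h)
  have h3 : L.ideal F ≤ I := (ideal_le_iff I L).2 h1
  -- e_{L,φ} + I' lies between I' and I and supports L, so by simplicity it is I.
  have hsup : GreenModule.Sub.sum {L.ideal F, I'} = I := by
    refine (eq_or_eq_of_isSimple hs (le_sum (by simp)) (sum_le ?_)).resolve_left fun h => h2 ?_
    · rintro J (rfl | rfl)
      · exact h3
      · exact hlt.le
    · exact (ideal_le_iff I' L).1 (h ▸ le_sum (by simp))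
  -- e⁰_{L,φ} + I' does not support L, since neither summand does; by simplicity it is I'.
  have hle : L.ideal₀ F ≤ I' := by
    have h4 : GreenModule.Sub.sum {L.ideal₀ F, I'} = I' := by
      refine (eq_or_eq_of_isSimple hs (le_sum (by simp)) (sum_le ?_)).resolve_right fun h => ?_
      · rintro J (rfl | rfl)
        · exact (ideal₀_lt_ideal hL).le.trans h3
        · exact hlt.le
      · rw [← h] at h1
        obtain ⟨J, rfl | rfl, hJ⟩ := (sum_supports_iff _ L).1 h1
        · exact not_ideal₀_supports_self L hJ
        · exact h2 hJ
    exact h4 ▸ le_sum (by simp)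
  refine ⟨L, hL, ⟨quotientIso h3 hle (fun G _ _ a ha => ?_) fun G _ _ a ha => ?_⟩⟩
  -- e_{L,φ} ∩ I' lies in e⁰_{L,φ}: a group supported by e_{L,φ} and not by e⁰_{L,φ} has β_K
  -- isomorphic to L, which I' does not support.
  · refine (mem_iff _ a).2 fun X hX => ?_
    have h5 := (mem_iff _ a).1 ha.1 X hX
    have h6 := (mem_iff _ a).1 ha.2 X hX
    by_contra h7
    exact h2 (I'.isClosed_supports.of_hasQuotient
      ((beta_isIso_iff (F := F) hL _).2 ⟨h5, h7⟩).symm.hasQuotient ((I'.supports_beta _).2 h6))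
  · rw [← hsup] at ha
    refine (iSup₂_le ?_ : (⨆ N ∈ ({L.ideal F, I'} : Set (FBIdeal F K)), N.obj G) ≤ _) ha
    rintro J (rfl | rfl)
    · exact le_sup_left
    · exact le_sup_right

end FBIdeal

end ShiftedBurnside

open ShiftedBurnside
theorem mainTheorem3 (F : Type v) [Field F] [CharZero F] (K : Type u) [Group K] [Finite K] :
    (∀ L : GroupOver K, L.IsBKGroup →
      -- the unique maximal proper subideal
      (Maximal (fun I : FBIdeal F K => I < L.ideal F) (L.ideal₀ F) ∧
        ∀ J : FBIdeal F K, Maximal (fun I : FBIdeal F K => I < L.ideal F) J → J = L.ideal₀ F) ∧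
      -- simplicity of the quotient
      (L.simpleModule F).IsSimple ∧
      -- bases of the evaluations
      (∀ (G : Type u) [Group G] [Finite G] (𝒜 : Set (Subgroup (G × K))),
        IsSetOfRepresentatives
          (fun X : Subgroup (G × K) => (GroupOver.ofSubgroup X).beta.IsIso L) 𝒜 →
        ∃ b : Module.Basis 𝒜 F ((L.simpleModule F).obj G),
          ∀ X : 𝒜, ∃ h : idem F X.1 ∈ (L.ideal F).obj G,
            b X = GreenModule.Sub.proj (L.ideal F) (L.ideal₀ F) G ⟨idem F X.1, h⟩)) ∧
    -- the simple subquotients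
    (∀ I I' : FBIdeal F K, I' < I → (I.quotient I').IsSimple →
      ∃ L : GroupOver K, L.IsBKGroup ∧
        Nonempty (GreenModule.Iso (I.quotient I') (L.simpleModule F))) := by
  refine ⟨fun L hL => ⟨⟨FBIdeal.maximal_ideal₀ hL, fun J hJ => FBIdeal.eq_ideal₀_of_maximal hL hJ⟩,
    FBIdeal.isSimple_simpleModule hL, fun G _ _ 𝒜 h𝒜 => FBIdeal.exists_basis hL G 𝒜 h𝒜⟩,
    fun I I' hlt hs => FBIdeal.exists_iso_simpleModule hlt hs⟩
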